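/- **Definitions.** All directed graphs are finite and simple (no loops, no parallel edges, no pairs of opposite edges), and their edges are colored, arbitrarily, by $\{0,1,\dots,k\}$. A directed graph $H$ is an *elder graph* if any two distinct vertices $u,v$ for which there is a vertex $x$ with $(u,x),(v,x)\in E(H)$ are adjacent. An *outbranching* is a directed tree with all edges directed away from its root. An *elder vineyard* is a pair $(H,T)$, where $H$ is an elder graph and $T\subseteq H$ is an outbranching with $V(T)=V(H)$ such that for every edge $(t_1,t_2)\in E(H)$ there is a directed path in $T$ from $t_1$ to $t_2$ or from $t_2$ to $t_1$; let $r(T)$ be the root of $T$. A *homomorphism* $\phi:V(H)\to V(G)$ maps every edge $(u,v)$ of $H$ to an edge $(\phi(u),\phi(v))$ of $G$ of the same color. Let $\hom(H,G)$ be the number of homomorphisms from $H$ to $G$, and for $v\in V(G)$ let $\hom((H,T),G,v)$ be the number of those with $\phi(r(T))=v$. *Machine.* Running times are worst-case numbers of steps of a unit-cost random access machine with words of $w$ bits, where $2^w\ge(|V(G)|+2)^K$ for a constant $K$. Its memory is a table, indexed by words, with constant-time access, in which only the nonzero entries are stored (a hash table with constant-time access). Space is the number of stored entries, at every moment of the computation.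 **Theorem.** Let $(H,T)$ be an elder vineyard with edges colored by $\{0,1,\dots,k\}$. There is a data structure (one set of programs) with the following properties for every integer $D\ge 1$, where the constant $K$ and the constants hidden in the $O$-notation depend only on $(H,T)$ and $k$. The data structure represents a directed graph $G$ on a nonempty vertex set $\{0,\dots,|V(G)|-1\}$ with edges colored by $\{0,1,\dots,k\}$ and with maximum in-degree at most $D$, and it supports the following operations, each in time $O(D^{|V(H)|^2})$: 1. addition of an edge $e$ of a given color such that the maximum in-degree of $G+e$ is at most $D$; 2. reorientation of an edge (keeping its color) such that the maximum in-degree of the resulting graph is at most $D$; 3. removal or recoloring of an edge. At any time, it determines $\hom(H,G)$, and $\hom((H,T),G,v)$ for any given vertex $v\in V(G)$, in time $O(1)$. It can be built from a list of the colored edges of $G$ in time $O(D^{|V(H)|^2+1}|V(G)|)$, and its space complexity (including the space used while it is built, updated and queried) is $O(D^{|V(H)|}|V(G)|)$. -/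

import Mathlib

/-! ## Directed graphs with coloured edges, homomorphisms, elder vineyards -/

/-- A simple directed graph on `V` whose edges are coloured by `0, 1, …, k`: `color u v` is the colour
of the edge `(u, v)`, and `none` if `(u, v)` is not an edge.  There are no loops and no pairs of
opposite edges; the colouring is arbitrary. -/
structure ColoredDigraph (k : ℕ) (V : Type*) where
  color : V → V → Option (Fin (k + 1))
  loopless : ∀ v, color v v = none
  asymm : ∀ u v, color u v ≠ none → color v u = none

namespace ColoredDigraph

variable {k : ℕ} {V W : Type*}

/-- `(u, v)` is an edge. -/
def Adj (G : ColoredDigraph k V) (u v : V) : Prop := G.color u v ≠ none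

/-- The maximum in-degree is at most `D`. -/
def InDegreeLE (G : ColoredDigraph k V) (D : ℕ) : Prop :=
  ∀ v, {u | G.Adj u v}.encard ≤ (D : ℕ∞)

/-- `G` is an elder graph: there is no fork, i.e. any two distinct vertices `u`, `v` with a common
out-neighbour `x` are adjacent. -/
def IsElder (G : ColoredDigraph k V) : Prop :=
  ∀ u v x, u ≠ v → G.Adj u x → G.Adj v x → G.Adj u v ∨ G.Adj v u

/-- `φ` is a homomorphism: edges go to edges of the same direction and colour. -/
def IsHom (H : ColoredDigraph k V) (G : ColoredDigraph k W) (φ : V → W) : Prop :=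
  ∀ u v c, H.color u v = some c → G.color (φ u) (φ v) = some c

/-- `hom(H, G)`, the number of homomorphisms from `H` to `G`. -/
noncomputable def hom (H : ColoredDigraph k V) (G : ColoredDigraph k W) : ℕ :=
  {φ : V → W | H.IsHom G φ}.ncard

/-- `hom((H, T), G, v)`, the number of homomorphisms from `H` to `G` that map the root `r` of `T`
to `v`. -/
noncomputable def homAt (H : ColoredDigraph k V) (r : V) (G : ColoredDigraph k W) (v : W) : ℕ :=
  {φ : V → W | H.IsHom G φ ∧ φ r = v}.ncard

end ColoredDigraph

/-- The relation `T` is the edge relation of an outbranching (a directed tree with all edges directed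
away from the root) with root `r` and with vertex set `V`. -/
structure IsOutbranching {V : Type*} (T : V → V → Prop) (r : V) : Prop where
  root : ∀ u, ¬ T u r
  parent : ∀ v, v ≠ r → ∃! u, T u v
  reach : ∀ v, Relation.ReflTransGen T r v

/-- `(H, T)` is an elder vineyard, and `r` is the root of `T`: `H` is an elder graph, `T` is a spanning
outbranching contained in `H`, and the ends of each edge of `H` are joined by a directed path of `T`
in one direction or the other. -/
structure IsElderVineyard {k : ℕ} {V : Type*} (H : ColoredDigraph k V) (T : V → V → Prop) (r : V) :
    Prop where
  elder : H.IsElder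
  outbranching : IsOutbranching T r
  subgraph : ∀ u v, T u v → H.Adj u v
  comparable : ∀ u v, H.Adj u v → Relation.ReflTransGen T u v ∨ Relation.ReflTransGen T v u

/-! ## Updates of the represented graph -/

/-- The updates of a graph with vertices `0, …, n - 1`. -/
inductive GraphUpdate (n k : ℕ) where
  /-- add the edge `(u, v)` with colour `c` -/
  | add (u v : Fin n) (c : Fin (k + 1))
  /-- remove the edge `(u, v)` -/
  | remove (u v : Fin n)
  /-- replace the edge `(u, v)` by `(v, u)`, keeping its colour -/
  | reorient (u v : Fin n)
  /-- change the colour of the edge `(u, v)` to `c` -/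
  | recolor (u v : Fin n) (c : Fin (k + 1))

/-- The update can be performed in `G` and turns `G` into `G'`. -/
def GraphUpdate.Turns {n k : ℕ} (G G' : ColoredDigraph k (Fin n)) : GraphUpdate n k → Prop
  | .add u v c => u ≠ v ∧ ¬ G.Adj u v ∧ ¬ G.Adj v u ∧
      ∀ a b, G'.color a b = if a = u ∧ b = v then some c else G.color a b
  | .remove u v => G.Adj u v ∧
      ∀ a b, G'.color a b = if a = u ∧ b = v then none else G.color a b
  | .reorient u v => G.Adj u v ∧
      ∀ a b, G'.color a b = if a = u ∧ b = v then none
        else if a = v ∧ b = u then G.color u v else G.color a b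
  | .recolor u v c => G.Adj u v ∧
      ∀ a b, G'.color a b = if a = u ∧ b = v then some c else G.color a b

/-- The list `es` enumerates the edges `(u, v)` of `G` with their colours `c` as triples `(u, v, c)`,
each edge once. -/
def ListsEdges {n k : ℕ} (es : List (Fin n × Fin n × Fin (k + 1))) (G : ColoredDigraph k (Fin n)) :
    Prop :=
  es.Nodup ∧ ∀ u v c, (u, v, c) ∈ es ↔ G.color u v = some c

/-! ## The machine: a unit-cost RAM with words of `w` bits -/

namespace WordRAM

/-- The binary operations on words. -/
inductive BinOp where
  | add | sub | mul | div | lt | eq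

/-- Addition and multiplication are modulo `2 ^ w`, subtraction is cut off at `0`, division is rounded
down, comparisons give `0` or `1`. -/
def BinOp.eval (w : ℕ) : BinOp → ℕ → ℕ → ℕ
  | .add, a, b => (a + b) % 2 ^ w
  | .sub, a, b => a - b
  | .mul, a, b => (a * b) % 2 ^ w
  | .div, a, b => a / b
  | .lt, a, b => if a < b then 1 else 0
  | .eq, a, b => if a = b then 1 else 0

/-- Programs.  The arguments `x y z` are names of registers; a program uses only the finitely many
registers that occur in it. -/
inductive Prog where
  | skip
  /-- `x := a` -/
  | const (x a : ℕ)
  /-- `x := y ∘ z` for the binary operation `∘` -/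
  | op (o : BinOp) (x y z : ℕ)
  /-- `x := mem[y]` -/
  | load (x y : ℕ)
  /-- `mem[x] := y` -/
  | store (x y : ℕ)
  | seq (p q : Prog)
  /-- if `x ≠ 0` then `p` else `q` -/
  | ite (x : ℕ) (p q : Prog)
  /-- while `x ≠ 0` do `p` -/
  | loop (x : ℕ) (p : Prog)

/-- A state of the machine: the registers and the memory.  The memory is a table that maps words
(addresses, keys) to words; only its nonzero entries are stored, and looking up a key that is not stored
gives `0`. -/
structure State where
  reg : ℕ → ℕ
  mem : ℕ →₀ ℕ

/-- The space in use: the number of stored (nonzero) entries of the memory. -/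
def State.space (s : State) : ℕ := s.mem.support.card

def State.setReg (s : State) (x a : ℕ) : State := { s with reg := Function.update s.reg x a }

noncomputable def State.setMem (s : State) (x a : ℕ) : State := { s with mem := s.mem.update x a }

/-- `Exec w S p s t s'`: on a machine with words of `w` bits, the program `p` started in the state `s`
halts in the state `s'` after exactly `t` steps, and no write makes the space in use exceed `S`. -/
inductive Exec (w S : ℕ) : Prog → State → ℕ → State → Prop
  | skip (s : State) : Exec w S .skip s 1 s
  | const (s : State) (x a : ℕ) : Exec w S (.const x a) s 1 (s.setReg x (a % 2 ^ w))
  | op (s : State) (o : BinOp) (x y z : ℕ) :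
      Exec w S (.op o x y z) s 1 (s.setReg x (o.eval w (s.reg y) (s.reg z)))
  | load (s : State) (x y : ℕ) : Exec w S (.load x y) s 1 (s.setReg x (s.mem (s.reg y)))
  | store (s : State) (x y : ℕ) (h : (s.setMem (s.reg x) (s.reg y)).space ≤ S) :
      Exec w S (.store x y) s 1 (s.setMem (s.reg x) (s.reg y))
  | seq {p q : Prog} {s s' s'' : State} {t t' : ℕ} (hp : Exec w S p s t s')
      (hq : Exec w S q s' t' s'') : Exec w S (.seq p q) s (t + t') s''
  | ite_pos {x : ℕ} {p q : Prog} {s s' : State} {t : ℕ} (hx : s.reg x ≠ 0)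
      (hp : Exec w S p s t s') : Exec w S (.ite x p q) s (t + 1) s'
  | ite_neg {x : ℕ} {p q : Prog} {s s' : State} {t : ℕ} (hx : s.reg x = 0)
      (hq : Exec w S q s t s') : Exec w S (.ite x p q) s (t + 1) s'
  | loop_end {x : ℕ} {p : Prog} {s : State} (hx : s.reg x = 0) : Exec w S (.loop x p) s 1 s
  | loop_step {x : ℕ} {p : Prog} {s s' s'' : State} {t t' : ℕ} (hx : s.reg x ≠ 0)
      (hp : Exec w S p s t s') (hl : Exec w S (.loop x p) s' t' s'') :
      Exec w S (.loop x p) s (t + t' + 1) s''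

/-- The arguments `a`, `b`, `c` of an operation are handed over in the registers `0`, `1`, `2`;
everything else is kept. -/
def State.withArgs (s : State) (a b c : ℕ) : State := ((s.setReg 0 a).setReg 1 b).setReg 2 c

/-- The input of the building procedure: register `0` holds the number `n` of vertices, register `1` the
number of edges, the memory cells `3 i`, `3 i + 1`, `3 i + 2` hold the tail, the head and the colour of
the `i`-th edge, and everything else is `0`. -/
def input {n k : ℕ} (es : List (Fin n × Fin n × Fin (k + 1))) : State where
  reg := fun x => if x = 0 then n else if x = 1 then es.length else 0
  mem := (es.flatMap fun e => [e.1.val, e.2.1.val, e.2.2.val]).toFinsupp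

end WordRAM

/-! ## Dynamic data structures -/

/-- The procedures of the data structure. -/
structure DynamicStructure where
  build : WordRAM.Prog
  add : WordRAM.Prog
  remove : WordRAM.Prog
  reorient : WordRAM.Prog
  recolor : WordRAM.Prog
  /-- the query for the number of all homomorphisms -/
  queryAll : WordRAM.Prog
  /-- the query for the number of homomorphisms that map the root to a given vertex -/
  queryAt : WordRAM.Prog

namespace DynamicStructure

open WordRAM

/-- The procedure that performs an update. -/
def updateProg (P : DynamicStructure) {n k : ℕ} : GraphUpdate n k → Prog
  | .add _ _ _ => P.add
  | .remove _ _ => P.remove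
  | .reorient _ _ => P.reorient
  | .recolor _ _ _ => P.recolor

/-- The state in which the procedure for an update is started. -/
def updateCall (s : State) {n k : ℕ} : GraphUpdate n k → State
  | .add u v c => s.withArgs u v c
  | .remove u v => s.withArgs u v 0
  | .reorient u v => s.withArgs u v 0
  | .recolor u v c => s.withArgs u v c

/-- `P.Represents w D G s`: the state `s` can arise as the representation of `G`, i.e. it results from
building the structure for some graph of maximum in-degree at most `D`, followed by an arbitrary finite
sequence of updates and queries that keep the maximum in-degree at most `D` and lead to `G`. -/
inductive Represents (P : DynamicStructure) {n k : ℕ} (w D : ℕ) :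
    ColoredDigraph k (Fin n) → State → Prop
  | build {G : ColoredDigraph k (Fin n)} {es : List (Fin n × Fin n × Fin (k + 1))} {S t : ℕ}
      {s : State} (hD : G.InDegreeLE D) (hes : ListsEdges es G)
      (hrun : Exec w S P.build (input es) t s) : Represents P w D G s
  | update {G G' : ColoredDigraph k (Fin n)} {o : GraphUpdate n k} {S t : ℕ} {s s' : State}
      (h : Represents P w D G s) (ho : o.Turns G G') (hD : G'.InDegreeLE D)
      (hrun : Exec w S (P.updateProg o) (updateCall s o) t s') : Represents P w D G' s'
  | queryAll {G : ColoredDigraph k (Fin n)} {S t : ℕ} {s s' : State}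
      (h : Represents P w D G s) (hrun : Exec w S P.queryAll s t s') : Represents P w D G s'
  | queryAt {G : ColoredDigraph k (Fin n)} {v : Fin n} {S t : ℕ} {s s' : State}
      (h : Represents P w D G s) (hrun : Exec w S P.queryAt (s.withArgs v 0 0) t s') :
      Represents P w D G s'

end DynamicStructure

/-! For a vertex `c` of `H` let R(c) be the set of vertices reachable from `c`, and call a vertex
outside R(c) with an edge into R(c) a ghost of `c`. The elder property has two consequences. First,
every ghost of `c` has an edge to `c` itself (`IsElder.adj_of_adj_reach`). Second, two vertices that
reach a common vertex are comparable by reachability (`IsElder.reach_or_reach`). Hence the vertices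
of R(c) outside the strong component of `c` split into disjoint sets R(b), where `b` runs over
suitable representatives, the parts of `c` (`IsElder.exists_parts`).

The data structure stores, for every `c`, every vertex `x` of `G` and all images γ of the ghosts of
`c`, the number `cntAt` of extensions of γ to R(c) that send `c` to `x` and respect the edges with
heads in R(c), together with the sums `cnt` over all `x`. If such a number is nonzero, then the
ghosts are sent to in-neighbours of `x` (`adj_of_cntAt_ne_zero`). So there are at most D^|V| nonzero
entries for given `c` and `x`, which gives the space bound, because zero entries are free. The root
reaches everything, so it has no ghosts and its entries are the answers to the queries.

The numbers satisfy a recurrence (`cntAt_eq_sum`): sum over the images of the strong component of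
`c` the indicator that its incoming edges are respected, times the product of the totals of the
parts. Each vertex of the component has a walk to `c` inside the component. Therefore only images
obtained by successive steps to in-neighbours matter, at most D choices per vertex (`exists_comp`,
`sum_contributions`). All entries for given `c` and `x` can thus be recomputed in time
O(D^(2(|V|-1))).

Changes are local. If the colour of a pair (x₀, y₀) changes, possibly from or to absence, then an
entry for `c` and `z` is affected only if some extension uses this pair. The image of a walk from
`c` then leads from `z` to y₀, so `z` is found by fewer than |V| backward steps from y₀
(`cntAt_eq_of_not_backWalk`). An update therefore takes the vertices `c` in an order in which the
strictly reachable ones come first, and refreshes the entries at the ends of all these backward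
walks (`wp_refreshNear`). The exponent of D is at most 3(|V|-1) ≤ |V|². The lists of in-neighbours
used for this must be valid for the old and for the new graph, so an insertion extends the list
before the refresh and a removal shortens it afterwards.

The remainder verifies programs. The judgement `Wp` bounds the time and confines the stored cells to
a fixed finite set, whose size bounds the space. Arithmetic is done modulo 2^w and is exact in the
end because the true values are less than 2^w. Building starts from the edgeless graph and adds the
listed edges one at a time. Finally, determinism of the machine carries the statements about the
constructed runs over to every state in `Represents`. -/

set_option linter.unusedSectionVars false

/-! ### A program logic for the machine: time, space and framing. -/

namespace WordRAM

variable {w S S' t t' : ℕ} {p q : Prog} {s s' s'' : State}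

/-- At most one rule applies to a program in a given state. The two space bounds may differ, since a
bound only forbids stores. This is how an arbitrary run in `Represents` is identified with the run
constructed for it. -/
theorem Exec.deterministic (h : Exec w S p s t s') (h' : Exec w S' p s t' s'') : s' = s'' := by
  induction h generalizing t' s'' with
  | seq _ _ ihp ihq =>
    cases h' with
    | seq hp hq => rw [← ihp hp] at hq; exact ihq hq
  | ite_pos hx _ ih =>
    cases h' with
    | ite_pos _ hp => exact ih hp
    | ite_neg hx' _ => exact absurd hx' hx
  | ite_neg hx _ ih =>
    cases h' with
    | ite_pos hx' _ => exact absurd hx hx'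
    | ite_neg _ hp => exact ih hp
  | loop_end hx =>
    cases h' with
    | loop_end _ => rfl
    | loop_step hx' _ _ => exact absurd hx hx'
  | loop_step hx _ _ ihp ihl =>
    cases h' with
    | loop_end hx' => exact absurd hx' hx
    | loop_step _ hp hl => rw [← ihp hp] at hl; exact ihl hl
  | _ => cases h'; rfl

theorem Exec.mono (h : Exec w S p s t s') (hS : S ≤ S') : Exec w S' p s t s' := by
  induction h with
  | skip => exact .skip _
  | const => exact .const _ _ _
  | op => exact .op _ _ _ _ _
  | load => exact .load _ _ _
  | store s x y h => exact .store _ _ _ (h.trans hS)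
  | seq _ _ h1 h2 => exact .seq h1 h2
  | ite_pos hx _ h => exact .ite_pos hx h
  | ite_neg hx _ h => exact .ite_neg hx h
  | loop_end hx => exact .loop_end hx
  | loop_step hx _ _ h1 h2 => exact .loop_step hx h1 h2

/-- The program `p` contains an instruction that writes to the register `x`. -/
def Prog.Writes : Prog → ℕ → Prop
  | .skip, _ => False
  | .const x _, y => y = x
  | .op _ x _ _, y => y = x
  | .load x _, y => y = x
  | .store _ _, _ => False
  | .seq p q, y => p.Writes y ∨ q.Writes y
  | .ite _ p q, y => p.Writes y ∨ q.Writes y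
  | .loop _ p, y => p.Writes y

@[simp] theorem State.setReg_mem (s : State) (x a : ℕ) : (s.setReg x a).mem = s.mem := rfl

theorem State.setReg_reg (s : State) (x a y : ℕ) :
    (s.setReg x a).reg y = if y = x then a else s.reg y := by
  simp [State.setReg, Function.update_apply]

@[simp] theorem State.setReg_reg_self (s : State) (x a : ℕ) : (s.setReg x a).reg x = a := by
  simp [State.setReg_reg]

theorem State.setReg_reg_ne (s : State) {x y : ℕ} (a : ℕ) (h : y ≠ x) :
    (s.setReg x a).reg y = s.reg y := by
  simp [State.setReg_reg, h]

@[simp] theorem State.setMem_reg (s : State) (x a : ℕ) : (s.setMem x a).reg = s.reg := rfl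

@[simp] theorem State.setMem_mem (s : State) (x a : ℕ) :
    (s.setMem x a).mem = s.mem.update x a := rfl

/-- A syntactic frame rule: loop counters, assigned images and the constants in registers `3` and
`4` survive a subprogram because it contains no instruction that names them as a target. -/
theorem Exec.reg_eq (h : Exec w S p s t s') {x : ℕ} (hx : ¬ p.Writes x) : s'.reg x = s.reg x := by
  induction h with
  | skip => rfl
  | const => exact State.setReg_reg_ne _ _ hx
  | op => exact State.setReg_reg_ne _ _ hx
  | load => exact State.setReg_reg_ne _ _ hx
  | store => rfl
  | seq _ _ h1 h2 =>
    simp only [Prog.Writes, not_or] at hx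
    rw [h2 hx.2, h1 hx.1]
  | ite_pos _ _ h => simp only [Prog.Writes, not_or] at hx; exact h hx.1
  | ite_neg _ _ h => simp only [Prog.Writes, not_or] at hx; exact h hx.2
  | loop_end => rfl
  | loop_step _ _ _ h1 h2 => rw [h2 hx, h1 hx]

/-- Started in `s`, the program `p` halts within `T` steps in a state that satisfies `Q`, and all the
cells that are stored at any moment belong to `A` if those stored in `s` do. -/
def Wp (w : ℕ) (A : Finset ℕ) (p : Prog) (T : ℕ) (Q : State → Prop) (s : State) : Prop :=
  s.mem.support ⊆ A → ∃ t s', t ≤ T ∧ Exec w A.card p s t s' ∧ s'.mem.support ⊆ A ∧ Q s'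

variable {A : Finset ℕ} {T T' T₁ T₂ : ℕ} {Q Q' : State → Prop}

theorem Wp.imp (h : Wp w A p T Q s) (hT : T ≤ T') (hQ : ∀ s', Q s' → Q' s') :
    Wp w A p T' Q' s := fun hs => by
  obtain ⟨t, s', ht, he, hA, hq⟩ := h hs
  exact ⟨t, s', ht.trans hT, he, hA, hQ _ hq⟩

theorem Wp.mono (h : Wp w A p T Q s) (hT : T ≤ T') : Wp w A p T' Q s := h.imp hT fun _ h => h

/-- Registers that are not written to keep their values. -/
theorem Wp.frame (h : Wp w A p T Q s) :
    Wp w A p T (fun s' => Q s' ∧ ∀ x, ¬ p.Writes x → s'.reg x = s.reg x) s := fun hs => by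
  obtain ⟨t, s', ht, he, hA, hq⟩ := h hs
  exact ⟨t, s', ht, he, hA, hq, fun x hx => he.reg_eq hx⟩

theorem wp_skip (h : Q s) : Wp w A .skip 1 Q s := fun hs => ⟨1, s, le_rfl, .skip _, hs, h⟩

theorem wp_const {x a : ℕ} (h : Q (s.setReg x (a % 2 ^ w))) : Wp w A (.const x a) 1 Q s :=
  fun hs => ⟨1, _, le_rfl, .const _ _ _, hs, h⟩

theorem wp_op {o : BinOp} {x y z : ℕ} (h : Q (s.setReg x (o.eval w (s.reg y) (s.reg z)))) :
    Wp w A (.op o x y z) 1 Q s :=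
  fun hs => ⟨1, _, le_rfl, .op _ _ _ _ _, hs, h⟩

theorem wp_load {x y : ℕ} (h : Q (s.setReg x (s.mem (s.reg y)))) : Wp w A (.load x y) 1 Q s :=
  fun hs => ⟨1, _, le_rfl, .load _ _ _, hs, h⟩

/-- Since the stored cells are confined to the fixed set `A`, a store needs only that its address
lies in `A`. No account of the cells currently in use has to be kept. -/
theorem wp_store {x y : ℕ} (hx : s.reg x ∈ A) (h : Q (s.setMem (s.reg x) (s.reg y))) :
    Wp w A (.store x y) 1 Q s := fun hs => by
  have hA : (s.setMem (s.reg x) (s.reg y)).mem.support ⊆ A := by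
    intro a ha
    by_cases e : a = s.reg x
    · exact e ▸ hx
    · apply hs
      simpa [Finsupp.update_apply, e] using ha
  exact ⟨1, _, le_rfl, .store _ _ _ (Finset.card_le_card hA), hA, h⟩

theorem wp_seq (h : Wp w A p T₁ (fun s' => Wp w A q T₂ Q s') s) :
    Wp w A (.seq p q) (T₁ + T₂) Q s := fun hs => by
  obtain ⟨t, s', ht, he, hA, hq⟩ := h hs
  obtain ⟨t', s'', ht', he', hA', hq'⟩ := hq hA
  exact ⟨t + t', s'', add_le_add ht ht', .seq he he', hA', hq'⟩

/-- A loop that counts a register down from `N` to `0`. -/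
theorem wp_countdown {x N : ℕ} (I : ℕ → State → Prop)
    (hI : ∀ j s, j < N → I (j + 1) s → s.reg x = j + 1 →
      Wp w A p T (fun s' => I j s' ∧ s'.reg x = j) s)
    (h : I N s) (hx : s.reg x = N) :
    Wp w A (.loop x p) (N * (T + 1) + 1) (I 0) s := by
  induction N generalizing s with
  | zero => exact fun hs => ⟨1, s, by omega, .loop_end hx, hs, h⟩
  | succ N ih =>
    intro hs
    obtain ⟨t, s', ht, he, hA, hI', hx'⟩ := hI N s (by omega) h hx hs
    obtain ⟨t', s'', ht', he', hA', h0⟩ := ih (fun j s hj => hI j s (by omega)) hI' hx' hA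
    exact ⟨t + t' + 1, s'', by nlinarith, .loop_step (by omega) he he', hA', h0⟩

/-- The programs of a list, one after the other. -/
def seqList : List Prog → Prog
  | [] => .skip
  | p :: l => .seq p (seqList l)

theorem writes_seqList {l : List Prog} {x : ℕ} : (seqList l).Writes x ↔ ∃ p ∈ l, p.Writes x := by
  induction l with
  | nil => simp [seqList, Prog.Writes]
  | cons p l ih => simp [seqList, Prog.Writes, ih]

/-- The invariant is indexed by the processed prefix, not by its length, so that it can refer to the
members already treated. -/
theorem wp_seqList {α : Type*} {l : List α} {f : α → Prog} (I : List α → State → Prop)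
    (hI : ∀ l₁ a l₂ s, l = l₁ ++ a :: l₂ → I l₁ s → Wp w A (f a) T (I (l₁ ++ [a])) s)
    (h : I [] s) : Wp w A (seqList (l.map f)) (l.length * T + 1) (I l) s := by
  suffices ∀ l₂ l₁ s, l = l₁ ++ l₂ → I l₁ s →
      Wp w A (seqList (l₂.map f)) (l₂.length * T + 1) (I l) s from this l [] s rfl h
  intro l₂
  induction l₂ with
  | nil =>
    intro l₁ s e h
    rw [List.append_nil] at e
    exact (wp_skip (e ▸ h)).mono (by simp)
  | cons a l₂ ih =>
    intro l₁ s e h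
    refine (wp_seq ((hI l₁ a l₂ s e h).imp le_rfl fun s' h' => ih (l₁ ++ [a]) s' (by simp [e]) h')).mono ?_
    simp only [List.length_cons]
    ring_nf
    omega

/-! ### Tables indexed by tuples -/

/-- The number `a` followed by the digits `l` to the base `n`. -/
def enc (n : ℕ) (a : ℕ) (l : List ℕ) : ℕ := l.foldl (fun a e => a * n + e) a

/-- The cell of the table `g` (of `M` tables) that holds the entry with the index `l`. -/
def addr (n M g : ℕ) (l : List ℕ) : ℕ := enc n (3 * n * n) l * M + g

theorem le_enc {n : ℕ} (hn : 0 < n) (a : ℕ) (l : List ℕ) : a ≤ enc n a l := by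
  induction l generalizing a with
  | nil => exact le_rfl
  | cons e l ih => exact le_trans (by nlinarith) (ih (a * n + e))

theorem enc_lt {n : ℕ} (a : ℕ) {l : List ℕ} (hl : ∀ e ∈ l, e < n) :
    enc n a l < (a + 1) * n ^ l.length := by
  induction l generalizing a with
  | nil => simp [enc]
  | cons e l ih =>
    have he := hl e (by simp)
    refine lt_of_lt_of_le (ih (a * n + e) fun x hx => hl x (by simp [hx])) ?_
    rw [List.length_cons, pow_succ', ← mul_assoc]
    exact Nat.mul_le_mul_right _ (by nlinarith)

/-- Peeling off the first digit leaves equal values `a * n + e` in front of the remaining digits.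
The residue modulo `n` gives the digit, and cancellation gives the leading number. -/
theorem enc_inj {n a a' : ℕ} {l l' : List ℕ} (hl : ∀ e ∈ l, e < n) (hl' : ∀ e ∈ l', e < n)
    (hlen : l.length = l'.length) (h : enc n a l = enc n a' l') : a = a' ∧ l = l' := by
  induction l generalizing a a' l' with
  | nil =>
    cases l' with
    | nil => exact ⟨h, rfl⟩
    | cons => simp at hlen
  | cons e l ih =>
    cases l' with
    | nil => simp at hlen
    | cons e' l' =>
      obtain ⟨h1, rfl⟩ := ih (a := a * n + e) (a' := a' * n + e') (l' := l') (fun x hx => hl x (by simp [hx])) (fun x hx => hl' x (by simp [hx]))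
        (by simpa using hlen) h
      have he := hl e (by simp)
      have he' := hl' e' (by simp)
      have hee : e = e' := by
        have := congrArg (· % n) h1
        simpa [Nat.mod_eq_of_lt he, Nat.mod_eq_of_lt he', Nat.add_mod] using this
      subst hee
      exact ⟨Nat.eq_of_mul_eq_mul_right (by omega) (Nat.add_right_cancel h1), rfl⟩

/-- The residue modulo `M` is the number of the table. Within a table the lengths of the indices
must agree, because digit strings of different lengths may encode the same number. -/
theorem addr_inj {n M g g' : ℕ} {l l' : List ℕ} (hg : g < M) (hg' : g' < M)
    (hl : ∀ e ∈ l, e < n) (hl' : ∀ e ∈ l', e < n) (hlen : g = g' → l.length = l'.length)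
    (h : addr n M g l = addr n M g' l') : g = g' ∧ l = l' := by
  have h1 : g = g' := by
    have := congrArg (· % M) h
    simpa [addr, Nat.mod_eq_of_lt hg, Nat.mod_eq_of_lt hg', Nat.add_mod] using this
  subst h1
  exact ⟨rfl, (enc_inj hl hl' (hlen rfl)
    (Nat.eq_of_mul_eq_mul_right (by omega) (Nat.add_right_cancel h))).2⟩

/-- The leading number `3 * n * n` lifts all tables above the input, which has at most `n * n` edges
of three cells each. -/
theorem le_addr {n M : ℕ} (hn : 0 < n) (hM : 0 < M) (g : ℕ) (l : List ℕ) :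
    3 * n * n ≤ addr n M g l := by
  have := le_enc hn (3 * n * n) l
  unfold addr
  nlinarith

/-- Append the digits in the registers `rs` to register `6`. -/
def digitsProg : List ℕ → Prog
  | [] => .skip
  | r :: rs => .seq (.op .mul 6 6 3) (.seq (.op .add 6 6 r) (digitsProg rs))

/-- Every operation reduces modulo `2 ^ w`, whereas `enc` does not. It suffices to follow the
register as a residue of the unreduced value, called `a` in the generalization below. -/
theorem wp_digitsProg {n : ℕ} {rs : List ℕ} (h3 : s.reg 3 = n) (hrs : ∀ r ∈ rs, r ≠ 6)
    (h6 : s.reg 6 < 2 ^ w)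
    (h : ∀ s' : State, s'.mem = s.mem → s'.reg 6 = enc n (s.reg 6) (rs.map s.reg) % 2 ^ w →
      (∀ x, x ≠ 6 → s'.reg x = s.reg x) → Q s') :
    Wp w A (digitsProg rs) (2 * rs.length + 1) Q s := by
  suffices ∀ (s₁ : State) (a : ℕ), s₁.mem = s.mem → s₁.reg 6 = a % 2 ^ w →
      (∀ x, x ≠ 6 → s₁.reg x = s.reg x) →
      (∀ s' : State, s'.mem = s.mem → s'.reg 6 = enc n a (rs.map s.reg) % 2 ^ w →
      (∀ x, x ≠ 6 → s'.reg x = s.reg x) → Q s') →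
      Wp w A (digitsProg rs) (2 * rs.length + 1) Q s₁ from
    this s _ rfl (Nat.mod_eq_of_lt h6).symm (fun _ _ => rfl) h
  clear h h6
  induction rs with
  | nil => exact fun s₁ a hm h6 hr h => (wp_skip (h s₁ hm h6 hr)).mono (by simp)
  | cons r rs ih =>
    intro s₁ a hm h6 hr h
    refine Wp.mono (T := 1 + (1 + (2 * rs.length + 1))) (wp_seq (wp_op (wp_seq (wp_op
      (ih (fun x hx => hrs x (by simp [hx])) _ (a * n + s.reg r) ?_ ?_ ?_ ?_)))))
      (by simp; omega)
    · simpa using hm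
    · have hr6 := hrs r (by simp)
      simp only [State.setReg_reg_self, State.setReg_reg_ne _ _ hr6, BinOp.eval, hr r hr6, h6,
        hr 3 (by norm_num), h3]
      simp [Nat.add_mod, Nat.mul_mod]
    · intro x hx
      rw [State.setReg_reg_ne _ _ hx, State.setReg_reg_ne _ _ hx, hr x hx]
    · exact h

/-- Compute in register `6` the cell of the table `g` for the index in the registers `rs`. -/
def keyProg (M g : ℕ) (rs : List ℕ) : Prog :=
  .seq (.const 5 0) (.seq (.op .add 6 4 5) (.seq (digitsProg rs)
    (.seq (.const 5 M) (.seq (.op .mul 6 6 5) (.seq (.const 5 g) (.op .add 6 6 5))))))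

/-- The result is exact although the computation is modular, because the address itself is less than
`2 ^ w`. Registers `5` and `6` are scratch and must not hold digits. -/
theorem wp_keyProg {n M g : ℕ} {rs l : List ℕ} (h3 : s.reg 3 = n) (h4 : s.reg 4 = 3 * n * n)
    (hrs : ∀ r ∈ rs, 6 < r ∨ r < 5) (hl : rs.map s.reg = l) (hb : addr n M g l < 2 ^ w)
    (hz : 3 * n * n < 2 ^ w)
    (h : ∀ s' : State, s'.mem = s.mem → s'.reg 6 = addr n M g l →
      (∀ x, x ≠ 5 → x ≠ 6 → s'.reg x = s.reg x) → Q s') :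
    Wp w A (keyProg M g rs) (2 * rs.length + 7) Q s := by
  refine Wp.mono (T := 1 + (1 + ((2 * rs.length + 1) + (1 + (1 + (1 + 1)))))) (wp_seq (wp_const
    (wp_seq (wp_op (wp_seq (wp_digitsProg (n := n) ?_ ?_ ?_
    (fun s' hm h6 hr => wp_seq (wp_const (wp_seq (wp_op (wp_seq (wp_const (wp_op
      (h _ ?_ ?_ ?_))))))))))))))
    (by omega)
  · simp [State.setReg_reg, h3]
  · intro r hr; have := hrs r hr; omega
  · simp [BinOp.eval, Nat.mod_lt]
  · simpa using hm
  · have e : (List.map ((s.setReg 5 (0 % 2 ^ w)).setReg 6 (BinOp.add.eval w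
        ((s.setReg 5 (0 % 2 ^ w)).reg 4) ((s.setReg 5 (0 % 2 ^ w)).reg 5))).reg rs) = l := by
      rw [← hl]
      refine List.map_congr_left fun r hr => ?_
      have := hrs r hr
      rw [State.setReg_reg_ne _ _ (by omega), State.setReg_reg_ne _ _ (by omega)]
    rw [e] at h6
    simp only [State.setReg_reg_self, BinOp.eval] at h6
    simp only [State.setReg_reg, BinOp.eval]
    norm_num [h6, State.setReg_reg, h4, Nat.mod_eq_of_lt hz]
    exact Nat.mod_eq_of_lt hb
  · intro x h5 h6
    simp [State.setReg_reg, h5, h6, hr]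

theorem writes_digitsProg {rs : List ℕ} {x : ℕ} (h : (digitsProg rs).Writes x) : x = 6 := by
  induction rs with
  | nil => exact h.elim
  | cons r rs ih =>
    simp only [digitsProg, Prog.Writes] at h
    tauto

theorem writes_keyProg {M g : ℕ} {rs : List ℕ} {x : ℕ} (h : (keyProg M g rs).Writes x) :
    x = 5 ∨ x = 6 := by
  simp only [keyProg, Prog.Writes] at h
  have := @writes_digitsProg rs x
  tauto

/-- Load the entry of the table `g` with the index in the registers `rs` into register `x`. -/
def loadAt (x M g : ℕ) (rs : List ℕ) : Prog := .seq (keyProg M g rs) (.load x 6)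

theorem wp_loadAt {n M g x : ℕ} {rs l : List ℕ} (h3 : s.reg 3 = n) (h4 : s.reg 4 = 3 * n * n)
    (hrs : ∀ r ∈ rs, 6 < r ∨ r < 5) (hl : rs.map s.reg = l) (hb : addr n M g l < 2 ^ w)
    (hz : 3 * n * n < 2 ^ w)
    (h : ∀ s' : State, s'.mem = s.mem → s'.reg x = s.mem (addr n M g l) →
      (∀ y, y ≠ 5 → y ≠ 6 → y ≠ x → s'.reg y = s.reg y) → Q s') :
    Wp w A (loadAt x M g rs) (2 * rs.length + 8) Q s := by
  refine wp_seq (T₁ := 2 * rs.length + 7) (T₂ := 1) (wp_keyProg h3 h4 hrs hl hb hz fun s' hm h6 hr => wp_load (h _ ?_ ?_ ?_))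
  · simpa using hm
  · simp [h6, hm]
  · intro y h5 h6 hx
    rw [State.setReg_reg_ne _ _ hx, hr y h5 h6]

theorem writes_loadAt {x M g : ℕ} {rs : List ℕ} {y : ℕ} (h : (loadAt x M g rs).Writes y) :
    y = 5 ∨ y = 6 ∨ y = x := by
  simp only [loadAt, Prog.Writes] at h
  have := @writes_keyProg M g rs y
  tauto

/-- Store register `x` as the entry of the table `g` with the index in the registers `rs`. -/
def storeAt (M g : ℕ) (rs : List ℕ) (x : ℕ) : Prog := .seq (keyProg M g rs) (.store 6 x)

theorem wp_storeAt {n M g x : ℕ} {rs l : List ℕ} (h3 : s.reg 3 = n) (h4 : s.reg 4 = 3 * n * n)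
    (hrs : ∀ r ∈ rs, 6 < r ∨ r < 5) (hl : rs.map s.reg = l) (hb : addr n M g l < 2 ^ w)
    (hz : 3 * n * n < 2 ^ w) (hx : 6 < x ∨ x < 5) (hA : addr n M g l ∈ A)
    (h : ∀ s' : State, s'.mem = s.mem.update (addr n M g l) (s.reg x) →
      (∀ y, y ≠ 5 → y ≠ 6 → s'.reg y = s.reg y) → Q s') :
    Wp w A (storeAt M g rs x) (2 * rs.length + 8) Q s := by
  refine wp_seq (T₁ := 2 * rs.length + 7) (T₂ := 1) (wp_keyProg h3 h4 hrs hl hb hz fun s' hm h6 hr => wp_store (h6 ▸ hA) (h _ ?_ ?_))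
  · simp [hm, h6, hr x (by omega) (by omega)]
  · intro y h5 h6
    simpa using hr y h5 h6

theorem writes_storeAt {x M g : ℕ} {rs : List ℕ} {y : ℕ} (h : (storeAt M g rs x).Writes y) :
    y = 5 ∨ y = 6 := by
  simp only [storeAt, Prog.Writes, or_false] at h
  exact writes_keyProg h

/-- Copy register `y` to register `x`. -/
def move (x y : ℕ) : Prog := .seq (.const 5 0) (.op .add x y 5)

theorem wp_move {x y : ℕ} (hy : y ≠ 5) (hb : s.reg y < 2 ^ w)
    (h : ∀ s' : State, s'.mem = s.mem → s'.reg x = s.reg y →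
      (∀ z, z ≠ 5 → z ≠ x → s'.reg z = s.reg z) → Q s') :
    Wp w A (move x y) 2 Q s := by
  refine wp_seq (T₁ := 1) (T₂ := 1) (wp_const (wp_op (h _ rfl ?_ ?_)))
  · simp [State.setReg_reg, hy, BinOp.eval, Nat.mod_eq_of_lt hb]
  · intro z h5 hx
    simp [State.setReg_reg, h5, hx]

theorem writes_move {x y z : ℕ} (h : (move x y).Writes z) : z = 5 ∨ z = x := by
  simpa [move, Prog.Writes] using h

end WordRAM

/-! ### Reachability in elder graphs and the recurrence for extension counts. -/

namespace ColoredDigraph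

section Counting

open scoped Classical

variable {k : ℕ} {V W : Type*} (H : ColoredDigraph k V) (G : ColoredDigraph k W)

/-- There is a directed walk from `u` to `v`. -/
def Reach (u v : V) : Prop := Relation.ReflTransGen H.Adj u v

variable {H}

/-- In an elder graph, the vertices that reach a given vertex are pairwise comparable. -/
theorem IsElder.reach_or_of_adj (hH : H.IsElder) {u x w : V} (hu : H.Reach u x) (hw : H.Adj w x) :
    H.Reach u w ∨ H.Reach w u := by
  induction hu generalizing w with
  | refl => exact .inr (.single hw)
  | @tail y x hy hyx ih =>
    by_cases h : w = y
    · exact .inl (h ▸ hy)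
    · rcases hH w y x h hw hyx with h | h
      · exact ih h
      · exact .inl (hy.tail h)

/-- Move the common target back along the walk from `u`. Its last edge enters `x` from some `w`, and
`v` is comparable with `w` by the preceding lemma: either `v` reaches `w` and induction applies, or
`u` reaches `v` through `w`. -/
theorem IsElder.reach_or_reach (hH : H.IsElder) {u v x : V} (hu : H.Reach u x) (hv : H.Reach v x) :
    H.Reach u v ∨ H.Reach v u := by
  induction hu generalizing v with
  | refl => exact .inr hv
  | tail hw hwx ih =>
    rcases hH.reach_or_of_adj hv hwx with h | h
    · exact ih h
    · exact .inl (hw.trans h)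

/-- A vertex outside of the set of the vertices reachable from `c` that has an edge to it has an edge
to `c`. -/
theorem IsElder.adj_of_adj_reach (hH : H.IsElder) {g b c : V} (hb : H.Reach c b) (hg : H.Adj g b)
    (hc : ¬ H.Reach c g) : H.Adj g c := by
  induction hb with
  | refl => exact hg
  | @tail a b ha hab ih =>
    have hne : g ≠ a := fun e => hc (e ▸ ha)
    -- Both `g` and the predecessor `a` of `b` on the walk point to `b`, so they are adjacent. An
    -- edge from `a` to `g` would make `g` reachable from `c`, so the edge goes from `g` to `a`, one
    -- step closer to `c`.
    rcases hH g a b hne hg hab with h | h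
    · exact ih h
    · exact absurd (ha.tail h) hc

variable (H)

/-- `φ` respects the edges of `H` with heads in `S`. -/
def RespectsInto (S : Set V) (φ : V → W) : Prop :=
  ∀ a b i, H.color a b = some i → b ∈ S → G.color (φ a) (φ b) = some i

variable {H G}

theorem RespectsInto.congr {S : Set V} {φ ψ : V → W} (h : H.RespectsInto G S φ)
    (ht : ∀ b ∈ S, φ b = ψ b) (hs : ∀ a, ∀ b ∈ S, H.Adj a b → φ a = ψ a) :
    H.RespectsInto G S ψ := fun a b i hi hb => by
  rw [← ht b hb, ← hs a b hb (by simp [Adj, hi])]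
  exact h a b i hi hb

variable (H G)
variable [Fintype V] [Fintype W]

/-- The extensions of `γ` to the vertices reachable from `c`. -/
noncomputable def extensions (c : V) (γ : V → W) : Finset (V → W) :=
  Finset.univ.filter fun φ => (∀ v, ¬ H.Reach c v → φ v = γ v) ∧ H.RespectsInto G {v | H.Reach c v} φ

/-- The number of the extensions of `γ` to the vertices reachable from `c`. -/
noncomputable def cnt (c : V) (γ : V → W) : ℕ := (H.extensions G c γ).card

/-- The number of the extensions of `γ` to the vertices reachable from `c` that map `c` to `x`. -/
noncomputable def cntAt (c : V) (x : W) (γ : V → W) : ℕ :=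
  ((H.extensions G c γ).filter fun φ => φ c = x).card

variable {H G}

theorem mem_extensions {c : V} {γ φ : V → W} : φ ∈ H.extensions G c γ ↔
    (∀ v, ¬ H.Reach c v → φ v = γ v) ∧ H.RespectsInto G {v | H.Reach c v} φ := by
  simp [extensions]

theorem cnt_eq_sum (c : V) (γ : V → W) : H.cnt G c γ = ∑ x, H.cntAt G c x γ :=
  Finset.card_eq_sum_card_fiberwise fun _ _ => Finset.mem_coe.2 (Finset.mem_univ _)

theorem cntAt_le (c : V) (x : W) (γ : V → W) :
    H.cntAt G c x γ ≤ Fintype.card W ^ Fintype.card V := by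
  refine (Finset.card_le_univ _).trans ?_
  simp

/-- Only the images of the ghosts enter the conditions, so a table indexed by these images can hold
all the numbers. -/
theorem cntAt_congr {c : V} (x : W) {γ γ' : V → W}
    (h : ∀ g b, ¬ H.Reach c g → H.Reach c b → H.Adj g b → γ g = γ' g) :
    H.cntAt G c x γ = H.cntAt G c x γ' := by
  suffices ∀ γ γ' : V → W, (∀ g b, ¬ H.Reach c g → H.Reach c b → H.Adj g b → γ g = γ' g) →
      H.cntAt G c x γ ≤ H.cntAt G c x γ' from
    le_antisymm (this _ _ h) (this _ _ fun g b h1 h2 h3 => (h g b h1 h2 h3).symm)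
  clear h γ γ'
  intro γ γ' h
  -- Keep the extension on the reachable set and replace `γ` by `γ'` elsewhere. This is injective
  -- because extensions are fixed off the reachable set.
  refine Finset.card_le_card_of_injOn (fun φ v => if H.Reach c v then φ v else γ' v) ?_ ?_
  · intro φ hφ
    simp only [Finset.coe_filter, mem_extensions, Set.mem_ofPred_eq] at hφ ⊢
    obtain ⟨⟨h1, h2⟩, h3⟩ := hφ
    refine ⟨⟨fun v hv => by simp [hv], h2.congr ?_ ?_⟩, ?_⟩
    · intro b hb
      simp only [Set.mem_ofPred_eq] at hb
      simp [hb]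
    · intro a b hb hab
      by_cases ha : H.Reach c a
      · simp [ha]
      · simp [ha, h1 a ha, h a b ha hb hab]
    · rw [if_pos (show H.Reach c c from .refl), h3]
  · intro φ hφ ψ hψ e
    simp only [Finset.coe_filter, mem_extensions, Set.mem_ofPred_eq] at hφ hψ
    funext v
    by_cases hv : H.Reach c v
    · simpa [hv] using congrFun e v
    · rw [hφ.1.1 v hv, hψ.1.1 v hv]

/-- The source of sparsity: any extension counted here respects the edge from the ghost to `c`. -/
theorem adj_of_cntAt_ne_zero {c g : V} {x : W} {γ : V → W} (h : H.cntAt G c x γ ≠ 0)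
    (hg : ¬ H.Reach c g) (hgc : H.Adj g c) : G.Adj (γ g) x := by
  obtain ⟨φ, hφ⟩ := Finset.card_ne_zero.1 h
  simp only [Finset.mem_filter, mem_extensions] at hφ
  obtain ⟨⟨h1, h2⟩, rfl⟩ := hφ
  obtain ⟨i, hi⟩ := Option.ne_none_iff_exists'.1 hgc
  have := h2 g c i hi (show H.Reach c c from .refl)
  rw [h1 g hg] at this
  simp [Adj, this]

/-- If predicates restrict maps on disjoint blocks, given the values outside of the blocks, then the
numbers of maps multiply. -/
theorem card_blocks {ι : Type*} (s : Finset ι) (B : ι → Set V) (P : ι → (V → W) → Prop) (θ : V → W)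
    (hB : ∀ i ∈ s, ∀ j ∈ s, i ≠ j → Disjoint (B i) (B j))
    (hP : ∀ i ∈ s, ∀ φ ψ : V → W, (∀ v, (∀ j ∈ s, j ≠ i → v ∉ B j) → φ v = ψ v) → P i φ → P i ψ) :
    (Finset.univ.filter fun φ : V → W => (∀ v, (∀ i ∈ s, v ∉ B i) → φ v = θ v) ∧
      ∀ i ∈ s, P i φ).card =
    ∏ i ∈ s, (Finset.univ.filter fun φ : V → W => (∀ v, v ∉ B i → φ v = θ v) ∧ P i φ).card := by
  induction s using Finset.induction_on with
  | empty =>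
    simp only [Finset.notMem_empty, IsEmpty.forall_iff, implies_true, and_true, Finset.prod_empty,
      forall_true_left, Finset.card_eq_one]
    exact ⟨θ, by ext φ; simp [funext_iff]⟩
  | insert i s hi ih =>
    have hne : ∀ j ∈ s, j ≠ i := fun j hj e => hi (e ▸ hj)
    rw [Finset.prod_insert hi, ← ih
      (fun a ha b hb => hB a (Finset.mem_insert_of_mem ha) b (Finset.mem_insert_of_mem hb))
      (fun a ha φ ψ h => hP a (Finset.mem_insert_of_mem ha) φ ψ fun v hv => h v fun j hj hja =>
        hv j (Finset.mem_insert_of_mem hj) hja), ← Finset.card_product]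
    have hdis : ∀ v ∈ B i, ∀ j ∈ s, v ∉ B j := fun v hv j hj hvj =>
      Set.disjoint_left.1 (hB i (by simp) j (Finset.mem_insert_of_mem hj) (hne j hj).symm) hv hvj
    -- Cut a map into its values on the block of `i` and its values on the other blocks, filling
    -- each piece up with `θ`. Predicates cannot see the other blocks, so they survive the cut and
    -- the gluing.
    refine Finset.card_bij' (fun φ _ => (fun v => if v ∈ B i then φ v else θ v,
      fun v => if v ∈ B i then θ v else φ v)) (fun p _ v => if v ∈ B i then p.1 v else p.2 v)
      ?_ ?_ ?_ ?_
    · intro φ hφ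
      simp only [Finset.mem_filter, Finset.mem_univ, true_and, Finset.mem_product,
        Finset.forall_mem_insert] at hφ ⊢
      obtain ⟨h1, h2, h3⟩ := hφ
      refine ⟨⟨fun v hv => by simp [hv], ?_⟩, ⟨fun v hv => ?_, fun j hj => ?_⟩⟩
      · refine hP i (by simp) _ _ (fun v hv => ?_) h2
        by_cases h : v ∈ B i
        · simp [h]
        · simp only [h, if_false]
          exact h1 v ⟨h, fun j hj => hv j (Finset.mem_insert_of_mem hj) (hne j hj)⟩
      · by_cases h : v ∈ B i
        · simp [h]
        · simp only [h, if_false]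
          exact h1 v ⟨h, hv⟩
      · refine hP j (Finset.mem_insert_of_mem hj) _ _ (fun v hv => ?_) (h3 j hj)
        simp [hv i (by simp) (hne j hj).symm]
    · intro p hp
      simp only [Finset.mem_filter, Finset.mem_univ, true_and, Finset.mem_product,
        Finset.forall_mem_insert] at hp ⊢
      obtain ⟨⟨h1, h2⟩, h3, h4⟩ := hp
      refine ⟨fun v hv => by simp [hv.1, h3 v hv.2], ?_, fun j hj => ?_⟩
      · refine hP i (by simp) _ _ (fun v hv => ?_) h2
        by_cases h : v ∈ B i
        · simp [h]
        · simp only [h, if_false]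
          rw [h1 v h, h3 v fun j hj => hv j (Finset.mem_insert_of_mem hj) (hne j hj)]
      · refine hP j (Finset.mem_insert_of_mem hj) _ _ (fun v hv => ?_) (h4 j hj)
        simp [hv i (by simp) (hne j hj).symm]
    · intro φ _
      funext v
      by_cases h : v ∈ B i <;> simp [h]
    · intro p hp
      simp only [Finset.mem_filter, Finset.mem_univ, true_and, Finset.mem_product] at hp
      obtain ⟨⟨h1, h2⟩, h3, h4⟩ := hp
      refine Prod.ext (funext fun v => ?_) (funext fun v => ?_)
      · by_cases h : v ∈ B i <;> simp [h, h1 v]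
      · by_cases h : v ∈ B i
        · simp [h, h3 v (hdis v h)]
        · simp [h]

/-- The number of extensions that map `c` to `x` is determined by the numbers of extensions to the
vertices reachable from suitable vertices outside of the strong component of `c`. -/
theorem cntAt_eq_sum (c : V) (x : W) (γ : V → W) (ch : Finset V)
    (hcover : ∀ v, (∃ b ∈ ch, H.Reach b v) ↔ H.Reach c v ∧ ¬ H.Reach v c)
    (hdisj : ∀ b ∈ ch, ∀ b' ∈ ch, b ≠ b' → ∀ v, H.Reach b v → ¬ H.Reach b' v) :
    H.cntAt G c x γ = ∑ θ ∈ Finset.univ.filter (fun θ : V → W =>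
        (∀ v, ¬ (H.Reach c v ∧ H.Reach v c ∧ v ≠ c) → θ v = Function.update γ c x v)),
      (if H.RespectsInto G {v | H.Reach c v ∧ H.Reach v c} θ then 1 else 0) *
        ∏ b ∈ ch, H.cnt G b θ := by
  have hU : ∀ b ∈ ch, ∀ v, H.Reach b v → H.Reach c v ∧ ¬ H.Reach v c :=
    fun b hb v hv => (hcover v).1 ⟨b, hb, hv⟩
  -- The product counts the simultaneous extensions of `θ` to all parts.
  have key : ∀ θ : V → W, ∏ b ∈ ch, H.cnt G b θ = (Finset.univ.filter fun φ : V → W =>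
      (∀ v, (∀ b ∈ ch, v ∉ {v | H.Reach b v}) → φ v = θ v) ∧
        ∀ b ∈ ch, H.RespectsInto G {v | H.Reach b v} φ).card := fun θ => by
    have := card_blocks ch (fun b => {v | H.Reach b v})
      (fun b φ => H.RespectsInto G {v | H.Reach b v} φ) θ ?_ ?_
    · refine (Finset.prod_congr rfl fun b _ => ?_).trans (this.symm.trans ?_)
      · simp only [cnt, extensions, Set.mem_ofPred_eq]
      · congr!
    · exact fun b hb b' hb' hne => Set.disjoint_left.2 fun v => hdisj b hb b' hb' hne v
    · intro b hb φ ψ h hφ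
      refine hφ.congr (fun v hv => h v fun b' hb' hne => hdisj b hb b' hb' hne.symm v hv)
        (fun a v hv hav => h a fun b' hb' hne ha => ?_)
      -- A tail inside another part would make its head `v` reachable from both representatives.
      exact hdisj b hb b' hb' hne.symm v hv (Relation.ReflTransGen.tail ha hav)
  simp_rw [key]
  -- Group the extensions by their values on the strong component. To remain a total map, the label
  -- `θ` of a group takes the irrelevant values `γ` on the parts.
  rw [cntAt, Finset.card_eq_sum_card_fiberwise (f := fun φ v =>
    if H.Reach c v ∧ ¬ H.Reach v c then γ v else φ v)
    (t := Finset.univ.filter (fun θ : V → W =>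
        (∀ v, ¬ (H.Reach c v ∧ H.Reach v c ∧ v ≠ c) → θ v = Function.update γ c x v)))]
  · refine Finset.sum_congr rfl fun θ hθ => ?_
    simp only [Finset.mem_filter, Finset.mem_univ, true_and] at hθ
    have hnU : ∀ v, (∀ b ∈ ch, v ∉ {v | H.Reach b v}) ↔ ¬ (H.Reach c v ∧ ¬ H.Reach v c) := by
      intro v
      rw [← hcover v]
      simp
    -- An edge whose head is in the strong component has a tail that reaches `c`, hence a tail
    -- outside the parts. So this condition is constant on each group and becomes the indicator
    -- factor.
    have hQ : ∀ φ : V → W, (∀ v, ¬ (H.Reach c v ∧ ¬ H.Reach v c) → φ v = θ v) →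
        (H.RespectsInto G {v | H.Reach c v ∧ H.Reach v c} φ ↔
          H.RespectsInto G {v | H.Reach c v ∧ H.Reach v c} θ) := by
      intro φ hφ
      have e1 : ∀ b ∈ {v | H.Reach c v ∧ H.Reach v c}, φ b = θ b :=
        fun b hb => hφ b fun h => h.2 hb.2
      have e2 : ∀ a, ∀ b ∈ {v | H.Reach c v ∧ H.Reach v c}, H.Adj a b → φ a = θ a :=
        fun a b hb hab => hφ a fun h => h.2 (Relation.ReflTransGen.head hab hb.2)
      exact ⟨fun h => h.congr e1 e2, fun h => h.congr (fun b hb => (e1 b hb).symm)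
        fun a b hb hab => (e2 a b hb hab).symm⟩
    by_cases hr : H.RespectsInto G {v | H.Reach c v ∧ H.Reach v c} θ
    · rw [if_pos hr, one_mul]
      congr 1
      ext φ
      simp only [Finset.mem_filter, Finset.mem_univ, true_and, mem_extensions, hnU]
      constructor
      · rintro ⟨⟨⟨h1, h2⟩, h3⟩, rfl⟩
        refine ⟨fun v hv => by simp only [hv, if_false], fun b hb a v i hi hv => ?_⟩
        exact h2 a v i hi (hU b hb v hv).1
      · rintro ⟨h1, h2⟩
        have hQφ := (hQ φ h1).2 hr
        refine ⟨⟨⟨fun v hv => ?_, fun a v i hi hv => ?_⟩, ?_⟩, funext fun v => ?_⟩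
        · have hvc : v ≠ c := fun e => hv (e ▸ .refl)
          rw [h1 v fun h => hv h.1, hθ v fun h => hv h.1, Function.update_of_ne hvc]
        · by_cases hvc : H.Reach v c
          · exact hQφ a v i hi ⟨hv, hvc⟩
          · obtain ⟨b, hb, hbv⟩ := (hcover v).2 ⟨hv, hvc⟩
            exact h2 b hb a v i hi hbv
        · rw [h1 c fun h => h.2 .refl, hθ c fun h => h.2.2 rfl, Function.update_self]
        · split_ifs with h
          · have hvc : v ≠ c := fun e => h.2 (e ▸ .refl)
            rw [hθ v fun h' => h.2 h'.2.1, Function.update_of_ne hvc]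
          · exact h1 v h
    · rw [if_neg hr, zero_mul, Finset.card_eq_zero, Finset.filter_eq_empty_iff]
      intro φ hφ e
      simp only [Finset.mem_filter, mem_extensions] at hφ
      refine hr ((hQ φ fun v hv => ?_).1 fun a v i hi hv => hφ.1.2 a v i hi hv.1)
      rw [← e]
      simp only [hv, if_false]
  · intro φ hφ
    simp only [Finset.coe_filter, Finset.mem_univ, true_and, Set.mem_ofPred_eq,
      mem_extensions] at hφ ⊢
    obtain ⟨⟨h1, h2⟩, h3⟩ := hφ
    intro v hv
    by_cases hvc : v = c
    · subst hvc
      rw [if_neg fun h => h.2 .refl, Function.update_self, h3]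
    · rw [Function.update_of_ne hvc]
      split_ifs with h
      · rfl
      · exact h1 v fun h' => hv ⟨h', by_contra fun h'' => h ⟨h', h''⟩, hvc⟩

/-- If `r` reaches all vertices, nothing is prescribed by `γ` and every edge has its head in the
reachable set. -/
theorem hom_eq_cnt {r : V} (hr : ∀ v, H.Reach r v) (γ : V → W) : H.hom G = H.cnt G r γ := by
  rw [hom, cnt, ← Set.ncard_coe_finset]
  congr 1
  ext φ
  simp only [Finset.mem_coe, mem_extensions, Set.mem_ofPred_eq, hr, not_true, IsEmpty.forall_iff,
    implies_true, true_and, RespectsInto, IsHom, forall_true_left]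

theorem homAt_eq_cntAt {r : V} (hr : ∀ v, H.Reach r v) (x : W) (γ : V → W) :
    H.homAt r G x = H.cntAt G r x γ := by
  rw [homAt, cntAt, ← Set.ncard_coe_finset]
  congr 1
  ext φ
  simp only [Finset.coe_filter, mem_extensions, Set.mem_ofPred_eq, hr, not_true, IsEmpty.forall_iff,
    implies_true, true_and, RespectsInto, IsHom, forall_true_left]

end Counting

end ColoredDigraph

/-! ### Backward walks and nested enumerations of in-neighbours -/

section Enumeration

variable {ι W : Type*}

/-- `z` is reached from `y` by `j` steps to members of the lists `L`. -/
def BackWalk (L : W → List W) : ℕ → W → W → Prop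
  | 0, y, z => z = y
  | j + 1, y, z => ∃ a ∈ L y, BackWalk L j a z

/-- The variables on the left of the pairs in a list are new, and those on the right are already
assigned, if the variables in `X` are assigned in the beginning. -/
def Assigns : Set ι → List (ι × ι) → Prop
  | _, [] => True
  | X, (d, s) :: l => s ∈ X ∧ d ∉ X ∧ Assigns (insert d X) l

theorem Assigns.notMem {X : Set ι} {l : List (ι × ι)} (h : Assigns X l) :
    ∀ d ∈ l.map Prod.fst, d ∉ X := by
  induction l generalizing X with
  | nil => simp
  | cons p l ih =>
    obtain ⟨_, h2, h3⟩ := h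
    intro d hd
    rcases List.mem_cons.1 hd with rfl | hd
    · exact h2
    · exact fun hX => ih h3 d hd (Set.mem_insert_of_mem _ hX)

theorem Assigns.nodup {X : Set ι} {l : List (ι × ι)} (h : Assigns X l) :
    (l.map Prod.fst).Nodup := by
  induction l generalizing X with
  | nil => simp
  | cons p l ih =>
    obtain ⟨_, _, h3⟩ := h
    exact List.nodup_cons.2 ⟨fun hd => h3.notMem _ hd (Set.mem_insert _ _), ih h3⟩

theorem Assigns.length_lt [Fintype ι] {X : Set ι} {l : List (ι × ι)} (h : Assigns X l) {c : ι}
    (hc : c ∈ X) : l.length < Fintype.card ι := by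
  have : (c :: l.map Prod.fst).Nodup := List.nodup_cons.2 ⟨fun hd => h.notMem c hd hc, h.nodup⟩
  simpa using this.length_le_card

theorem Assigns.ne_of_mem {X : Set ι} {d s : ι} {l : List (ι × ι)} (h : Assigns X ((d, s) :: l)) :
    d ≠ s ∧ d ∉ l.map Prod.fst ∧ s ∉ l.map Prod.fst :=
  ⟨fun e => h.2.1 (e ▸ h.1), fun hd => h.2.2.notMem _ hd (Set.mem_insert _ _),
    fun hs => h.2.2.notMem _ hs (Set.mem_insert_of_mem _ h.1)⟩

open scoped Classical

/-- The valuations obtained from `θ` by assigning, for each pair `(d, s)` of the list `l` in turn, to `d`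
a member of the list `L` of the value of `s`. -/
def vals [DecidableEq ι] (L : W → List W) : List (ι × ι) → (ι → W) → List (ι → W)
  | [], θ => [θ]
  | (d, s) :: l, θ => (L (θ s)).reverse.flatMap fun a => vals L l (Function.update θ d a)

/-- Once chosen, the values of `d` and of its source `s` are not overwritten, so each constraint can
be read off from the final valuation. -/
theorem mem_vals [DecidableEq ι] {L : W → List W} {X : Set ι} {l : List (ι × ι)} (hl : Assigns X l) {θ θ' : ι → W} :
    θ' ∈ vals L l θ ↔
      (∀ v, v ∉ l.map Prod.fst → θ' v = θ v) ∧ ∀ p ∈ l, θ' p.1 ∈ L (θ' p.2) := by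
  induction l generalizing X θ with
  | nil => simp [vals, funext_iff]
  | cons p l ih =>
    obtain ⟨d, s⟩ := p
    obtain ⟨hds, hd, hs⟩ := hl.ne_of_mem
    simp only [vals, List.mem_flatMap, List.mem_reverse, ih hl.2.2, List.map_cons, List.mem_cons,
      not_or, forall_eq_or_imp]
    constructor
    · rintro ⟨a, ha, h1, h2⟩
      have e1 : θ' d = a := by rw [h1 d hd, Function.update_self]
      have e2 : θ' s = θ s := by rw [h1 s hs, Function.update_of_ne hds.symm]
      exact ⟨fun v hv => by rw [h1 v hv.2, Function.update_of_ne hv.1], e1 ▸ e2 ▸ ha, h2⟩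
    · rintro ⟨h1, h2, h3⟩
      refine ⟨θ' d, h1 s ⟨hds.symm, hs⟩ ▸ h2, fun v hv => ?_, h3⟩
      by_cases hvd : v = d
      · subst hvd; simp
      · rw [Function.update_of_ne hvd, h1 v ⟨hvd, hv⟩]

/-- A sum over an enumeration is the sum over all valuations if the other ones do not contribute. -/
theorem sum_vals [DecidableEq ι] [Fintype ι] [Fintype W] {L : W → List W} (hL : ∀ v, (L v).Nodup) {X : Set ι}
    {l : List (ι × ι)} (hl : Assigns X l) {θ : ι → W} {g : (ι → W) → ℕ}
    (hg : ∀ θ' : ι → W, (∀ v, v ∉ l.map Prod.fst → θ' v = θ v) → g θ' ≠ 0 →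
      ∀ p ∈ l, θ' p.1 ∈ L (θ' p.2)) :
    ((vals L l θ).map g).sum =
      ∑ θ' ∈ Finset.univ.filter (fun θ' : ι → W => ∀ v, v ∉ l.map Prod.fst → θ' v = θ v), g θ' := by
  -- Different choices for `d` give disjoint families of valuations, since the value of `d` is never
  -- changed again.
  have hnd : ∀ (l : List (ι × ι)) (X : Set ι) (θ : ι → W), Assigns X l → (vals L l θ).Nodup := by
    intro l
    induction l with
    | nil => simp [vals]
    | cons p l ih =>
      intro X θ hl
      obtain ⟨d, s⟩ := p
      obtain ⟨hds, hd, hs⟩ := hl.ne_of_mem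
      refine List.nodup_flatMap.2 ⟨fun a _ => ih _ _ hl.2.2, ?_⟩
      refine List.Pairwise.imp ?_ (List.nodup_reverse.2 (hL _))
      intro a b hab θ' h1 h2
      have e1 := ((mem_vals hl.2.2).1 h1).1 d hd
      have e2 := ((mem_vals hl.2.2).1 h2).1 d hd
      rw [Function.update_self] at e1 e2
      exact hab (e1 ▸ e2)
  rw [← List.sum_toFinset _ (hnd l X θ hl)]
  -- Valuations missed by the enumeration violate some constraint, so `hg` makes their terms zero.
  refine Finset.sum_subset (fun θ' h => ?_) (fun θ' h h' => ?_)
  · simpa using ((mem_vals hl).1 (List.mem_toFinset.1 h)).1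
  · by_contra hne
    simp only [Finset.mem_filter, Finset.mem_univ, true_and] at h
    exact h' (List.mem_toFinset.2 ((mem_vals hl).2 ⟨h, hg θ' h hne⟩))

/-- The pairs that describe a walk of length `j` with the variables `s, s + 1, …`. -/
def walkPairs (s : ℕ) : ℕ → List (ℕ × ℕ)
  | 0 => []
  | j + 1 => (s + 1, s) :: walkPairs (s + 1) j

theorem assigns_walkPairs {X : Set ℕ} {s : ℕ} (hs : s ∈ X) (hX : ∀ i ∈ X, i ≤ s) (j : ℕ) :
    Assigns X (walkPairs s j) := by
  induction j generalizing X s with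
  | zero => trivial
  | succ j ih =>
    refine ⟨hs, fun h => by have := hX _ h; omega, ih (Set.mem_insert _ _) ?_⟩
    rintro i (rfl | hi)
    · rfl
    · have := hX i hi; omega

theorem length_walkPairs (s j : ℕ) : (walkPairs s j).length = j := by
  induction j generalizing s with
  | zero => rfl
  | succ j ih => simp [walkPairs, ih]

theorem lt_of_mem_walkPairs {s j : ℕ} {d : ℕ} (h : d ∈ (walkPairs s j).map Prod.fst) :
    s < d ∧ d ≤ s + j := by
  induction j generalizing s with
  | zero => simp [walkPairs] at h
  | succ j ih =>
    rcases List.mem_cons.1 h with rfl | h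
    · simp
    · have := ih h; omega

/-- A backward walk is a valuation of the variables `s`, …, `s + j`. Only this inclusion matters:
every end must be visited, and repeated visits do no harm. -/
theorem exists_mem_vals_walkPairs {L : W → List W} {s j : ℕ} {θ : ℕ → W} {z : W}
    (h : BackWalk L j (θ s) z) : ∃ θ' ∈ vals L (walkPairs s j) θ, θ' (s + j) = z := by
  induction j generalizing s θ with
  | zero => exact ⟨θ, by simp [walkPairs, vals], h.symm⟩
  | succ j ih =>
    obtain ⟨a, ha, h⟩ := h
    obtain ⟨θ', h1, h2⟩ := ih (s := s + 1) (θ := Function.update θ (s + 1) a) (by simpa using h)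
    refine ⟨θ', List.mem_flatMap.2 ⟨a, by simpa using ha, h1⟩, ?_⟩
    rw [← h2]
    congr 1
    omega

end Enumeration

/-! ### Locality of changes, and the existence of evaluation plans. -/

namespace ColoredDigraph

variable {k : ℕ} {V W : Type*} {H : ColoredDigraph k V} {G G' : ColoredDigraph k W}

variable (H) in
/-- There is a directed walk of length `j` from `u` to `v`. -/
def WalkOfLength : ℕ → V → V → Prop
  | 0, u, v => v = u
  | j + 1, u, v => ∃ a, WalkOfLength j u a ∧ H.Adj a v

theorem WalkOfLength.reach {j : ℕ} {u v : V} (h : H.WalkOfLength j u v) : H.Reach u v := by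
  induction j generalizing v with
  | zero => exact h ▸ .refl
  | succ j ih =>
    obtain ⟨a, h1, h2⟩ := h
    exact (ih h1).tail h2

/-- A shortest walk has pairwise distinct vertices: its end cannot be reached in fewer steps, so it
is new among the vertices collected before it. This bounds the lengths of walks that an update has
to consider. -/
theorem Reach.exists_walkOfLength [Fintype V] {u v : V} (h : H.Reach u v) :
    ∃ j < Fintype.card V, H.WalkOfLength j u v := by
  classical
  have hex : ∃ j, H.WalkOfLength j u v := by
    induction h with
    | refl => exact ⟨0, rfl⟩
    | tail _ hab ih =>
      obtain ⟨j, hj⟩ := ih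
      exact ⟨j + 1, _, hj, hab⟩
  have key : ∀ j v, H.WalkOfLength j u v → (∀ i < j, ¬ H.WalkOfLength i u v) →
      ∃ s : Finset V, s.card = j + 1 ∧ ∀ a ∈ s, ∃ i ≤ j, H.WalkOfLength i u a := by
    intro j
    induction j with
    | zero => exact fun v hv _ => ⟨{v}, by simp, fun a ha => ⟨0, le_rfl, Finset.mem_singleton.1 ha ▸ hv⟩⟩
    | succ j ih =>
      rintro v ⟨a, ha, hav⟩ hmin
      obtain ⟨s, hs, hs'⟩ := ih a ha fun i hi h => hmin (i + 1) (by omega) ⟨a, h, hav⟩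
      have hv : v ∉ s := fun hv => by
        obtain ⟨i, hi, h⟩ := hs' v hv
        exact hmin i (by omega) h
      refine ⟨insert v s, by rw [Finset.card_insert_of_notMem hv, hs], fun b hb => ?_⟩
      rcases Finset.mem_insert.1 hb with rfl | hb
      · exact ⟨j + 1, le_rfl, a, ha, hav⟩
      · obtain ⟨i, hi, h⟩ := hs' b hb
        exact ⟨i, by omega, h⟩
  obtain ⟨s, hs, _⟩ := key _ v (Nat.find_spec hex) fun i hi => Nat.find_min hex hi
  exact ⟨_, by have := s.card_le_univ; omega, Nat.find_spec hex⟩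

/-- All edges of a walk from `c` have their heads in the reachable set, so the map sends them to
edges of `G`. Read from its end, the image walk steps to in-neighbours. -/
theorem RespectsInto.backWalk {L : W → List W} (hL : ∀ a b, G.Adj a b → a ∈ L b) {c b : V}
    {φ : V → W} (hφ : H.RespectsInto G {v | H.Reach c v} φ) {j : ℕ} (h : H.WalkOfLength j c b) :
    BackWalk L j (φ b) (φ c) := by
  induction j generalizing b with
  | zero => exact h ▸ rfl
  | succ j ih =>
    have hb := h.reach
    obtain ⟨a, h1, h2⟩ := h
    obtain ⟨i, hi⟩ := Option.ne_none_iff_exists'.1 h2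
    refine ⟨φ a, hL _ _ ?_, ih h1⟩
    simp [Adj, hφ a b i hi hb]

/-- If the colour of one pair `(x₀, y₀)` changes, then the numbers of extensions change only for the
images of `c` that are close to `y₀`. -/
theorem cntAt_eq_of_not_backWalk [Fintype V] [Fintype W] {L : W → List W} {x₀ y₀ : W}
    (hGG : ∀ a b, ¬ (a = x₀ ∧ b = y₀) → G'.color a b = G.color a b)
    (hL : ∀ a b, G.Adj a b → a ∈ L b) (hL' : ∀ a b, G'.Adj a b → a ∈ L b) {c : V} {z : W}
    (h : ∀ j < Fintype.card V, ¬ BackWalk L j y₀ z) (γ : V → W) :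
    H.cntAt G c z γ = H.cntAt G' c z γ := by
  classical
  -- The two graphs play symmetric roles, so an inclusion of the sets of extensions in one direction
  -- is enough.
  have key : ∀ G₁ G₂ : ColoredDigraph k W,
      (∀ a b, ¬ (a = x₀ ∧ b = y₀) → G₂.color a b = G₁.color a b) →
      (∀ a b, G₁.Adj a b → a ∈ L b) → H.cntAt G₁ c z γ ≤ H.cntAt G₂ c z γ := by
    intro G₁ G₂ hG hL₁
    refine Finset.card_le_card fun φ hφ => ?_
    simp only [Finset.mem_filter, mem_extensions] at hφ ⊢
    obtain ⟨⟨h1, h2⟩, h3⟩ := hφ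
    refine ⟨⟨h1, fun a b i hi hb => ?_⟩, h3⟩
    rw [hG, h2 a b i hi hb]
    -- If an edge with head `b` is sent to the changed pair, then the image of a short walk from `c`
    -- to `b` is a forbidden backward walk from `y₀` to `z`.
    rintro ⟨_, hy⟩
    obtain ⟨j, hj, hw⟩ := Reach.exists_walkOfLength (show H.Reach c b from hb)
    exact h j hj (hy ▸ h3 ▸ h2.backWalk hL₁ hw)
  exact le_antisymm (key G G' hGG hL) (key G' G (fun a b hab => (hGG a b hab).symm) hL')

variable (H) in
/-- The lists that govern the recomputation of the numbers of extensions to the vertices reachable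
from `c`. -/
structure EvalPlan (c : V) where
  /-- the vertices outside with edges into the set of the reachable vertices -/
  ghosts : List V
  /-- the other vertices `q` of the strong component of `c`, each with an out-neighbour -/
  comp : List (V × V)
  /-- representatives of the parts into which the other reachable vertices fall -/
  parts : List V
  /-- the edges with heads in the strong component of `c` -/
  edges : List (V × V × Fin (k + 1))
  ghosts_nodup : ghosts.Nodup
  mem_ghosts : ∀ g, g ∈ ghosts ↔ ¬ H.Reach c g ∧ ∃ b, H.Reach c b ∧ H.Adj g b
  ghosts_adj : ∀ g ∈ ghosts, H.Adj g c
  comp_assigns : Assigns ({v | v = c ∨ v ∈ ghosts}) comp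
  mem_comp : ∀ v, v ∈ comp.map Prod.fst ↔ H.Reach c v ∧ H.Reach v c ∧ v ≠ c
  comp_adj : ∀ p ∈ comp, H.Adj p.1 p.2 ∧ H.Reach c p.2 ∧ H.Reach p.2 c
  parts_nodup : parts.Nodup
  parts_cover : ∀ v, (∃ b ∈ parts, H.Reach b v) ↔ H.Reach c v ∧ ¬ H.Reach v c
  parts_disjoint : ∀ b ∈ parts, ∀ b' ∈ parts, b ≠ b' → ∀ v, H.Reach b v → ¬ H.Reach b' v
  mem_edges : ∀ a b i, (a, b, i) ∈ edges ↔ H.color a b = some i ∧ H.Reach c b ∧ H.Reach b c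

/-- Assign the strong component outwards from `X`: as long as a vertex is missing, some missing
vertex has an out-neighbour that is already assigned. The recursion then continues with a smaller
missing set. -/
theorem exists_comp [Fintype V] (c : V) (X : Set V) (hc : c ∈ X) : ∃ l : List (V × V), Assigns X l ∧
    (∀ v, v ∈ l.map Prod.fst ↔ (H.Reach c v ∧ H.Reach v c) ∧ v ∉ X) ∧
    ∀ p ∈ l, H.Adj p.1 p.2 ∧ H.Reach c p.2 ∧ H.Reach p.2 c := by
  classical
  induction hN : ({v | (H.Reach c v ∧ H.Reach v c) ∧ v ∉ X} : Set V).ncard using Nat.strong_induction_on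
    generalizing X with
  | _ N ih =>
  by_cases h : ∃ v, (H.Reach c v ∧ H.Reach v c) ∧ v ∉ X
  · obtain ⟨q, ⟨hcq, hqc⟩, hqX⟩ := h
    -- A walk from `q` to `c` starts outside `X` and ends inside; take the first edge that enters
    -- `X`.
    obtain ⟨d, s, hcd, hd, hs, hds, hsc⟩ : ∃ d s, H.Reach c d ∧ d ∉ X ∧ s ∈ X ∧ H.Adj d s ∧
        H.Reach s c := by
      have : ∀ q, H.Reach q c → H.Reach c q → q ∉ X → ∃ d s, H.Reach c d ∧ d ∉ X ∧ s ∈ X ∧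
          H.Adj d s ∧ H.Reach s c := by
        intro q hqc
        induction hqc using Relation.ReflTransGen.head_induction_on with
        | refl => exact fun _ h => absurd hc h
        | @head a b hab hbc ih =>
          intro hca ha
          by_cases hb : b ∈ X
          · exact ⟨a, b, hca, ha, hb, hab, hbc⟩
          · exact ih (hca.tail hab) hb
      exact this q hqc hcq hqX
    have hdc : H.Reach d c := Relation.ReflTransGen.head hds hsc
    obtain ⟨l, h1, h2, h3⟩ := ih _ (hN ▸ Set.ncard_lt_ncard (t := {v | (H.Reach c v ∧ H.Reach v c) ∧ v ∉ X})
      (s := {v | (H.Reach c v ∧ H.Reach v c) ∧ v ∉ insert d X})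
      ⟨fun v hv => ⟨hv.1, fun hX => hv.2 (Set.mem_insert_of_mem _ hX)⟩,
        fun hsub => (hsub (a := d) ⟨⟨hcd, hdc⟩, hd⟩).2 (Set.mem_insert _ _)⟩ (Set.toFinite _))
      (insert d X) (Set.mem_insert_of_mem _ hc) rfl
    refine ⟨(d, s) :: l, ⟨hs, hd, h1⟩, fun v => ?_, ?_⟩
    · rw [List.map_cons, List.mem_cons, h2, Set.mem_insert_iff]
      by_cases hv : v = d
      · subst hv; simp [hcd, hdc, hd]
      · simp [hv]
    · rintro p hp
      rcases List.mem_cons.1 hp with rfl | hp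
      · exact ⟨hds, hcd.tail hds, hsc⟩
      · exact h3 p hp
  · push Not at h
    refine ⟨[], trivial, fun v => ?_, by simp⟩
    simp only [List.map_nil, List.not_mem_nil, false_iff, not_and, not_not]
    exact h v

/-- Take an inclusion-minimal set whose members together reach exactly the required vertices. By
minimality no member reaches another one, and in an elder graph members with a common reachable
vertex would be comparable. -/
theorem IsElder.exists_parts [Fintype V] (hH : H.IsElder) (c : V) : ∃ s : Finset V,
    (∀ v, (∃ b ∈ s, H.Reach b v) ↔ H.Reach c v ∧ ¬ H.Reach v c) ∧
    ∀ b ∈ s, ∀ b' ∈ s, b ≠ b' → ∀ v, H.Reach b v → ¬ H.Reach b' v := by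
  classical
  let P : Finset V → Prop := fun s => ∀ v, (∃ b ∈ s, H.Reach b v) ↔ H.Reach c v ∧ ¬ H.Reach v c
  have hP : P (Finset.univ.filter fun v => H.Reach c v ∧ ¬ H.Reach v c) := by
    intro v
    simp only [Finset.mem_filter, Finset.mem_univ, true_and]
    constructor
    · rintro ⟨b, ⟨h1, h2⟩, h3⟩
      exact ⟨h1.trans h3, fun h => h2 (h3.trans h)⟩
    · exact fun h => ⟨v, h, .refl⟩
  obtain ⟨s, hs⟩ := exists_minimal_of_wellFoundedLT P ⟨_, hP⟩
  refine ⟨s, hs.prop, ?_⟩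
  have key : ∀ b ∈ s, ∀ b' ∈ s, b ≠ b' → ¬ H.Reach b b' := by
    intro b hb b' hb' hne hbb'
    have : P (s.erase b') := by
      intro v
      rw [← hs.prop v]
      constructor
      · rintro ⟨a, ha, hav⟩
        exact ⟨a, Finset.mem_of_mem_erase ha, hav⟩
      · rintro ⟨a, ha, hav⟩
        by_cases e : a = b'
        · exact ⟨b, Finset.mem_erase.2 ⟨hne, hb⟩, hbb'.trans (e ▸ hav)⟩
        · exact ⟨a, Finset.mem_erase.2 ⟨e, ha⟩, hav⟩
    exact Finset.notMem_erase b' s (hs.le_of_le this (Finset.erase_subset _ _) hb')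
  intro b hb b' hb' hne v hv hv'
  rcases hH.reach_or_reach hv hv' with h | h
  · exact key b hb b' hb' hne h
  · exact key b' hb' b hb hne.symm h

theorem IsElder.nonempty_evalPlan [Fintype V] (hH : H.IsElder) (c : V) : Nonempty (H.EvalPlan c) := by
  classical
  obtain ⟨ch, h1, h2⟩ := hH.exists_parts c
  obtain ⟨l, hl1, hl2, hl3⟩ := exists_comp (H := H) c
    {v | v = c ∨ v ∈ (Finset.univ.filter fun g => ¬ H.Reach c g ∧ ∃ b, H.Reach c b ∧ H.Adj g b).toList}
    (.inl rfl)
  exact ⟨{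
    ghosts := (Finset.univ.filter fun g => ¬ H.Reach c g ∧ ∃ b, H.Reach c b ∧ H.Adj g b).toList
    comp := l
    parts := ch.toList
    edges := (Finset.univ.filter fun p : V × V × Fin (k + 1) =>
      H.color p.1 p.2.1 = some p.2.2 ∧ H.Reach c p.2.1 ∧ H.Reach p.2.1 c).toList
    ghosts_nodup := Finset.nodup_toList _
    mem_ghosts := by simp
    ghosts_adj := fun g hg => by
      simp only [Finset.mem_toList, Finset.mem_filter, Finset.mem_univ, true_and] at hg
      obtain ⟨hg, b, hb, hgb⟩ := hg
      exact hH.adj_of_adj_reach hb hgb hg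
    comp_assigns := hl1
    mem_comp := fun v => by
      rw [hl2, and_assoc]
      refine and_congr_right fun hcv => and_congr_right fun _ => ?_
      simp [hcv]
    comp_adj := hl3
    parts_nodup := Finset.nodup_toList _
    parts_cover := by simpa using h1
    parts_disjoint := by simpa using h2
    mem_edges := by simp }⟩

end ColoredDigraph

namespace WordRAM

/-! ### Programs that run through lists of in-neighbours -/

/-- For each member of the list of the vertex in register `s`, put it into register `d` and run `p`.
Register `d + 1` counts. -/
def forEach (M d s : ℕ) (p : Prog) : Prog :=
  .seq (loadAt (d + 1) M 1 [s]) (.loop (d + 1) (.seq (.const 5 1) (.seq (.op .sub (d + 1) (d + 1) 5)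
    (.seq (loadAt d M 2 [s, d + 1]) p))))

/-- Nested loops, one for each pair of the list. -/
def nest {ι : Type*} (M : ℕ) (vr : ι → ℕ) : List (ι × ι) → Prog → Prog
  | [], p => p
  | (d, s) :: l, p => forEach M (vr d) (vr s) (nest M vr l p)

theorem writes_forEach {M d s : ℕ} {p : Prog} {x : ℕ} (h : (forEach M d s p).Writes x) :
    p.Writes x ∨ x = 5 ∨ x = 6 ∨ x = d ∨ x = d + 1 := by
  simp only [forEach, Prog.Writes] at h
  rcases h with h | h | h | h | h
  · have := writes_loadAt h; tauto
  · tauto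
  · tauto
  · have := writes_loadAt h; tauto
  · tauto

theorem writes_nest {ι : Type*} {M : ℕ} {vr : ι → ℕ} {l : List (ι × ι)} {p : Prog} {x : ℕ}
    (h : (nest M vr l p).Writes x) :
    p.Writes x ∨ x = 5 ∨ x = 6 ∨ ∃ d ∈ l.map Prod.fst, x = vr d ∨ x = vr d + 1 := by
  induction l with
  | nil => exact .inl h
  | cons q l ih =>
    obtain ⟨d, s⟩ := q
    rcases writes_forEach h with h | h | h | h
    · rcases ih h with h | h | h | ⟨d, hd, h⟩
      · tauto
      · tauto
      · tauto
      · exact .inr (.inr (.inr ⟨d, List.mem_cons_of_mem _ hd, h⟩))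
    · tauto
    · tauto
    · exact .inr (.inr (.inr ⟨d, by simp, h⟩))

/-- The constants in registers `3` and `4`. -/
def Ready (n : ℕ) (s : State) : Prop := s.reg 3 = n ∧ s.reg 4 = 3 * n * n

theorem Ready.congr {n : ℕ} {s s' : State} (h : Ready n s) (h3 : s'.reg 3 = s.reg 3)
    (h4 : s'.reg 4 = s.reg 4) : Ready n s' := ⟨h3.trans h.1, h4.trans h.2⟩

/-- The cells of the `M` tables with indices of length at most `b` have words as addresses. -/
structure Fits (n M w b : ℕ) : Prop where
  sq : 3 * n * n < 2 ^ w
  two : 2 ≤ b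
  pos : 0 < n
  addr_lt : ∀ g l, g < M → l.length ≤ b → (∀ e ∈ l, e < n) → addr n M g l < 2 ^ w

/-- The tables `1` and `2` hold the lists `L`. -/
def HasLists {n : ℕ} (M : ℕ) (L : Fin n → List (Fin n)) (mem : ℕ →₀ ℕ) : Prop :=
  ∀ v : Fin n, mem (addr n M 1 [v]) = (L v).length ∧
    ∀ i (h : i < (L v).length), mem (addr n M 2 [v, i]) = (L v)[i]

theorem Fits.one_mod {n M w b : ℕ} (h : Fits n M w b) : 1 % 2 ^ w = 1 := by
  have := h.sq
  have h' := h.pos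
  refine Nat.mod_eq_of_lt (lt_of_le_of_lt ?_ this)
  nlinarith

variable {ι : Type*} [DecidableEq ι] {n M w b D T : ℕ} {A : Finset ℕ} {L : Fin n → List (Fin n)}
  {vr : ι → ℕ} {p : Prog}

/-- The invariant `I` records the valuations already treated. The body may change the memory,
provided that the lists being enumerated stay intact, and it may not write to the registers of the
loops around it. -/
theorem wp_nest (hf : Fits n M w b) (hM : 3 ≤ M) (hL : ∀ v, (L v).Nodup) (hLD : ∀ v, (L v).length ≤ D)
    (hvr : Function.Injective vr) (hvr' : ∀ v, 20 ≤ vr v ∧ vr v % 2 = 0) (hD : 0 < D)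
    {X : Set ι} {l : List (ι × ι)} (hl : Assigns X l) {θ : ι → Fin n}
    {I : List (ι → Fin n) → (ℕ →₀ ℕ) → ℕ → Prop} (hI : ∀ done mem a, I done mem a → HasLists M L mem)
    (hwr : ∀ x, p.Writes x → x ≠ 3 ∧ x ≠ 4 ∧ ∀ v, (v ∈ X ∨ v ∈ l.map Prod.fst → x ≠ vr v) ∧
      (v ∈ l.map Prod.fst → x ≠ vr v + 1))
    (hbody : ∀ done θ' s, θ' ∈ vals L l θ → Ready n s → I done s.mem (s.reg 10) →
      (∀ v, v ∈ X ∨ v ∈ l.map Prod.fst → s.reg (vr v) = θ' v) →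
      Wp w A p T (fun s' => I (done ++ [θ']) s'.mem (s'.reg 10)) s)
    {done : List (ι → Fin n)} {s : State} (hs : Ready n s) (hX : ∀ v ∈ X, s.reg (vr v) = θ v)
    (h : I done s.mem (s.reg 10)) :
    Wp w A (nest M vr l p) ((T + 26 * l.length) * D ^ l.length)
      (fun s' => I (done ++ vals L l θ) s'.mem (s'.reg 10)) s := by
  induction l generalizing X θ done s with
  | nil =>
    simp only [nest, vals, List.length_nil, pow_zero, mul_zero, add_zero, mul_one]
    exact hbody done θ s (by simp [vals]) hs h fun v hv => hX v (by simpa using hv)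
  | cons q l ih =>
    obtain ⟨d, q⟩ := q
    obtain ⟨hdq, hd, hq⟩ := hl.ne_of_mem
    have hne : ∀ v ∈ X, vr v ≠ vr d := fun v hv e => hl.2.1 (hvr e ▸ hv)
    have hlen : (L (θ q)).length ≤ n := by simpa using (hL (θ q)).length_le_card
    have hq20 := hvr' q
    have hd20 := hvr' d
    -- Values are in even registers and counters in the odd ones that follow them, so distinct
    -- variables never interfere.
    have hwr' : ∀ x, (nest M vr l p).Writes x → x ≠ 3 ∧ x ≠ 4 ∧ x ≠ vr d + 1 ∧ ∀ v ∈ X, x ≠ vr v := by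
      intro x hx
      rcases writes_nest hx with hx | hx | hx | ⟨d', hd', hx⟩
      · obtain ⟨h1, h2, h3⟩ := hwr x hx
        exact ⟨h1, h2, (h3 d).2 (by simp), fun v hv => (h3 v).1 (.inl hv)⟩
      · refine ⟨by omega, by omega, by omega, fun v hv => ?_⟩
        have := hvr' v; omega
      · refine ⟨by omega, by omega, by omega, fun v hv => ?_⟩
        have := hvr' v; omega
      · have h1 := hvr' d'
        have h2 : vr d' ≠ vr d := fun e => hd (hvr e ▸ hd')
        refine ⟨by omega, by omega, by omega, fun v hv => ?_⟩
        have h3 := hvr' v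
        have h4 : vr d' ≠ vr v := fun e => hl.2.2.notMem d' hd' (hvr e ▸ Set.mem_insert_of_mem _ hv)
        omega
    refine Wp.mono (T := 10 + ((L (θ q)).length * (1 + (1 + (12 + (T + 26 * l.length) * D ^ l.length)) + 1)
      + 1)) (wp_seq (T₁ := 10) (wp_loadAt hs.1 hs.2 (by simp; omega) (l := [(θ q : ℕ)])
      (by simp [hX q hl.1]) (hf.addr_lt _ _ (by omega) (by have := hf.two; simp; omega) (by simp)) hf.sq ?_)) ?_
    · intro s' hm hd' hr
      have hcnt : s'.reg (vr d + 1) = (L (θ q)).length := by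
        rw [hd', (hI _ _ _ h (θ q)).1]
      -- The counter runs down, so at value `j` the members from index `j` on have been treated, in
      -- reverse order. This explains the reversal in `vals`.
      refine Wp.imp (wp_countdown
        (fun j s => Ready n s ∧ (∀ v ∈ X, s.reg (vr v) = θ v) ∧ I (done ++ ((L (θ q)).drop j).reverse.flatMap
          fun a => vals L l (Function.update θ d a)) s.mem (s.reg 10)) ?_ ⟨?_, ?_, ?_⟩ hcnt) le_rfl
          (fun s' hs' => by simpa [vals] using hs'.2.2)
      · intro j s hj ⟨hs, hX, hIs⟩ hsj
        have hjn : j < n := by omega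
        have hsub : BinOp.sub.eval w ((s.setReg 5 (1 % 2 ^ w)).reg (vr d + 1))
            ((s.setReg 5 (1 % 2 ^ w)).reg 5) = j := by
          simp [BinOp.eval, hf.one_mod, State.setReg_reg_ne s _ (show vr d + 1 ≠ 5 by omega), hsj]
        refine wp_seq (wp_const (wp_seq (wp_op (wp_seq (wp_loadAt (n := n) (rs := [vr q, vr d + 1])
          (l := [(θ q : ℕ), j])
          ?_ ?_ ?_ ?_ (hf.addr_lt _ _ (by omega) (by simpa using hf.two) ?_) hf.sq ?_)))))
        · rw [State.setReg_reg_ne _ _ (by omega), State.setReg_reg_ne _ _ (by omega), hs.1]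
        · rw [State.setReg_reg_ne _ _ (by omega), State.setReg_reg_ne _ _ (by omega), hs.2]
        · simp; omega
        · rw [hsub]
          simp only [List.map_cons, List.map_nil, State.setReg_reg_self, List.cons.injEq, and_true]
          rw [State.setReg_reg_ne _ _ (by omega), State.setReg_reg_ne _ _ (by omega), hX q hl.1]
        · simp [hjn]
        · rw [hsub]
          intro s₁ hm₁ hd₁ hr₁
          have hr₁' : ∀ y, y ≠ 5 → y ≠ 6 → y ≠ vr d → y ≠ vr d + 1 → s₁.reg y = s.reg y := by
            intro y h5 h6 hy hy'
            rw [hr₁ y h5 h6 hy, State.setReg_reg_ne _ _ hy', State.setReg_reg_ne _ _ h5]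
          have hd₁' : s₁.reg (vr d) = ((L (θ q))[j] : Fin n) := by
            rw [hd₁]
            exact (hI _ _ _ hIs (θ q)).2 j hj
          have hj₁ : s₁.reg (vr d + 1) = j := by
            rw [hr₁ _ (by omega) (by omega) (by omega), State.setReg_reg_self]
          have hready : Ready n s₁ := hs.congr (hr₁' _ (by omega) (by omega) (by omega) (by omega))
            (hr₁' _ (by omega) (by omega) (by omega) (by omega))
          have hX₁ : ∀ v ∈ X, s₁.reg (vr v) = θ v := fun v hv => by
            have := hvr' v
            rw [hr₁' _ (by omega) (by omega) (hne v hv) (by omega), hX v hv]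
          refine Wp.imp (Wp.frame (ih hl.2.2 (θ := Function.update θ d (L (θ q))[j]) ?_ ?_ hready ?_
            (done := done ++ ((L (θ q)).drop (j + 1)).reverse.flatMap
              fun a => vals L l (Function.update θ d a)) ?_)) le_rfl ?_
          · intro x hx
            obtain ⟨h1, h2, h3⟩ := hwr x hx
            refine ⟨h1, h2, fun v => ⟨fun hv => (h3 v).1 ?_, fun hv => (h3 v).2 ?_⟩⟩
            · rcases hv with (rfl | hv) | hv
              · exact .inr (by simp)
              · exact .inl hv
              · exact .inr (by simp [hv])
            · exact List.mem_cons_of_mem _ hv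
          · intro done θ' s hθ' hs hI' hv
            refine hbody done θ' s ?_ hs hI' fun v hv' => hv v ?_
            · exact List.mem_flatMap.2 ⟨(L (θ q))[j], by simp, hθ'⟩
            · rcases hv' with hv' | hv'
              · exact .inl (Set.mem_insert_of_mem _ hv')
              · rcases List.mem_cons.1 hv' with rfl | hv'
                · exact .inl (Set.mem_insert _ _)
                · exact .inr hv'
          · rintro v (rfl | hv)
            · rw [hd₁', Function.update_self]
            · rw [hX₁ v hv, Function.update_of_ne (fun e => hne v hv (congrArg vr e))]
          · rw [hm₁, hr₁' _ (by omega) (by omega) (by omega) (by omega)]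
            exact hIs
          · rintro s₂ ⟨hI₂, hr₂⟩
            refine ⟨⟨hready.congr (hr₂ _ fun h => (hwr' _ h).1 rfl) (hr₂ _ fun h => (hwr' _ h).2.1 rfl),
              fun v hv => ?_, ?_⟩, ?_⟩
            · rw [hr₂ _ fun h => (hwr' _ h).2.2.2 v hv rfl, hX₁ v hv]
            · rw [List.drop_eq_getElem_cons hj, List.reverse_cons, List.flatMap_append, ← List.append_assoc]
              simpa using hI₂
            · rw [hr₂ _ fun h => (hwr' _ h).2.2.1 rfl, hj₁]
      · exact hs.congr (hr _ (by omega) (by omega) (by omega)) (hr _ (by omega) (by omega) (by omega))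
      · intro v hv
        have := hvr' v
        rw [hr _ (by omega) (by omega) (by omega), hX v hv]
      · rw [hm, hr _ (by omega) (by omega) (by omega)]
        simpa using h
    -- One level costs 11 steps around the loop and 15 per pass besides the inner loops; both are
    -- covered by 26 per pass because `D` is positive.
    · rw [List.length_cons, pow_succ]
      have h1 := hLD (θ q)
      have h2 : 1 ≤ D ^ l.length := Nat.one_le_pow _ _ hD
      set P := D ^ l.length
      have h3 : (L (θ q)).length * (1 + (1 + (12 + (T + 26 * l.length) * P)) + 1) ≤
          D * (1 + (1 + (12 + (T + 26 * l.length) * P)) + 1) := Nat.mul_le_mul_right _ h1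
      have h4 : D ≤ P * D := Nat.le_mul_of_pos_left _ h2
      nlinarith

end WordRAM

namespace ColoredDigraph

open WordRAM

open scoped Classical

/-! ### The tables and their contents -/

section Layout

variable (V : Type*) [Fintype V]

/-- The number of tables. -/
def tables : ℕ := 2 * Fintype.card V + 4

variable {V}

/-- The number of a vertex. -/
noncomputable def idx (v : V) : ℕ := (Fintype.equivFin V v).val

theorem idx_lt (v : V) : idx v < Fintype.card V := (Fintype.equivFin V v).isLt

theorem idx_inj {u v : V} : idx u = idx v ↔ u = v := by
  simp [idx, Fin.val_inj]

/-- The register for the image of a vertex. -/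
noncomputable def vreg (v : V) : ℕ := 20 + 2 * idx v

theorem vreg_injective : Function.Injective (vreg : V → ℕ) := fun u v h => by
  unfold vreg at h
  exact idx_inj.1 (by omega)

/-- Registers below 20 serve as arguments, constants and scratch. From 20 on, even registers hold
images of vertices and the next odd ones the loop counters. -/
theorem vreg_mod (v : V) : 20 ≤ vreg v ∧ vreg v % 2 = 0 := by
  unfold vreg; omega

/-- The table for the numbers of extensions with a given image of `c`. -/
noncomputable def atTable (c : V) : ℕ := 4 + 2 * idx c

/-- The table for the numbers of extensions to the vertices reachable from `c`. -/
noncomputable def totalTable (c : V) : ℕ := 5 + 2 * idx c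

theorem atTable_lt (c : V) : atTable c < tables V := by
  have := idx_lt c
  unfold atTable tables; omega

theorem totalTable_lt (c : V) : totalTable c < tables V := by
  have := idx_lt c
  unfold totalTable tables; omega

end Layout

variable {k : ℕ} {V : Type*} [Fintype V] {H : ColoredDigraph k V} (π : ∀ c, H.EvalPlan c) {n : ℕ}

/-- The index of the entries of the tables of `c`. -/
def ghostIndex (c : V) (γ : V → Fin n) : List ℕ := (π c).ghosts.map fun g => (γ g : ℕ)

/-- The cell for the number of extensions of `γ` that map `c` to `x`. -/
noncomputable def atCell (c : V) (x : Fin n) (γ : V → Fin n) : ℕ :=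
  addr n (tables V) (atTable c) (x :: ghostIndex π c γ)

/-- The cell for the number of extensions of `γ`. -/
noncomputable def totalCell (c : V) (γ : V → Fin n) : ℕ :=
  addr n (tables V) (totalTable c) (ghostIndex π c γ)

/-- The code of the colour of an edge, or of its absence. -/
def colorCode : Option (Fin (k + 1)) → ℕ
  | none => 0
  | some i => i + 1

/-- The code 0 for absence lets non-edges occupy no memory, and a single comparison tests both the
presence and the colour of an edge. -/
theorem colorCode_eq_succ {o : Option (Fin (k + 1))} {i : Fin (k + 1)} :
    colorCode o = i + 1 ↔ o = some i := by
  cases o with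
  | none => simp [colorCode]
  | some j => simp [colorCode, Fin.ext_iff]

/-- The memory represents the graph `G`, the lists `L`, and the numbers `f` and their sums; the cells
below the tables contain `g₀`. -/
structure Rep (g₀ : ℕ → ℕ) (G : ColoredDigraph k (Fin n)) (L : Fin n → List (Fin n))
    (f : V → Fin n → (V → Fin n) → ℕ) (mem : ℕ →₀ ℕ) : Prop where
  low : ∀ a < 3 * n * n, mem a = g₀ a
  color : ∀ u v : Fin n, mem (addr n (tables V) 0 [u, v]) = colorCode (G.color u v)
  lists : HasLists (tables V) L mem
  pos : ∀ (v : Fin n) i (h : i < (L v).length), mem (addr n (tables V) 3 [(L v)[i], v]) = i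
  pos_zero : ∀ u v : Fin n, u ∉ L v → mem (addr n (tables V) 3 [u, v]) = 0
  entry : ∀ c x γ, mem (atCell π c x γ) = f c x γ
  total : ∀ c γ, mem (totalCell π c γ) = ∑ x, f c x γ

theorem addr_ne {n M g g' : ℕ} {l l' : List ℕ} (hg : g < M) (hg' : g' < M) (h : g ≠ g') :
    addr n M g l ≠ addr n M g' l' := fun e => h <| by
  have := congrArg (· % M) e
  simpa [addr, Nat.mod_eq_of_lt hg, Nat.mod_eq_of_lt hg', Nat.add_mod] using this

variable {π}

theorem lt_of_mem_ghostIndex {c : V} {γ : V → Fin n} : ∀ e ∈ ghostIndex π c γ, e < n := by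
  simp [ghostIndex]

theorem ghostIndex_inj {c : V} {γ γ' : V → Fin n} :
    ghostIndex π c γ = ghostIndex π c γ' ↔ ∀ g ∈ (π c).ghosts, γ g = γ' g := by
  simp [ghostIndex, Fin.val_inj]

theorem length_ghostIndex {c : V} {γ : V → Fin n} :
    (ghostIndex π c γ).length = (π c).ghosts.length := by
  simp [ghostIndex]

theorem atCell_inj {c c' : V} {x x' : Fin n} {γ γ' : V → Fin n} :
    atCell π c x γ = atCell π c' x' γ' ↔ c = c' ∧ x = x' ∧ ∀ g ∈ (π c).ghosts, γ g = γ' g := by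
  constructor
  · intro h
    have hc : c = c' := by
      by_contra hc
      refine addr_ne (atTable_lt c) (atTable_lt c') (fun e => hc (idx_inj.1 ?_)) h
      unfold atTable at e
      omega
    subst hc
    have := (addr_inj (atTable_lt c) (atTable_lt c)
      (by simpa using lt_of_mem_ghostIndex) (by simpa using lt_of_mem_ghostIndex)
      (fun _ => by simp [length_ghostIndex]) h).2
    simp only [List.cons.injEq, Fin.val_inj, ghostIndex_inj] at this
    exact ⟨rfl, this⟩
  · rintro ⟨rfl, rfl, h⟩
    rw [atCell, atCell, ghostIndex_inj.2 h]

theorem totalCell_inj {c c' : V} {γ γ' : V → Fin n} :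
    totalCell π c γ = totalCell π c' γ' ↔ c = c' ∧ ∀ g ∈ (π c).ghosts, γ g = γ' g := by
  constructor
  · intro h
    have hc : c = c' := by
      by_contra hc
      refine addr_ne (totalTable_lt c) (totalTable_lt c') (fun e => hc (idx_inj.1 ?_)) h
      unfold totalTable at e
      omega
    subst hc
    have := (addr_inj (totalTable_lt c) (totalTable_lt c)
      lt_of_mem_ghostIndex lt_of_mem_ghostIndex
      (fun _ => by simp [length_ghostIndex]) h).2
    exact ⟨rfl, ghostIndex_inj.1 this⟩
  · rintro ⟨rfl, h⟩
    rw [totalCell, totalCell, ghostIndex_inj.2 h]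

theorem atCell_ne_totalCell {c c' : V} {x : Fin n} {γ γ' : V → Fin n} :
    atCell π c x γ ≠ totalCell π c' γ' :=
  addr_ne (atTable_lt c) (totalTable_lt c') (by unfold atTable totalTable; omega)

theorem addr_ne_atCell {g : ℕ} (hg : g < 4) {l : List ℕ} {c : V} {x : Fin n} {γ : V → Fin n} :
    addr n (tables V) g l ≠ atCell π c x γ :=
  addr_ne (by unfold tables; omega) (atTable_lt c) (by unfold atTable; omega)

theorem addr_ne_totalCell {g : ℕ} (hg : g < 4) {l : List ℕ} {c : V} {γ : V → Fin n} :
    addr n (tables V) g l ≠ totalCell π c γ :=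
  addr_ne (by unfold tables; omega) (totalTable_lt c) (by unfold totalTable; omega)

variable {G : ColoredDigraph k (Fin n)} {L : Fin n → List (Fin n)}
  {f : V → Fin n → (V → Fin n) → ℕ} {mem : ℕ →₀ ℕ} {g₀ : ℕ → ℕ}

/-- Maps that agree on the ghosts share a cell, so the memory itself forces `f` to depend on the
ghosts only. -/
theorem Rep.congr_fun (h : Rep π g₀ G L f mem) {c : V} {x : Fin n} {γ γ' : V → Fin n}
    (hγ : ∀ g ∈ (π c).ghosts, γ g = γ' g) : f c x γ = f c x γ' := by
  rw [← h.entry, ← h.entry, atCell_inj.2 ⟨rfl, rfl, hγ⟩]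

theorem Rep.congr {f' : V → Fin n → (V → Fin n) → ℕ} (h : Rep π g₀ G L f mem)
    (hf : ∀ c x γ, f c x γ = f' c x γ) : Rep π g₀ G L f' mem := by
  have : f = f' := funext fun c => funext fun x => funext fun γ => hf c x γ
  exact this ▸ h

/-- Change one entry and the sum that it contributes to. -/
theorem Rep.setEntry (h : Rep π g₀ G L f mem) (c : V) (x : Fin n) (γ : V → Fin n) (a : ℕ) :
    Rep π g₀ G L (fun c' x' γ' => if c' = c ∧ x' = x ∧ ∀ g ∈ (π c).ghosts, γ' g = γ g then a
      else f c' x' γ')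
      ((mem.update (totalCell π c γ) (mem (totalCell π c γ) + a - mem (atCell π c x γ))).update
        (atCell π c x γ) a) where
  low b hb := by
    have hn : 0 < n := x.pos
    have h1 := le_addr hn (show 0 < tables V by unfold tables; omega) (atTable c)
      ((x : ℕ) :: ghostIndex π c γ)
    have h2 := le_addr hn (show 0 < tables V by unfold tables; omega) (totalTable c)
      (ghostIndex π c γ)
    rw [Finsupp.update_apply, if_neg (by unfold atCell; omega), Finsupp.update_apply,
      if_neg (by unfold totalCell; omega), h.low b hb]
  color u v := by
    simp only [Finsupp.update_apply, if_neg (addr_ne_atCell (show 0 < 4 by omega)),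
      if_neg (addr_ne_totalCell (show 0 < 4 by omega)), h.color]
  lists v := by
    simp only [Finsupp.update_apply, if_neg (addr_ne_atCell (show 1 < 4 by omega)),
      if_neg (addr_ne_totalCell (show 1 < 4 by omega)), if_neg (addr_ne_atCell (show 2 < 4 by omega)),
      if_neg (addr_ne_totalCell (show 2 < 4 by omega))]
    exact h.lists v
  pos v i hi := by
    simp only [Finsupp.update_apply, if_neg (addr_ne_atCell (show 3 < 4 by omega)),
      if_neg (addr_ne_totalCell (show 3 < 4 by omega)), h.pos]
  pos_zero u v huv := by
    simp only [Finsupp.update_apply, if_neg (addr_ne_atCell (show 3 < 4 by omega)),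
      if_neg (addr_ne_totalCell (show 3 < 4 by omega)), h.pos_zero u v huv]
  entry c' x' γ' := by
    simp only [Finsupp.update_apply, if_neg atCell_ne_totalCell, h.entry, atCell_inj]
    by_cases hc : c' = c
    · subst hc; rfl
    · simp [hc]
  total c' γ' := by
    simp only [Finsupp.update_apply, if_neg atCell_ne_totalCell.symm, h.total, totalCell_inj, h.entry]
    by_cases hc : c' = c
    · subst hc
      by_cases hγ : ∀ g ∈ (π c').ghosts, γ' g = γ g
      · simp only [true_and, if_pos hγ]
        have e : ∀ x' ∈ Finset.univ, (if x' = x ∧ ∀ g ∈ (π c').ghosts, γ' g = γ g then a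
            else f c' x' γ') = Function.update (fun x' => f c' x' γ) x a x' := by
          intro x' _
          rw [Function.update_apply, h.congr_fun hγ]
          exact if_congr (and_iff_left hγ) rfl rfl
        -- The old entry is a summand of the old total, so the truncated subtraction in the new
        -- total loses nothing.
        rw [Finset.sum_congr rfl e, Finset.sum_update_of_mem (Finset.mem_univ x),
          ← Finset.add_sum_erase Finset.univ (fun x => f c' x γ) (Finset.mem_univ x),
          Finset.sdiff_singleton_eq_erase]
        omega
      · simp only [hγ, and_false, if_false]
    · simp [hc]

end ColoredDigraph

/-! ### Recomputing the entries that belong to one vertex. -/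

namespace WordRAM

/-- The product of the values that the programs compute in register `7`, in register `11`. -/
def prodProg (l : List Prog) : Prog :=
  .seq (.const 11 1) (seqList (l.map fun p => .seq p (.op .mul 11 11 7)))

theorem writes_prodProg {l : List Prog} {x : ℕ} (h : (prodProg l).Writes x) :
    x = 11 ∨ ∃ p ∈ l, p.Writes x := by
  simp only [prodProg, Prog.Writes, writes_seqList, List.mem_map] at h
  rcases h with h | ⟨_, ⟨p, hp, rfl⟩, h | h⟩
  · exact .inl h
  · exact .inr ⟨p, hp, h⟩
  · exact .inl h

/-- The product is tracked modulo `2 ^ w` only; a single product may be reduced without harm because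
the sum of all contributions is known to fit into a word. -/
theorem wp_prodProg {α : Type*} {w T : ℕ} {A : Finset ℕ} {l : List α} {F : α → Prog} {val : α → ℕ}
    {s : State} {Q : State → Prop}
    (hF : ∀ a ∈ l, ∀ s₁ : State, s₁.mem = s.mem →
      (∀ y, y < 5 ∨ 7 < y → y ≠ 11 → s₁.reg y = s.reg y) →
      Wp w A (F a) T (fun s' => s'.mem = s₁.mem ∧ s'.reg 7 = val a ∧
        ∀ y, y < 5 ∨ 7 < y → s'.reg y = s₁.reg y) s₁)
    (hQ : ∀ s' : State, s'.mem = s.mem → s'.reg 11 = (l.map val).prod % 2 ^ w →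
      (∀ y, y < 5 ∨ 7 < y → y ≠ 11 → s'.reg y = s.reg y) → Q s') :
    Wp w A (prodProg (l.map F)) (1 + (l.length * (T + 1) + 1)) Q s := by
  refine wp_seq (wp_const ?_)
  rw [List.map_map]
  refine Wp.imp (wp_seqList (fun l₁ s' => s'.mem = s.mem ∧ s'.reg 11 = (l₁.map val).prod % 2 ^ w ∧
      (∀ y, y < 5 ∨ 7 < y → y ≠ 11 → s'.reg y = s.reg y)) ?_ ?_) le_rfl
    (fun s' h => hQ s' h.1 h.2.1 h.2.2)
  · rintro l₁ a l₂ s₁ hl ⟨hm, h11, hr⟩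
    refine wp_seq ((hF a (by simp [hl]) s₁ hm hr).imp le_rfl ?_)
    rintro s₂ ⟨hm₂, h7, hr₂⟩
    refine wp_op ⟨hm₂.trans hm, ?_, ?_⟩
    · rw [State.setReg_reg_self, hr₂ 11 (by omega), h7, h11]
      simp [BinOp.eval, Nat.mul_mod]
    · intro y hy hy'
      rw [State.setReg_reg_ne _ _ hy', hr₂ y hy, hr y hy hy']
  · refine ⟨rfl, by simp, fun y _ hy => State.setReg_reg_ne _ _ hy⟩

end WordRAM

namespace ColoredDigraph

open WordRAM

open scoped Classical

variable {k : ℕ} {V : Type*} [Fintype V] {H : ColoredDigraph k V} (π : ∀ c, H.EvalPlan c) {n : ℕ}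

/-- The general assumptions on the sizes of the words, on the lists of in-neighbours, and on the set of
the admissible cells. -/
structure Setting (w D : ℕ) (A : Finset ℕ) (L : Fin n → List (Fin n)) : Prop where
  fits : Fits n (tables V) w (Fintype.card V + 1)
  color_lt : k + 1 < 2 ^ w
  sum_lt : (n + 1) * n ^ Fintype.card V < 2 ^ w
  nodup : ∀ v, (L v).Nodup
  length_le : ∀ v, (L v).length ≤ D
  pos : 0 < D
  color_mem : ∀ u v : Fin n, u ∈ L v → addr n (tables V) 0 [u, v] ∈ A
  length_mem : ∀ v : Fin n, addr n (tables V) 1 [v] ∈ A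
  list_mem : ∀ (v : Fin n) i, i < D → addr n (tables V) 2 [v, i] ∈ A
  pos_mem : ∀ u v : Fin n, u ∈ L v → addr n (tables V) 3 [u, v] ∈ A
  atCell_mem : ∀ c x (γ : V → Fin n), (∀ g ∈ (π c).ghosts, γ g ∈ L x) → atCell π c x γ ∈ A
  totalCell_mem : ∀ c x (γ : V → Fin n), (∀ g ∈ (π c).ghosts, γ g ∈ L x) → totalCell π c γ ∈ A

/-- The registers that hold the ghosts of `c`. -/
noncomputable def ghostRegs (c : V) : List ℕ := (π c).ghosts.map vreg

/-- The factors of the contribution of an assignment: those for the edges, and those for the parts. -/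
noncomputable def factorProg : (V × V × Fin (k + 1)) ⊕ V → Prog
  | .inl (a, b, i) => .seq (loadAt 7 (tables V) 0 [vreg a, vreg b])
      (.seq (.const 5 (i + 1)) (.op .eq 7 7 5))
  | .inr b => loadAt 7 (tables V) (totalTable b) (ghostRegs π b)

/-- The factors for the vertex `c`. -/
def factors (c : V) : List ((V × V × Fin (k + 1)) ⊕ V) :=
  (π c).edges.map .inl ++ (π c).parts.map .inr

/-- Add the contribution of an assignment to register `10`. -/
noncomputable def contribution (c : V) : Prog :=
  .seq (prodProg ((factors π c).map (factorProg π))) (.op .add 10 10 11)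

/-- Make register `10` the entry for `c` and the assigned images of `c` and of its ghosts, and
change the sum that this entry contributes to. -/
noncomputable def storeEntry (c : V) : Prog :=
  .seq (loadAt 8 (tables V) (atTable c) (vreg c :: ghostRegs π c))
    (.seq (loadAt 9 (tables V) (totalTable c) (ghostRegs π c))
    (.seq (.op .add 9 9 10) (.seq (.op .sub 9 9 8)
    (.seq (storeAt (tables V) (totalTable c) (ghostRegs π c) 9)
    (storeAt (tables V) (atTable c) (vreg c :: ghostRegs π c) 10)))))

/-- Recompute the entries for `c` and the assigned images of `c` and of its ghosts. -/
noncomputable def refreshEntry (c : V) : Prog :=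
  .seq (.const 10 0) (.seq (nest (tables V) vreg (π c).comp (contribution π c)) (storeEntry π c))

/-- Recompute the entries for `c` and the assigned image of `c`. -/
noncomputable def refresh (c : V) : Prog :=
  nest (tables V) vreg ((π c).ghosts.map fun g => (g, c)) (refreshEntry π c)

/-- A bound for the time to compute a contribution. -/
def contributionCost (c : V) : ℕ :=
  1 + ((factors π c).length * (2 * Fintype.card V + 14 + 1) + 1) + 1

/-- A constant for the time of `refreshEntry`. -/
def refreshEntryCost (c : V) : ℕ :=
  contributionCost π c + 26 * (π c).comp.length + (1 + 4 * (2 * Fintype.card V + 8) + 2)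

/-- A constant for the time of `refresh`. -/
def refreshCost (c : V) : ℕ := refreshEntryCost π c + 26 * (π c).ghosts.length

variable {π}

theorem writes_factorProg {a : (V × V × Fin (k + 1)) ⊕ V} {x : ℕ} (h : (factorProg π a).Writes x) :
    5 ≤ x ∧ x ≤ 7 := by
  rcases a with ⟨a, b, i⟩ | b
  · simp only [factorProg, Prog.Writes] at h
    rcases h with h | h | h
    · have := writes_loadAt h; omega
    · omega
    · omega
  · have := writes_loadAt h; omega

theorem writes_contribution {c : V} {x : ℕ} (h : (contribution π c).Writes x) : 5 ≤ x ∧ x < 12 := by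
  rcases h with h | h
  · rcases writes_prodProg h with h | ⟨p, hp, h⟩
    · omega
    · obtain ⟨a, _, rfl⟩ := List.mem_map.1 hp
      have := writes_factorProg h
      omega
  · simp only [Prog.Writes] at h
    omega

theorem writes_refreshEntry {c : V} {x : ℕ} (h : (refreshEntry π c).Writes x) :
    5 ≤ x ∧ x < 12 ∨ ∃ d ∈ (π c).comp.map Prod.fst, x = vreg d ∨ x = vreg d + 1 := by
  simp only [refreshEntry, storeEntry, Prog.Writes] at h
  rcases h with h | h | h | h | h | h | h | h
  · omega
  · rcases writes_nest h with h | h | h | h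
    · exact .inl (writes_contribution h)
    · omega
    · omega
    · exact .inr h
  · have := writes_loadAt h; omega
  · have := writes_loadAt h; omega
  · omega
  · omega
  · have := writes_storeAt h; omega
  · have := writes_storeAt h; omega

theorem writes_refresh {c : V} {x : ℕ} (h : (refresh π c).Writes x) :
    5 ≤ x ∧ x < 12 ∨ 20 ≤ x ∧ x < 20 + 2 * Fintype.card V := by
  have key : ∀ d : V, x = vreg d ∨ x = vreg d + 1 → 20 ≤ x ∧ x < 20 + 2 * Fintype.card V := by
    intro d hd
    have := idx_lt d
    unfold vreg at hd
    omega
  rcases writes_nest h with h | h | h | ⟨d, _, h⟩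
  · rcases writes_refreshEntry h with h | ⟨d, _, h⟩
    · exact .inl h
    · exact .inr (key d h)
  · omega
  · omega
  · exact .inr (key d h)

theorem EvalPlan.notMem_ghosts {c : V} : c ∉ (π c).ghosts := fun h =>
  (((π c).mem_ghosts c).1 h).1 .refl

/-- Since `c` is not among its ghosts, at most |V| - 1 of them are enumerated. Together with the
same bound for the strong component, this gives the exponent 2(|V| - 1). -/
theorem EvalPlan.length_ghosts_lt (c : V) : (π c).ghosts.length < Fintype.card V := by
  have : (c :: (π c).ghosts).Nodup := List.nodup_cons.2 ⟨notMem_ghosts, (π c).ghosts_nodup⟩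
  simpa using this.length_le_card

theorem EvalPlan.length_comp_lt (c : V) : (π c).comp.length < Fintype.card V :=
  (π c).comp_assigns.length_lt (c := c) (.inl rfl)

theorem assigns_of_nodup {ι : Type*} {X : Set ι} {c : ι} {l : List ι} (hl : l.Nodup) (hc : c ∈ X)
    (hX : ∀ g ∈ l, g ∉ X) : Assigns X (l.map fun g => (g, c)) := by
  induction l generalizing X with
  | nil => trivial
  | cons g l ih =>
    obtain ⟨h1, h2⟩ := List.nodup_cons.1 hl
    refine ⟨hc, hX g (by simp), ih h2 (Set.mem_insert_of_mem _ hc) fun g' hg' h => ?_⟩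
    rcases h with rfl | h
    · exact h1 hg'
    · exact hX g' (by simp [hg']) h

/-- A vertex that occurs in the contributions for `c` is `c`, a ghost, or in the strong component. -/
theorem EvalPlan.assigned_of_reach {c v : V} (h1 : H.Reach c v) (h2 : H.Reach v c) :
    v ∈ {v | v = c ∨ v ∈ (π c).ghosts} ∨ v ∈ (π c).comp.map Prod.fst := by
  by_cases h : v = c
  · exact .inl (.inl h)
  · exact .inr (((π c).mem_comp v).2 ⟨h1, h2, h⟩)

theorem EvalPlan.assigned_of_adj {c a b : V} (h1 : H.Reach c b) (h2 : H.Reach b c) (hab : H.Adj a b) :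
    a ∈ {v | v = c ∨ v ∈ (π c).ghosts} ∨ a ∈ (π c).comp.map Prod.fst := by
  by_cases h : H.Reach c a
  · exact assigned_of_reach h (Relation.ReflTransGen.head hab h2)
  · exact .inl (.inr (((π c).mem_ghosts a).2 ⟨h, b, h1, hab⟩))

/-- A ghost `g` of the part `b` has an edge to some `v` reachable from `b`. If `g` were reachable
from `c` outside the strong component, it would lie in a part, and so would `v`; disjointness makes
this the part of `b`, against `g` being a ghost of `b`. Hence the totals of the parts can be looked
up from the assigned images alone. -/
theorem EvalPlan.assigned_of_mem_ghosts {c b g : V} (hb : b ∈ (π c).parts) (hg : g ∈ (π b).ghosts) :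
    g ∈ {v | v = c ∨ v ∈ (π c).ghosts} ∨ g ∈ (π c).comp.map Prod.fst := by
  obtain ⟨h1, v, h2, h3⟩ := ((π b).mem_ghosts g).1 hg
  have hcv := (((π c).parts_cover v).1 ⟨b, hb, h2⟩).1
  by_cases h : H.Reach c g
  · by_cases h' : H.Reach g c
    · exact assigned_of_reach h h'
    · obtain ⟨b', hb', hg'⟩ := ((π c).parts_cover g).2 ⟨h, h'⟩
      exact absurd h2 ((π c).parts_disjoint b' hb' b hb (fun e => h1 (e ▸ hg')) v (hg'.tail h3))
  · exact .inl (.inr (((π c).mem_ghosts g).2 ⟨h, v, hcv, h3⟩))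

/-- The value of a factor. -/
noncomputable def factorVal (G : ColoredDigraph k (Fin n)) (θ : V → Fin n) :
    (V × V × Fin (k + 1)) ⊕ V → ℕ
  | .inl (a, b, i) => if G.color (θ a) (θ b) = some i then 1 else 0
  | .inr b => H.cnt G b θ

/-- The test of the edges is a product of 0-1 comparisons, so a contribution is computed by
multiplications without branching. -/
theorem prod_factorVal (G : ColoredDigraph k (Fin n)) (c : V) (θ : V → Fin n) :
    ((factors π c).map (factorVal (H := H) G θ)).prod =
      (if H.RespectsInto G {v | H.Reach c v ∧ H.Reach v c} θ then 1 else 0) *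
        ∏ b ∈ (π c).parts.toFinset, H.cnt G b θ := by
  rw [factors, List.map_append, List.prod_append, List.map_map, List.map_map]
  congr 1
  · have key : ∀ l : List (V × V × Fin (k + 1)),
        (l.map (factorVal (H := H) G θ ∘ Sum.inl)).prod =
        if ∀ a b i, (a, b, i) ∈ l → G.color (θ a) (θ b) = some i then 1 else 0 := by
      intro l
      induction l with
      | nil => simp
      | cons p l ih =>
        obtain ⟨a, b, i⟩ := p
        rw [List.map_cons, List.prod_cons, ih]
        by_cases h : G.color (θ a) (θ b) = some i
        · simp only [Function.comp, factorVal, h, if_true, one_mul, List.mem_cons]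
          refine if_congr ⟨?_, fun h' a b i hm => h' a b i (.inr hm)⟩ rfl rfl
          rintro h' a' b' i' (e | hm)
          · simp only [Prod.mk.injEq] at e
            obtain ⟨rfl, rfl, rfl⟩ := e
            exact h
          · exact h' a' b' i' hm
        · rw [Function.comp, factorVal, if_neg h, zero_mul, if_neg fun h' => h (h' a b i (by simp))]
    rw [key]
    refine if_congr ?_ rfl rfl
    simp only [(π c).mem_edges, RespectsInto, Set.mem_ofPred_eq]
    exact ⟨fun h a b i hi hb => h a b i ⟨hi, hb⟩, fun h a b i hi => h a b i hi.1 hi.2⟩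
  · rw [List.prod_toFinset _ (π c).parts_nodup]
    rfl

/-- This is the recurrence restricted to the enumerated assignments. An assignment with nonzero
indicator respects the edges of the pairs in `comp`, hence sends each `d` to an in-neighbour of the
image of `s`, and is enumerated. -/
theorem sum_contributions {G : ColoredDigraph k (Fin n)} {L : Fin n → List (Fin n)}
    (hL : ∀ v, (L v).Nodup) (hGL : ∀ a b, G.Adj a b → a ∈ L b) (c : V) (θ : V → Fin n) :
    ((vals L (π c).comp θ).map fun θ' => ((factors π c).map (factorVal (H := H) G θ')).prod).sum =
      H.cntAt G c (θ c) θ := by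
  have hp := (π c).mem_comp
  simp only [prod_factorVal]
  rw [sum_vals hL (π c).comp_assigns, cntAt_eq_sum c (θ c) θ (π c).parts.toFinset
    (by simpa using (π c).parts_cover) (by simpa using (π c).parts_disjoint), Function.update_eq_self]
  · refine Finset.sum_congr ?_ fun _ _ => rfl
    ext θ'
    simp only [hp, Finset.mem_filter, Finset.mem_univ, true_and]
  · intro θ' _ hne p hp
    have hr : H.RespectsInto G {v | H.Reach c v ∧ H.Reach v c} θ' := by
      by_contra hr
      simp [hr] at hne
    obtain ⟨h1, h2, h3⟩ := (π c).comp_adj p hp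
    obtain ⟨i, hi⟩ := Option.ne_none_iff_exists'.1 h1
    exact hGL _ _ (by simp [Adj, hr _ _ i hi ⟨h2, h3⟩])

variable {w D : ℕ} {A : Finset ℕ} {L : Fin n → List (Fin n)} {G : ColoredDigraph k (Fin n)}
  {f : V → Fin n → (V → Fin n) → ℕ} {s : State} {g₀ : ℕ → ℕ}

theorem map_ghostRegs {c : V} {θ : V → Fin n} (h : ∀ g ∈ (π c).ghosts, s.reg (vreg g) = θ g) :
    (ghostRegs π c).map s.reg = ghostIndex π c θ := by
  rw [ghostRegs, ghostIndex, List.map_map]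
  exact List.map_congr_left h

theorem Setting.ghostRegs_ok {c : V} : ∀ r ∈ ghostRegs π c, 6 < r ∨ r < 5 := by
  intro r hr
  obtain ⟨v, _, rfl⟩ := List.mem_map.1 hr
  have := vreg_mod v
  omega

theorem wp_factor (hS : Setting π w D A L) (hs : Ready n s) (hR : Rep π g₀ G L f s.mem) {c : V}
    (hf : ∀ b ∈ (π c).parts, ∀ x γ, f b x γ = H.cntAt G b x γ) {θ : V → Fin n}
    (hθ : ∀ v, v ∈ {v | v = c ∨ v ∈ (π c).ghosts} ∨ v ∈ (π c).comp.map Prod.fst →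
      s.reg (vreg v) = θ v) {a : (V × V × Fin (k + 1)) ⊕ V} (ha : a ∈ factors π c) :
    Wp w A (factorProg π a) (2 * Fintype.card V + 14) (fun s' => s'.mem = s.mem ∧
      s'.reg 7 = factorVal (H := H) G θ a ∧ ∀ y, y < 5 ∨ 7 < y → s'.reg y = s.reg y) s := by
  rw [factors, List.mem_append, List.mem_map, List.mem_map] at ha
  rcases ha with ⟨⟨a, b, i⟩, hm, rfl⟩ | ⟨b, hb, rfl⟩
  · obtain ⟨hi, h1, h2⟩ := ((π c).mem_edges a b i).1 hm
    have hb := hθ b (EvalPlan.assigned_of_reach h1 h2)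
    have ha := hθ a (EvalPlan.assigned_of_adj h1 h2 (by simp [Adj, hi]))
    have hva := vreg_mod a
    have hvb := vreg_mod b
    refine Wp.mono (wp_seq (T₁ := 12) (wp_loadAt hs.1 hs.2 (by simp; omega) (l := [(θ a : ℕ), (θ b : ℕ)])
      (by simp [ha, hb]) (hS.fits.addr_lt _ _ (by unfold tables; omega) hS.fits.two (by simp))
      hS.fits.sq fun s' hm h7 hr => wp_seq (wp_const (wp_op ⟨?_, ?_, ?_⟩)))) (by omega)
    · simpa using hm
    · have hi : (i : ℕ) + 1 < 2 ^ w := by have := hS.color_lt; omega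
      simp only [State.setReg_reg_self, BinOp.eval, State.setReg_reg_ne _ _ (show 7 ≠ 5 by omega), h7,
        hR.color, Nat.mod_eq_of_lt hi, colorCode_eq_succ, factorVal]
    · intro y hy
      rw [State.setReg_reg_ne _ _ (by omega), State.setReg_reg_ne _ _ (by omega),
        hr y (by omega) (by omega) (by omega)]
  · have hlen := EvalPlan.length_ghosts_lt (π := π) b
    refine Wp.mono (wp_loadAt hs.1 hs.2 Setting.ghostRegs_ok (l := ghostIndex π b θ) (map_ghostRegs
      fun g hg => hθ g (EvalPlan.assigned_of_mem_ghosts hb hg))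
      (hS.fits.addr_lt _ _ (totalTable_lt b) (by rw [length_ghostIndex]; omega) lt_of_mem_ghostIndex)
      hS.fits.sq fun s' hm h7 hr => ⟨hm, ?_, fun y hy => hr y (by omega) (by omega) (by omega)⟩) ?_
    · rw [h7]
      refine (hR.total b θ).trans ?_
      rw [factorVal, cnt_eq_sum]
      exact Finset.sum_congr rfl fun x _ => hf b hb x θ
    · simp only [ghostRegs, List.length_map]
      omega

end ColoredDigraph

namespace ColoredDigraph

open WordRAM

open scoped Classical

variable {k : ℕ} {V : Type*} [Fintype V] {H : ColoredDigraph k V} {π : ∀ c, H.EvalPlan c} {n : ℕ}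

variable {w D : ℕ} {A : Finset ℕ} {L : Fin n → List (Fin n)} {G : ColoredDigraph k (Fin n)}
  {f : V → Fin n → (V → Fin n) → ℕ} {s : State} {g₀ : ℕ → ℕ}

theorem wp_contribution (hS : Setting π w D A L) (hs : Ready n s) (hR : Rep π g₀ G L f s.mem) {c : V}
    (hf : ∀ b ∈ (π c).parts, ∀ x γ, f b x γ = H.cntAt G b x γ) {θ : V → Fin n}
    (hθ : ∀ v, v ∈ {v | v = c ∨ v ∈ (π c).ghosts} ∨ v ∈ (π c).comp.map Prod.fst →
      s.reg (vreg v) = θ v) {a : ℕ} (ha : s.reg 10 = a % 2 ^ w) :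
    Wp w A (contribution π c) (contributionCost π c) (fun s' => s'.mem = s.mem ∧
      s'.reg 10 = (a + ((factors π c).map (factorVal (H := H) G θ)).prod) % 2 ^ w) s := by
  refine wp_seq (T₂ := 1) (wp_prodProg (T := 2 * Fintype.card V + 14)
    (val := factorVal (H := H) G θ) (fun b hb s₁ hm hr => ?_)
    fun s' hm h11 hr => wp_op ⟨by simpa using hm, ?_⟩)
  · have hv : ∀ v : V, s₁.reg (vreg v) = s.reg (vreg v) := fun v => by
      have := vreg_mod v
      exact hr _ (by omega) (by omega)
    exact wp_factor hS (hs.congr (hr _ (by omega) (by omega)) (hr _ (by omega) (by omega)))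
      (hm ▸ hR) hf (fun v hv' => (hv v).trans (hθ v hv')) hb
  · rw [State.setReg_reg_self, h11, hr 10 (by omega) (by omega), ha]
    simp [BinOp.eval, Nat.add_mod]

theorem wp_storeEntry (hS : Setting π w D A L) (hs : Ready n s) (hR : Rep π g₀ G L f s.mem) {c : V}
    (hb : ∀ x γ, f c x γ ≤ n ^ Fintype.card V) {θ : V → Fin n}
    (hθ : ∀ v, v = c ∨ v ∈ (π c).ghosts → s.reg (vreg v) = θ v)
    (hg : ∀ g ∈ (π c).ghosts, θ g ∈ L (θ c)) {a : ℕ} (ha : s.reg 10 = a)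
    (ha' : a ≤ n ^ Fintype.card V) :
    Wp w A (storeEntry π c) (4 * (2 * Fintype.card V + 8) + 2)
      (fun s' => Rep π g₀ G L (fun c' x' γ' => if c' = c ∧ x' = θ c ∧ ∀ g ∈ (π c).ghosts, γ' g = θ g
        then a else f c' x' γ') s'.mem) s := by
  have hlen := EvalPlan.length_ghosts_lt (π := π) c
  have hglen : (ghostRegs π c).length = (π c).ghosts.length := by simp [ghostRegs]
  have hN : ∑ x, f c x θ ≤ n * n ^ Fintype.card V := by
    simpa using Finset.sum_le_card_nsmul Finset.univ (fun x => f c x θ) _ fun x _ => hb x θ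
  have hsum := hS.sum_lt
  rw [add_mul, one_mul] at hsum
  have hcell : atCell π c (θ c) θ < 2 ^ w := hS.fits.addr_lt _ _ (atTable_lt c)
    (by simp [length_ghostIndex]; omega) (by simpa using lt_of_mem_ghostIndex)
  have hcell' : totalCell π c θ < 2 ^ w := hS.fits.addr_lt _ _ (totalTable_lt c)
    (by simp [length_ghostIndex]; omega) lt_of_mem_ghostIndex
  have hreg : ∀ s' : State, (∀ y, y < 5 ∨ 9 < y → s'.reg y = s.reg y) → Ready n s' ∧
      (ghostRegs π c).map s'.reg = ghostIndex π c θ ∧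
      (vreg c :: ghostRegs π c).map s'.reg = (θ c : ℕ) :: ghostIndex π c θ ∧ s'.reg 10 = a := by
    intro s' h
    have hv : ∀ v : V, s'.reg (vreg v) = s.reg (vreg v) := fun v => by
      have := vreg_mod v
      exact h _ (by omega)
    have hgi := map_ghostRegs (π := π) (s := s') (c := c) (θ := θ)
      fun g hg => (hv g).trans (hθ g (.inr hg))
    exact ⟨hs.congr (h _ (by omega)) (h _ (by omega)), hgi, by
      rw [List.map_cons, hgi, hv, hθ c (.inl rfl)], (h _ (by omega)).trans ha⟩
  have hok := Setting.ghostRegs_ok (π := π) (c := c)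
  have hok' : ∀ r ∈ vreg c :: ghostRegs π c, 6 < r ∨ r < 5 := by
    have := vreg_mod c
    rintro r (_ | ⟨_, hr⟩)
    · omega
    · exact hok r hr
  obtain ⟨r0, g0, v0, a0⟩ := hreg s fun _ _ => rfl
  refine Wp.mono (T := (2 * (vreg c :: ghostRegs π c).length + 8) + ((2 * (ghostRegs π c).length + 8) +
    (1 + (1 + ((2 * (ghostRegs π c).length + 8) + (2 * (vreg c :: ghostRegs π c).length + 8))))))
    (wp_seq (wp_loadAt r0.1 r0.2 hok' v0 hcell hS.fits.sq fun s₁ hm₁ h8 hr₁ => ?_))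
    (by simp only [List.length_cons, hglen]; omega)
  obtain ⟨r1, g1, v1, a1⟩ := hreg s₁ fun y hy => hr₁ y (by omega) (by omega) (by omega)
  refine wp_seq (wp_loadAt r1.1 r1.2 hok g1 hcell' hS.fits.sq fun s₂ hm₂ h9 hr₂ =>
    wp_seq (wp_op (wp_seq (wp_op ?_))))
  obtain ⟨r2, g2, v2, a2⟩ := hreg s₂ fun y hy =>
    (hr₂ y (by omega) (by omega) (by omega)).trans (hr₁ y (by omega) (by omega) (by omega))
  set s₃ := (s₂.setReg 9 (BinOp.add.eval w (s₂.reg 9) (s₂.reg 10))) with hs₃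
  have e9 : s₂.reg 9 = ∑ x, f c x θ := by
    rw [h9, hm₁]; exact hR.total c θ
  have e8 : s₂.reg 8 = f c (θ c) θ := by
    rw [hr₂ 8 (by omega) (by omega) (by omega), h8]; exact hR.entry c (θ c) θ
  have e3 : BinOp.sub.eval w (s₃.reg 9) (s₃.reg 8) = s.mem (totalCell π c θ) + a - s.mem (atCell π c (θ c) θ) := by
    rw [hs₃, State.setReg_reg_self, State.setReg_reg_ne _ _ (by omega), e8, e9, a2]
    simp only [BinOp.eval]
    -- Before the subtraction the register holds the old total plus `a`, at most `(n + 1) * n ^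
    -- |V|`, so the addition does not wrap around.
    rw [Nat.mod_eq_of_lt (by omega), hR.total, hR.entry]
  rw [e3]
  obtain ⟨r4, g4, v4, a4⟩ := hreg (s₃.setReg 9 (s.mem (totalCell π c θ) + a - s.mem (atCell π c (θ c) θ)))
    fun y hy => by
      rw [State.setReg_reg_ne _ _ (by omega), hs₃, State.setReg_reg_ne _ _ (by omega),
        hr₂ y (by omega) (by omega) (by omega), hr₁ y (by omega) (by omega) (by omega)]
  refine wp_seq (wp_storeAt r4.1 r4.2 hok g4 hcell' hS.fits.sq (by omega)
    (hS.totalCell_mem c (θ c) θ hg) fun s₅ hm₅ hr₅ => ?_)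
  obtain ⟨r5, g5, v5, a5⟩ := hreg s₅ fun y hy => by
      rw [hr₅ y (by omega) (by omega), State.setReg_reg_ne _ _ (by omega), hs₃, State.setReg_reg_ne _ _ (by omega),
        hr₂ y (by omega) (by omega) (by omega), hr₁ y (by omega) (by omega) (by omega)]
  refine wp_storeAt r5.1 r5.2 hok' v5 hcell hS.fits.sq (by omega)
    (hS.atCell_mem c (θ c) θ hg) fun s₆ hm₆ hr₆ => ?_
  have := hR.setEntry c (θ c) θ a
  rw [hm₆, a5, hm₅, State.setReg_reg_self, State.setReg_mem, hs₃, State.setReg_mem, hm₂, hm₁]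
  exact this

theorem wp_refreshEntry (hS : Setting π w D A L) (hs : Ready n s) (hR : Rep π g₀ G L f s.mem) {c : V}
    (hGL : ∀ a b, G.Adj a b → a ∈ L b)
    (hf : ∀ b ∈ (π c).parts, ∀ x γ, f b x γ = H.cntAt G b x γ)
    (hb : ∀ x γ, f c x γ ≤ n ^ Fintype.card V) {θ : V → Fin n}
    (hθ : ∀ v, v = c ∨ v ∈ (π c).ghosts → s.reg (vreg v) = θ v)
    (hg : ∀ g ∈ (π c).ghosts, θ g ∈ L (θ c)) :
    Wp w A (refreshEntry π c) (refreshEntryCost π c * D ^ (π c).comp.length)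
      (fun s' => Rep π g₀ G L (fun c' x' γ' => if c' = c ∧ x' = θ c ∧ ∀ g ∈ (π c).ghosts, γ' g = θ g
        then H.cntAt G c (θ c) θ else f c' x' γ') s'.mem) s := by
  refine Wp.mono (T := 1 + ((contributionCost π c + 26 * (π c).comp.length) * D ^ (π c).comp.length +
    (4 * (2 * Fintype.card V + 8) + 2))) (wp_seq (wp_const (wp_seq (Wp.imp (Wp.frame (wp_nest hS.fits
    (by unfold tables; omega) hS.nodup
    hS.length_le vreg_injective vreg_mod hS.pos (π c).comp_assigns (θ := θ) (done := [])
    (I := fun done mem r => mem = s.mem ∧ r = (done.map fun θ' =>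
      ((factors π c).map (factorVal (H := H) G θ')).prod).sum % 2 ^ w) ?_ ?_
    (fun done θ' s₁ _ hs₁ hI hv => (wp_contribution hS hs₁
        (hI.1 ▸ hR) hf hv hI.2).imp le_rfl ?_) ?_ ?_ ?_)) le_rfl ?_)))) ?_
  · rintro done mem r ⟨rfl, _⟩
    exact hR.lists
  · intro x hx
    have := writes_contribution hx
    refine ⟨by omega, by omega, fun v => ?_⟩
    have := vreg_mod v
    constructor <;> intro <;> omega
  · rintro s' ⟨h1, h2⟩
    exact ⟨h1.trans hI.1, by simpa using h2⟩
  · exact hs.congr (State.setReg_reg_ne _ _ (by omega)) (State.setReg_reg_ne _ _ (by omega))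
  · intro v hv
    have := vreg_mod v
    rw [State.setReg_reg_ne _ _ (by omega), hθ v hv]
  · exact ⟨rfl, by simp⟩
  · rintro s₁ ⟨⟨hm₁, ha₁⟩, hr₁⟩
    have hw : ∀ y, y < 5 ∨ (∃ v, (v = c ∨ v ∈ (π c).ghosts) ∧ y = vreg v) → s₁.reg y = s.reg y := by
      intro y hy
      rw [hr₁, State.setReg_reg_ne]
      · rintro rfl
        rcases hy with hy | ⟨v, _, hy⟩
        · omega
        · have := vreg_mod v; omega
      · intro h
        rcases writes_nest h with h | h | h | ⟨d, hd, h⟩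
        · have := writes_contribution h
          rcases hy with hy | ⟨v, _, hy⟩
          · omega
          · have := vreg_mod v; omega
        · rcases hy with hy | ⟨v, _, hy⟩
          · omega
          · have := vreg_mod v; omega
        · rcases hy with hy | ⟨v, _, hy⟩
          · omega
          · have := vreg_mod v; omega
        · have h1 := vreg_mod d
          rcases hy with hy | ⟨v, hv, hy⟩
          · omega
          · have h2 := vreg_mod v
            have h3 : vreg d ≠ vreg v := fun e =>
              (π c).comp_assigns.notMem d hd (vreg_injective e ▸ hv)
            omega
    rw [← hm₁] at hR
    have htot : H.cntAt G c (θ c) θ ≤ n ^ Fintype.card V := by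
      simpa using cntAt_le (H := H) (G := G) c (θ c) θ
    refine wp_storeEntry hS (hs.congr (hw _ (.inl (by omega))) (hw _ (.inl (by omega)))) hR hb
      (fun v hv => (hw _ (.inr ⟨v, hv, rfl⟩)).trans (hθ v hv)) hg ?_ htot
    rw [ha₁, List.nil_append, sum_contributions hS.nodup hGL]
    -- Only here does the modular sum become exact: the count is at most `n ^ |V|`.
    refine Nat.mod_eq_of_lt (lt_of_le_of_lt htot (lt_of_le_of_lt ?_ hS.sum_lt))
    exact Nat.le_mul_of_pos_left _ (by omega)
  · have h1 : 1 ≤ D ^ (π c).comp.length := Nat.one_le_pow _ _ hS.pos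
    unfold refreshEntryCost
    nlinarith

end ColoredDigraph

namespace ColoredDigraph

open WordRAM

open scoped Classical

variable {k : ℕ} {V : Type*} [Fintype V] {H : ColoredDigraph k V} {π : ∀ c, H.EvalPlan c} {n : ℕ}

variable {w D : ℕ} {A : Finset ℕ} {L : Fin n → List (Fin n)} {G G' : ColoredDigraph k (Fin n)}
  {f : V → Fin n → (V → Fin n) → ℕ} {s : State} {g₀ : ℕ → ℕ}

/-- Only assignments of the ghosts to members of `L x` are run through. For all other ones the entry
is zero before, by `h0`, and its new value is zero too, since ghosts are sent to in-neighbours of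
`x`. -/
theorem wp_refresh (hS : Setting π w D A L) (hs : Ready n s) (hR : Rep π g₀ G L f s.mem) {c : V}
    (hGL : ∀ a b, G.Adj a b → a ∈ L b)
    (hf : ∀ b ∈ (π c).parts, ∀ x γ, f b x γ = H.cntAt G b x γ)
    (hb : ∀ x γ, f c x γ ≤ n ^ Fintype.card V) {x : Fin n} (hx : s.reg (vreg c) = x)
    (h0 : ∀ γ g, g ∈ (π c).ghosts → γ g ∉ L x → f c x γ = 0) :
    Wp w A (refresh π c) (refreshCost π c * D ^ (2 * (Fintype.card V - 1)))
      (fun s' => Rep π g₀ G L (fun c' x' γ => if c' = c ∧ x' = x then H.cntAt G c' x' γ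
        else f c' x' γ) s'.mem) s := by
  have hl : Assigns {c} ((π c).ghosts.map fun g => (g, c)) :=
    assigns_of_nodup (π c).ghosts_nodup rfl fun g hg h => EvalPlan.notMem_ghosts (h ▸ hg)
  have hfst : ((π c).ghosts.map fun g => (g, c)).map Prod.fst = (π c).ghosts := by
    simp [Function.comp_def]
  have hvals : ∀ {θ : V → Fin n}, θ ∈ vals L ((π c).ghosts.map fun g => (g, c)) (fun _ => x) ↔
      (∀ v, v ∉ (π c).ghosts → θ v = x) ∧ ∀ g ∈ (π c).ghosts, θ g ∈ L (θ c) := by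
    intro θ
    rw [mem_vals hl, hfst]
    simp
  refine Wp.imp (wp_nest (T := refreshEntryCost π c * D ^ (π c).comp.length) hS.fits
    (by unfold tables; omega) hS.nodup
    hS.length_le vreg_injective vreg_mod hS.pos hl (θ := fun _ => x) (done := [])
    (I := fun done mem _ => Rep π g₀ G L (fun c' x' γ => if c' = c ∧ x' = x ∧
      ∃ θ ∈ done, ∀ g ∈ (π c).ghosts, γ g = θ g then H.cntAt G c' x' γ else f c' x' γ) mem)
      ?_ ?_ ?_ hs ?_ ?_) ?_ ?_
  · exact fun done mem a h => h.lists
  · intro y hy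
    rw [hfst]
    rcases writes_refreshEntry hy with hy | ⟨d, hd, hy⟩
    · refine ⟨by omega, by omega, fun v => ?_⟩
      have := vreg_mod v
      constructor <;> intro <;> omega
    · have h1 := vreg_mod d
      refine ⟨by omega, by omega, fun v => ?_⟩
      have h2 := vreg_mod v
      have h3 : v ∈ ({c} : Set V) ∨ v ∈ (π c).ghosts → vreg d ≠ vreg v := fun hv e =>
        (π c).comp_assigns.notMem d hd (vreg_injective e ▸ hv)
      exact ⟨fun hv => by have := h3 hv; omega, fun hv => by have := h3 (.inr hv); omega⟩
  · intro done θ s₁ hθ hs₁ hI hv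
    rw [hfst] at hv
    obtain ⟨h1, h2⟩ := hvals.1 hθ
    have hxc : θ c = x := h1 c EvalPlan.notMem_ghosts
    refine Wp.imp (wp_refreshEntry hS hs₁ hI hGL ?_ ?_ (θ := θ) hv h2) le_rfl ?_
    · intro b hb y γ
      -- No part is represented by `c` itself, so rewriting the entries of `c` leaves the totals it
      -- depends on untouched.
      have hbc : b ≠ c := by
        rintro rfl
        exact (((π b).parts_cover b).1 ⟨b, hb, .refl⟩).2 .refl
      simpa [hbc] using hf b hb y γ
    · intro y γ
      split_ifs
      · simpa using cntAt_le (H := H) (G := G) c y γ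
      · exact hb y γ
    · intro s' h
      refine h.congr fun c' x' γ => ?_
      simp only [hxc, List.mem_append, List.mem_singleton, or_and_right, exists_or, exists_eq_left]
      by_cases h : c' = c ∧ x' = x
      · obtain ⟨rfl, rfl⟩ := h
        simp only [true_and]
        by_cases h' : ∀ g ∈ (π c').ghosts, γ g = θ g
        · rw [if_pos h', if_pos (.inr h')]
          refine cntAt_congr x' fun g b hg hb hgb => (h' g ?_).symm
          exact ((π c').mem_ghosts g).2 ⟨hg, b, hb, hgb⟩
        · simp only [h', if_false, or_false]
      · rw [if_neg fun h' => h ⟨h'.1, h'.2.1⟩, if_neg fun h' => h ⟨h'.1, h'.2.1⟩,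
          if_neg fun h' => h ⟨h'.1, h'.2.1⟩]
  · rintro v rfl
    exact hx
  · simpa using hR
  · rw [List.length_map]
    have h1 : 1 ≤ D ^ (π c).comp.length := Nat.one_le_pow _ _ hS.pos
    have h2 := EvalPlan.length_comp_lt (π := π) c
    have h3 := EvalPlan.length_ghosts_lt (π := π) c
    calc _ ≤ refreshCost π c * D ^ (π c).comp.length * D ^ (π c).ghosts.length := by
          refine Nat.mul_le_mul_right _ ?_
          unfold refreshCost
          nlinarith
      _ = refreshCost π c * D ^ ((π c).comp.length + (π c).ghosts.length) := by
          rw [mul_assoc, pow_add]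
      _ ≤ _ := Nat.mul_le_mul_left _ (Nat.pow_le_pow_right hS.pos (by omega))
  · intro s' h
    refine h.congr fun c' x' γ => ?_
    by_cases h : c' = c ∧ x' = x
    · obtain ⟨rfl, rfl⟩ := h
      simp only [true_and, List.nil_append, and_self, if_true]
      -- Off the ghosts `γ` is arbitrary, while the enumerated valuations are constant there, so the
      -- witness replaces those values by `x'`.
      by_cases hγ : ∀ g ∈ (π c').ghosts, γ g ∈ L x'
      · refine if_pos ⟨fun v => if v ∈ (π c').ghosts then γ v else x', hvals.2 ⟨?_, ?_⟩, ?_⟩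
        · intro v hv; simp [hv]
        · intro g hg; simpa [hg, EvalPlan.notMem_ghosts] using hγ g hg
        · intro g hg; simp [hg]
      · push Not at hγ
        obtain ⟨g, hg, hgL⟩ := hγ
        have e : H.cntAt G c' x' γ = 0 := by
          by_contra hne
          exact hgL (hGL _ _ (adj_of_cntAt_ne_zero hne (((π c').mem_ghosts g).1 hg).1
            ((π c').ghosts_adj g hg)))
        rw [e, h0 γ g hg hgL, ite_self]
    · rw [if_neg fun h' => h ⟨h'.1, h'.2.1⟩, if_neg h]

/-! ### Recomputation after a change of a colour -/

variable (V) in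
/-- The registers for the vertices of a walk. -/
def wreg (j : ℕ) : ℕ := 20 + 2 * Fintype.card V + 2 * j

theorem wreg_injective : Function.Injective (wreg V) := fun i j h => by
  unfold wreg at h
  omega

theorem wreg_mod (j : ℕ) : 20 ≤ wreg V j ∧ wreg V j % 2 = 0 := by
  unfold wreg; omega

variable (π) in
/-- Recompute the entries for `c` and the ends of the backward walks of length `j`. -/
noncomputable def refreshWalks (c : V) (j : ℕ) : Prog :=
  nest (tables V) (wreg V) (walkPairs 0 j) (.seq (move (vreg c) (wreg V j)) (refresh π c))

variable (π) in
/-- Recompute the entries for all vertices of `ord` and the ends of the backward walks of length less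
than `|V|` that start in the vertex in register `1`. -/
noncomputable def refreshNear (ord : List V) : Prog :=
  .seq (move (wreg V 0) 1) (seqList (ord.map fun c =>
    seqList ((List.range (Fintype.card V)).map (refreshWalks π c))))

variable (π) in
/-- A constant for the time of `refreshWalks`. -/
def refreshWalksCost : ℕ := ∑ c, (2 + refreshCost π c + 26 * Fintype.card V)

/-- The start of the walks has to survive, because it is used again for every length and every
vertex. -/
theorem writes_refreshWalks {c : V} {j x : ℕ} (h : (refreshWalks π c j).Writes x) :
    5 ≤ x ∧ x < 12 ∨ 20 ≤ x ∧ x ≠ wreg V 0 := by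
  rcases writes_nest h with h | h | h | ⟨d, hd, h⟩
  · rcases h with h | h
    · have := writes_move h
      have h1 := vreg_mod c
      have h2 := idx_lt c
      unfold wreg
      unfold vreg at *
      omega
    · have := writes_refresh h
      unfold wreg
      omega
  · omega
  · omega
  · have := lt_of_mem_walkPairs hd
    unfold wreg at *
    omega

theorem writes_refreshNear {ord : List V} {x : ℕ} (h : (refreshNear π ord).Writes x) :
    5 ≤ x ∧ x < 12 ∨ 20 ≤ x := by
  rcases h with h | h
  · have := writes_move h
    have := wreg_mod (V := V) 0
    omega
  · simp only [writes_seqList, List.mem_map] at h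
    obtain ⟨_, ⟨c, _, rfl⟩, h⟩ := h
    simp only [writes_seqList, List.mem_map] at h
    obtain ⟨_, ⟨j, _, rfl⟩, h⟩ := h
    have := writes_refreshWalks h
    omega

/-- The numbers of extensions after a change, for the pairs in `P`, and before it, for the others. -/
noncomputable def mixed (H : ColoredDigraph k V) (G G' : ColoredDigraph k (Fin n))
    (P : V → Fin n → Prop) (c : V) (x : Fin n) (γ : V → Fin n) : ℕ :=
  if P c x then H.cntAt G' c x γ else H.cntAt G c x γ

/-- The set `P` of pairs already in the new state only grows. Refreshing a pair twice is harmless,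
since the totals of the parts are already the new ones. -/
theorem wp_refreshWalks (hS : Setting π w D A L) (hs : Ready n s) {P : V → Fin n → Prop}
    (hR : Rep π g₀ G' L (mixed H G G' P) s.mem) (hGL : ∀ a b, G.Adj a b → a ∈ L b)
    (hGL' : ∀ a b, G'.Adj a b → a ∈ L b) {c : V} (hP : ∀ b ∈ (π c).parts, ∀ x, P b x)
    {y : Fin n} (hy : s.reg (wreg V 0) = y) {j : ℕ} (hj : j < Fintype.card V) :
    Wp w A (refreshWalks π c j) (refreshWalksCost π * D ^ (Fintype.card V ^ 2))
      (fun s' => ∃ P' : V → Fin n → Prop, (∀ b x, P b x → P' b x) ∧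
        (∀ x, BackWalk L j y x → P' c x) ∧ Rep π g₀ G' L (mixed H G G' P') s'.mem) s := by
  -- An entry may still be old or already new, so its vanishing outside the lists is needed for both
  -- graphs.
  have hzero : ∀ G₁ : ColoredDigraph k (Fin n), (∀ a b, G₁.Adj a b → a ∈ L b) → ∀ x γ g,
      g ∈ (π c).ghosts → γ g ∉ L x → H.cntAt G₁ c x γ = 0 := by
    intro G₁ hG₁ x γ g hg hgL
    by_contra hne
    exact hgL (hG₁ _ _ (adj_of_cntAt_ne_zero hne (((π c).mem_ghosts g).1 hg).1 ((π c).ghosts_adj g hg)))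
  refine Wp.imp (wp_nest (T := 2 + refreshCost π c * D ^ (2 * (Fintype.card V - 1))) hS.fits
    (by unfold tables; omega) hS.nodup hS.length_le wreg_injective wreg_mod hS.pos
    (assigns_walkPairs (X := {0}) rfl (by simp) j) (θ := fun _ => y) (done := [])
    (I := fun done mem _ => ∃ P' : V → Fin n → Prop, (∀ b x, P b x → P' b x) ∧
        (∀ θ ∈ done, P' c (θ j)) ∧ Rep π g₀ G' L (mixed H G G' P') mem)
      ?_ ?_ ?_ hs ?_ ?_) ?_ ?_
  · rintro done mem a ⟨P', _, _, h⟩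
    exact h.lists
  · intro x hx
    have hx' : 5 ≤ x ∧ x < 12 ∨ 20 ≤ x ∧ x < 20 + 2 * Fintype.card V := by
      rcases hx with hx | hx
      · have := writes_move hx
        have h1 := vreg_mod c
        have h2 := idx_lt c
        unfold vreg at *
        omega
      · exact writes_refresh hx
    refine ⟨by omega, by omega, fun v => ?_⟩
    unfold wreg
    constructor <;> intro <;> omega
  · rintro done θ s₁ hθ hs₁ ⟨P', h1, h2, h3⟩ hv
    have hjv : s₁.reg (wreg V j) = θ j := by
      refine hv j ?_
      by_cases h0 : j = 0
      · exact .inl h0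
      · right
        clear * - h0
        have : ∀ s j, 0 < j → s + j ∈ (walkPairs s j).map Prod.fst := by
          intro s j
          induction j generalizing s with
          | zero => simp
          | succ j ih =>
            intro _
            by_cases h : j = 0
            · subst h; simp [walkPairs]
            · refine List.mem_cons_of_mem _ ?_
              have := ih (s + 1) (by omega)
              rwa [show s + (j + 1) = s + 1 + j by omega]
        simpa using this 0 j (by omega)
    have hlt : s₁.reg (wreg V j) < 2 ^ w := by
      rw [hjv]
      have h4 := hS.fits.sq
      have h5 := hS.fits.pos
      have := (θ j).isLt
      nlinarith
    have := wreg_mod (V := V) j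
    have hvc := vreg_mod c
    refine wp_seq (wp_move (by omega) hlt fun s₂ hm hr2 hr => ?_)
    refine Wp.imp (wp_refresh hS (hs₁.congr (hr _ (by omega) (by omega)) (hr _ (by omega) (by omega)))
      (hm ▸ h3) hGL' ?_ ?_ (x := θ j) (hr2.trans hjv) ?_) le_rfl ?_
    · intro b hb x γ
      simp [mixed, h1 b x (hP b hb x)]
    · intro x γ
      unfold mixed
      split_ifs
      · simpa using cntAt_le (H := H) (G := G') c x γ
      · simpa using cntAt_le (H := H) (G := G) c x γ
    · intro γ g hg hgL
      simp [mixed, hzero G hGL _ γ g hg hgL, hzero G' hGL' _ γ g hg hgL]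
    · intro s' h
      refine ⟨fun b x => P' b x ∨ b = c ∧ x = θ j, fun b x hb => .inl (h1 b x hb), ?_,
        h.congr fun b x γ => ?_⟩
      · intro θ' hθ'
        rcases List.mem_append.1 hθ' with hθ' | hθ'
        · exact .inl (h2 θ' hθ')
        · rw [List.mem_singleton.1 hθ']
          exact .inr ⟨rfl, rfl⟩
      · unfold mixed
        by_cases hc : b = c ∧ x = θ j
        · simp [hc]
        · simp only [hc, if_false, or_false]
  · rintro v rfl
    exact hy
  · exact ⟨P, fun _ _ h => h, by simp, hR⟩
  · rw [length_walkPairs]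
    set m := Fintype.card V with hm
    have h1 : 1 ≤ D ^ (2 * (m - 1)) := Nat.one_le_pow _ _ hS.pos
    have h2 : 2 + refreshCost π c + 26 * m ≤ refreshWalksCost π :=
      Finset.single_le_sum (f := fun c => 2 + refreshCost π c + 26 * m) (fun _ _ => Nat.zero_le _)
        (Finset.mem_univ c)
    calc _ ≤ (2 + refreshCost π c + 26 * m) * D ^ (2 * (m - 1)) * D ^ j := by
          refine Nat.mul_le_mul_right _ ?_
          nlinarith
      _ = (2 + refreshCost π c + 26 * m) * D ^ (2 * (m - 1) + j) := by rw [mul_assoc, pow_add]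
      _ ≤ _ := by
          -- The exponent is 2(m - 1) + j with j ≤ m - 1, and 3(m - 1) ≤ m².
          refine Nat.mul_le_mul h2 (Nat.pow_le_pow_right hS.pos ?_)
          obtain ⟨m', hm'⟩ : ∃ m', m = m' + 1 := ⟨m - 1, by omega⟩
          rw [hm']
          have : j ≤ m' := by omega
          simp only [Nat.add_sub_cancel]
          nlinarith [sq_nonneg ((m' : ℤ) - 1), Nat.le_self_pow (n := 2) (by omega) m']
  · rintro s' ⟨P', h1, h2, h3⟩
    refine ⟨P', h1, fun x hx => ?_, h3⟩
    obtain ⟨θ, hθ, hθx⟩ := exists_mem_vals_walkPairs (s := 0) (θ := fun _ => y) hx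
    rw [zero_add] at hθx
    exact hθx ▸ h2 θ (by simpa using hθ)

/-- In the list `ord` of the vertices, the vertices reachable from `c`, other than those in the strong
component of `c`, precede `c`. -/
def IsEvalOrder (H : ColoredDigraph k V) (ord : List V) : Prop :=
  (∀ v, v ∈ ord) ∧ ∀ l₁ c l₂, ord = l₁ ++ c :: l₂ → ∀ b, H.Reach c b → ¬ H.Reach b c → b ∈ l₁

/-- Sort by the number of reachable vertices. If `c` reaches `b` but not conversely, then `b`
reaches strictly fewer vertices than `c`, as `c` itself is lost. -/
theorem exists_isEvalOrder (H : ColoredDigraph k V) : ∃ ord, IsEvalOrder H ord := by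
  let h : V → ℕ := fun v => (Finset.univ.filter fun u => H.Reach v u).card
  let l := (Finset.univ : Finset V).toList.insertionSort fun a b => h a ≤ h b
  have : IsTrans V fun a b => h a ≤ h b := ⟨fun _ _ _ => le_trans⟩
  have : Std.Total fun a b : V => h a ≤ h b := ⟨fun _ _ => le_total _ _⟩
  have hl : ∀ v, v ∈ l := fun v => (List.perm_insertionSort _ _).mem_iff.2 (by simp)
  refine ⟨l, hl, fun l₁ c l₂ e b hcb hbc => ?_⟩
  have hs : l.Pairwise fun a b => h a ≤ h b := List.pairwise_insertionSort _ _
  have hb := hl b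
  rw [e] at hb hs
  rcases List.mem_append.1 hb with hb | hb
  · exact hb
  · rcases List.mem_cons.1 hb with rfl | hb
    · exact absurd .refl hbc
    · have h1 := (List.pairwise_cons.1 (List.pairwise_append.1 hs).2.1).1 b hb
      refine absurd h1 (not_le.2 (Finset.card_lt_card ⟨fun u hu => ?_, fun hsub => hbc ?_⟩))
      · simp only [Finset.mem_filter, Finset.mem_univ, true_and] at hu ⊢
        exact hcb.trans hu
      · simpa using hsub (x := c) (Finset.mem_filter.2 ⟨Finset.mem_univ _, .refl⟩)

variable (π) in
/-- A constant for the time of `refreshNear`. -/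
def refreshNearCost (ord : List V) : ℕ :=
  2 + (ord.length * (Fintype.card V * refreshWalksCost π + 1) + 1)

/-- On entry the memory holds the new graph with the old counts. The order guarantees that the parts
of a vertex are completely up to date when its turn comes. -/
theorem wp_refreshNear (hS : Setting π w D A L) (hs : Ready n s)
    (hR : Rep π g₀ G' L (H.cntAt G) s.mem) (hGL : ∀ a b, G.Adj a b → a ∈ L b)
    (hGL' : ∀ a b, G'.Adj a b → a ∈ L b) {x₀ y₀ : Fin n}
    (hGG : ∀ a b, ¬ (a = x₀ ∧ b = y₀) → G'.color a b = G.color a b)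
    (hy : s.reg 1 = y₀) {ord : List V} (hord : IsEvalOrder H ord) :
    Wp w A (refreshNear π ord) (refreshNearCost π ord * D ^ (Fintype.card V ^ 2))
      (fun s' => Rep π g₀ G' L (H.cntAt G') s'.mem) s := by
  have hlt : s.reg 1 < 2 ^ w := by
    rw [hy]
    have h4 := hS.fits.sq
    have h5 := hS.fits.pos
    have := y₀.isLt
    nlinarith
  have hw := wreg_mod (V := V) 0
  set E := D ^ (Fintype.card V ^ 2) with hE
  refine Wp.mono (T := 2 + (ord.length * (Fintype.card V * (refreshWalksCost π * E) + 1) + 1))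
    (wp_seq (wp_move (by omega) hlt fun s₁ hm₁ hw₁ hr₁ => ?_)) ?_
  · refine Wp.imp (wp_seqList (fun l₁ s => Ready n s ∧ s.reg (wreg V 0) = y₀ ∧
      ∃ P : V → Fin n → Prop, (∀ b ∈ l₁, ∀ x, P b x) ∧ Rep π g₀ G' L (mixed H G G' P) s.mem)
      ?_ ⟨?_, ?_, ?_⟩) le_rfl ?_
    · rintro l₁ c l₂ s e ⟨hs, hy, P, hP, hR⟩
      refine Wp.imp (wp_seqList (fun js s => Ready n s ∧ s.reg (wreg V 0) = y₀ ∧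
        ∃ P : V → Fin n → Prop, (∀ b ∈ l₁, ∀ x, P b x) ∧
        (∀ j ∈ js, ∀ x, BackWalk L j y₀ x → P c x) ∧ Rep π g₀ G' L (mixed H G G' P) s.mem)
        (T := refreshWalksCost π * E) ?_ ⟨hs, hy, P, hP, by simp, hR⟩)
        (by rw [List.length_range]) ?_
      · rintro js j js' s ej ⟨hs, hy, P, h1, h2, h3⟩
        have hj : j < Fintype.card V := List.mem_range.1 (ej ▸ by simp)
        refine Wp.imp (Wp.frame (wp_refreshWalks hS hs h3 hGL hGL' (fun b hb => h1 b ?_) hy hj))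
          le_rfl ?_
        · obtain ⟨h4, h5⟩ := ((π c).parts_cover b).1 ⟨b, hb, .refl⟩
          exact hord.2 _ _ _ e b h4 h5
        · rintro s' ⟨⟨P', h4, h5, h6⟩, hr⟩
          have hw' : ∀ x, x < 5 ∨ x = wreg V 0 → s'.reg x = s.reg x := fun x hx => hr x fun h => by
            have := writes_refreshWalks h
            omega
          refine ⟨hs.congr (hw' _ (by omega)) (hw' _ (by omega)), (hw' _ (.inr rfl)).trans hy, P',
            fun b hb x => h4 b x (h1 b hb x), fun i hi x hx => ?_, h6⟩
          rcases List.mem_append.1 hi with hi | hi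
          · exact h4 c x (h2 i hi x hx)
          · exact h5 x (List.mem_singleton.1 hi ▸ hx)
      · rintro s' ⟨hs', hy', P, h1, h2, h3⟩
        refine ⟨hs', hy', fun b x => P b x ∨ b = c, fun b hb x => ?_, h3.congr fun b x γ => ?_⟩
        · rcases List.mem_append.1 hb with hb | hb
          · exact .inl (h1 b hb x)
          · exact .inr (List.mem_singleton.1 hb)
        · unfold mixed
          by_cases hb : P b x
          · simp [hb]
          · by_cases hc : b = c
            · subst hc
              simp only [hb, if_false, or_true, if_true]
              -- After all walk lengths, an image of `c` that was not refreshed is far from `y₀`, so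
              -- its old entry is already the new one.
              exact cntAt_eq_of_not_backWalk hGG hGL hGL'
                (fun j hj hw => hb (h2 j (List.mem_range.2 hj) x hw)) γ
            · simp [hb, hc]
    · exact hs.congr (hr₁ _ (by omega) (by omega)) (hr₁ _ (by omega) (by omega))
    · rw [hw₁, hy]
    · rw [hm₁]
      exact ⟨fun _ _ => False, by simp, hR.congr fun b x γ => by simp [mixed]⟩
    · rintro s' ⟨_, _, P, h1, h2⟩
      exact h2.congr fun b x γ => by simp [mixed, h1 b (hord.1 b) x]
  · have : 1 ≤ E := Nat.one_le_pow _ _ hS.pos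
    unfold refreshNearCost
    have h1 : ord.length * (Fintype.card V * (refreshWalksCost π * E) + 1) ≤
      ord.length * (Fintype.card V * refreshWalksCost π + 1) * E := by
      rw [mul_assoc]
      refine Nat.mul_le_mul_left _ ?_
      nlinarith
    nlinarith

end ColoredDigraph

namespace ColoredDigraph

open WordRAM

open scoped Classical

variable {k : ℕ} {V : Type*} [Fintype V] {H : ColoredDigraph k V} {π : ∀ c, H.EvalPlan c} {n : ℕ}

variable {w D : ℕ} {A : Finset ℕ} {L : Fin n → List (Fin n)} {G G' : ColoredDigraph k (Fin n)}
  {f : V → Fin n → (V → Fin n) → ℕ} {s : State} {g₀ : ℕ → ℕ} {mem mem' : ℕ →₀ ℕ}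

/-! ### Changes of the colours and of the lists of in-neighbours -/

theorem four_le_tables : 4 ≤ tables V := by unfold tables; omega

theorem addr_one_inj {g : ℕ} (hg : g < 4) {v v' : Fin n} :
    addr n (tables V) g [(v : ℕ)] = addr n (tables V) g [(v' : ℕ)] ↔ v = v' := by
  have := four_le_tables (V := V)
  refine ⟨fun h => ?_, fun h => h ▸ rfl⟩
  simpa [Fin.val_inj] using (addr_inj (by omega) (by omega) (by simp) (by simp) (by simp) h).2

theorem addr_two_inj {g : ℕ} (hg : g < 4) {u v : Fin n} {u' v' : Fin n} :
    addr n (tables V) g [(u : ℕ), (v : ℕ)] = addr n (tables V) g [(u' : ℕ), (v' : ℕ)] ↔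
      u = u' ∧ v = v' := by
  have := four_le_tables (V := V)
  refine ⟨fun h => ?_, fun h => h.1 ▸ h.2 ▸ rfl⟩
  simpa [Fin.val_inj] using (addr_inj (by omega) (by omega) (by simp) (by simp) (by simp) h).2

theorem addr_list_inj {g : ℕ} (hg : g < 4) {v v' : Fin n} {i i' : ℕ} (hi : i < n) (hi' : i' < n) :
    addr n (tables V) g [(v : ℕ), i] = addr n (tables V) g [(v' : ℕ), i'] ↔ v = v' ∧ i = i' := by
  simpa using addr_two_inj (V := V) hg (u := v) (v := ⟨i, hi⟩) (u' := v') (v' := ⟨i', hi'⟩)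

/-- Changes confined to the four tables describing the graph and its lists affect neither the input
nor the counts. -/
theorem Rep.of_eq_off (h : Rep π g₀ G L f mem) (hn : 0 < n)
    (hm : ∀ a, (∀ g l, g < 4 → a ≠ addr n (tables V) g l) → mem' a = mem a)
    (color : ∀ u v : Fin n, mem' (addr n (tables V) 0 [u, v]) = colorCode (G'.color u v))
    {L' : Fin n → List (Fin n)} (lists : HasLists (tables V) L' mem')
    (pos : ∀ (v : Fin n) i (h : i < (L' v).length), mem' (addr n (tables V) 3 [(L' v)[i], v]) = i)
    (pos_zero : ∀ u v : Fin n, u ∉ L' v → mem' (addr n (tables V) 3 [u, v]) = 0) :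
    Rep π g₀ G' L' f mem' where
  low a ha := by
    have := four_le_tables (V := V)
    rw [hm a, h.low a ha]
    intro g l hg e
    have := le_addr hn (show 0 < tables V by omega) g l
    omega
  color := color
  lists := lists
  pos := pos
  pos_zero := pos_zero
  entry c x γ := by rw [hm _ fun g l hg => (addr_ne_atCell hg).symm, h.entry]
  total c γ := by rw [hm _ fun g l hg => (addr_ne_totalCell hg).symm, h.total]

/-- The counts `f` are deliberately left as they were; they belong to the old graph until the
refresh. -/
theorem Rep.setColor (h : Rep π g₀ G L f mem) {u v : Fin n} {o : Option (Fin (k + 1))}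
    (hG : ∀ a b, G'.color a b = if a = u ∧ b = v then o else G.color a b) :
    Rep π g₀ G' L f (mem.update (addr n (tables V) 0 [u, v]) (colorCode o)) := by
  have h4 := four_le_tables (V := V)
  refine h.of_eq_off u.pos ?_ ?_ ?_ ?_ ?_
  · intro a ha
    rw [Finsupp.update_apply, if_neg (ha _ _ (by omega))]
  · intro a b
    rw [Finsupp.update_apply, hG, h.color]
    by_cases e : a = u ∧ b = v
    · rw [if_pos ((addr_two_inj (by omega)).2 e), if_pos e]
    · rw [if_neg fun e' => e ((addr_two_inj (by omega)).1 e'), if_neg e]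
  · intro b
    simp only [Finsupp.update_apply, if_neg (addr_ne (show 1 < tables V by omega)
      (show 0 < tables V by omega) (show 1 ≠ 0 by omega)),
      if_neg (addr_ne (show 2 < tables V by omega)
      (show 0 < tables V by omega) (show 2 ≠ 0 by omega))]
    exact h.lists b
  · intro b i hi
    rw [Finsupp.update_apply, if_neg (addr_ne (by omega) (by omega) (by omega)), h.pos]
  · intro a b hab
    rw [Finsupp.update_apply, if_neg (addr_ne (by omega) (by omega) (by omega)), h.pos_zero a b hab]

theorem length_lt_of_notMem {l : List (Fin n)} (hl : l.Nodup) {u : Fin n} (hu : u ∉ l) :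
    l.length < n := by
  have : (u :: l).Nodup := List.nodup_cons.2 ⟨hu, hl⟩
  simpa using this.length_le_card

/-- Lists and colours are independent in `Rep`: the new member enters the list while the edge is
still absent from the graph. -/
theorem Rep.insert (h : Rep π g₀ G L f mem) (hL : ∀ v, (L v).Nodup) {u v : Fin n} (hu : u ∉ L v) :
    Rep π g₀ G (Function.update L v (L v ++ [u])) f
      (((mem.update (addr n (tables V) 2 [v, (L v).length]) u).update
        (addr n (tables V) 3 [u, v]) (L v).length).update
        (addr n (tables V) 1 [v]) ((L v).length + 1)) := by
  have h4 := four_le_tables (V := V)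
  have hlen := length_lt_of_notMem (hL v) hu
  refine h.of_eq_off u.pos ?_ ?_ ?_ ?_ ?_
  · intro a ha
    rw [Finsupp.update_apply, if_neg (ha _ _ (by omega)), Finsupp.update_apply,
      if_neg (ha _ _ (by omega)), Finsupp.update_apply, if_neg (ha _ _ (by omega))]
  · intro a b
    rw [Finsupp.update_apply, if_neg (addr_ne (by omega) (by omega) (by omega)),
      Finsupp.update_apply, if_neg (addr_ne (by omega) (by omega) (by omega)),
      Finsupp.update_apply, if_neg (addr_ne (by omega) (by omega) (by omega)), h.color]
  · intro b
    obtain ⟨h1, h2⟩ := h.lists b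
    constructor
    · rw [Finsupp.update_apply]
      simp only [addr_one_inj (V := V) (show 1 < 4 by omega)]
      by_cases e : b = v
      · subst e; simp
      · rw [if_neg e, Finsupp.update_apply, if_neg (addr_ne (by omega) (by omega) (by omega)),
          Finsupp.update_apply, if_neg (addr_ne (by omega) (by omega) (by omega)), h1,
          Function.update_of_ne e]
    · intro i hi
      have hi' : i < n := by
        by_cases e : b = v
        · subst e
          simp at hi
          omega
        · rw [Function.update_of_ne e] at hi
          have := (hL b).length_le_card
          simp at this
          omega
      rw [Finsupp.update_apply, if_neg (addr_ne (by omega) (by omega) (by omega)),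
        Finsupp.update_apply, if_neg (addr_ne (by omega) (by omega) (by omega)), Finsupp.update_apply]
      simp only [addr_list_inj (V := V) (show 2 < 4 by omega) hi' hlen]
      by_cases e : b = v
      · subst e
        simp only [Function.update_self, List.length_append, List.length_singleton] at hi ⊢
        by_cases e' : i = (L b).length
        · simp [e']
        · simp only [e', and_false, if_false]
          rw [h2 i (by omega), List.getElem_append_left (by omega)]
      · rw [if_neg fun h => e h.1]
        simp only [Function.update_of_ne e] at hi ⊢
        exact h2 i hi
  · intro b i hi
    rw [Finsupp.update_apply, if_neg (addr_ne (by omega) (by omega) (by omega)), Finsupp.update_apply]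
    simp only [addr_two_inj (V := V) (show 3 < 4 by omega)]
    by_cases e : b = v
    · subst e
      simp only [Function.update_self, List.length_append, List.length_singleton] at hi ⊢
      by_cases e' : i = (L b).length
      · simp [e']
      · have hi' : i < (L b).length := by omega
        have hne : (L b)[i] ≠ u := fun h => hu (h ▸ List.getElem_mem hi')
        simp only [List.getElem_append_left hi', hne, false_and, if_false]
        rw [Finsupp.update_apply, if_neg (addr_ne (by omega) (by omega) (by omega)), h.pos]
    · rw [if_neg fun h => e h.2]
      simp only [Function.update_of_ne e] at hi ⊢
      rw [Finsupp.update_apply, if_neg (addr_ne (by omega) (by omega) (by omega)), h.pos]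
  · intro a b hab
    have h1 : ¬ (a = u ∧ b = v) := by
      rintro ⟨rfl, rfl⟩
      simp at hab
    have h2 : a ∉ L b := by
      by_cases e : b = v
      · subst e; simp at hab; exact hab.1
      · rwa [Function.update_of_ne e] at hab
    rw [Finsupp.update_apply, if_neg (addr_ne (by omega) (by omega) (by omega)), Finsupp.update_apply,
      if_neg fun e => h1 ((addr_two_inj (by omega)).1 e), Finsupp.update_apply,
      if_neg (addr_ne (by omega) (by omega) (by omega)), h.pos_zero a b h2]

/-- Remove the member with the index `i` of a list, and move the last one to its place. -/
def swapRemove {α : Type*} (l : List α) (i : ℕ) (hl : l.length - 1 < l.length) : List α :=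
  (l.set i (l[l.length - 1])).dropLast

theorem getElem_swapRemove {α : Type*} {l : List α} {i : ℕ} (hl : l.length - 1 < l.length) {j : ℕ}
    (hj : j < (swapRemove l i hl).length) :
    (swapRemove l i hl)[j] = if j = i then l[l.length - 1] else
      l[j]'(by simp [swapRemove] at hj; omega) := by
  simp [swapRemove, List.getElem_set, eq_comm]

theorem length_swapRemove {α : Type*} {l : List α} {i : ℕ} (hl : l.length - 1 < l.length) :
    (swapRemove l i hl).length = l.length - 1 := by
  simp [swapRemove]

theorem nodup_swapRemove {α : Type*} {l : List α} (hn : l.Nodup) {i : ℕ}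
    (hl : l.length - 1 < l.length) : (swapRemove l i hl).Nodup := by
  rw [List.nodup_iff_injective_getElem]
  rintro ⟨a, ha⟩ ⟨b, hb⟩ hab
  simp only [getElem_swapRemove] at hab
  rw [length_swapRemove] at ha hb
  rw [Fin.mk.injEq]
  split_ifs at hab with h1 h2 h2
  · omega
  · have := (hn.getElem_inj_iff).1 hab; omega
  · have := (hn.getElem_inj_iff).1 hab; omega
  · exact (hn.getElem_inj_iff).1 hab

theorem mem_swapRemove {α : Type*} {l : List α} (hn : l.Nodup) {i : ℕ} (hi : i < l.length)
    (hl : l.length - 1 < l.length) {x : α} : x ∈ swapRemove l i hl ↔ x ∈ l ∧ x ≠ l[i] := by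
  constructor
  · intro hx
    obtain ⟨j, hj, rfl⟩ := List.mem_iff_getElem.1 hx
    rw [getElem_swapRemove]
    rw [length_swapRemove] at hj
    split_ifs with h
    · exact ⟨List.getElem_mem _, fun e => by have := (hn.getElem_inj_iff).1 e; omega⟩
    · exact ⟨List.getElem_mem _, fun e => by have := (hn.getElem_inj_iff).1 e; omega⟩
  · rintro ⟨hx, hxi⟩
    obtain ⟨j, hj, rfl⟩ := List.mem_iff_getElem.1 hx
    have hji : j ≠ i := fun e => hxi (by subst e; rfl)
    by_cases h : j = l.length - 1
    · refine List.mem_iff_getElem.2 ⟨i, by rw [length_swapRemove]; omega, ?_⟩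
      rw [getElem_swapRemove, if_pos rfl]
      subst h; rfl
    · refine List.mem_iff_getElem.2 ⟨j, by rw [length_swapRemove]; omega, ?_⟩
      rw [getElem_swapRemove, if_neg hji]

/-- The position of the removed member is cleared after the last member has received the position
`p`; when they coincide, the clearing must win. The former last slot of the list is not erased,
which is why all slots with index below `D` count as admissible cells. -/
theorem Rep.swapRemove (h : Rep π g₀ G L f mem) (hL : ∀ v, (L v).Nodup) {v : Fin n} {p : ℕ}
    (hp : p < (L v).length) (hl : (L v).length - 1 < (L v).length) :
    Rep π g₀ G (Function.update L v (swapRemove (L v) p hl)) f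
      ((((mem.update (addr n (tables V) 2 [v, p]) (L v)[(L v).length - 1]).update
        (addr n (tables V) 3 [(L v)[(L v).length - 1], v]) p).update
        (addr n (tables V) 3 [(L v)[p], v]) 0).update
        (addr n (tables V) 1 [v]) ((L v).length - 1)) := by
  have h4 := four_le_tables (V := V)
  have hlen : ∀ b, (L b).length ≤ n := fun b => by simpa using (hL b).length_le_card
  have hpn : p < n := lt_of_lt_of_le hp (hlen v)
  refine h.of_eq_off v.pos ?_ ?_ ?_ ?_ ?_
  · intro a ha
    rw [Finsupp.update_apply, if_neg (ha _ _ (by omega)), Finsupp.update_apply,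
      if_neg (ha _ _ (by omega)), Finsupp.update_apply, if_neg (ha _ _ (by omega)),
      Finsupp.update_apply, if_neg (ha _ _ (by omega))]
  · intro a b
    rw [Finsupp.update_apply, if_neg (addr_ne (by omega) (by omega) (by omega)),
      Finsupp.update_apply, if_neg (addr_ne (by omega) (by omega) (by omega)),
      Finsupp.update_apply, if_neg (addr_ne (by omega) (by omega) (by omega)),
      Finsupp.update_apply, if_neg (addr_ne (by omega) (by omega) (by omega)), h.color]
  · intro b
    obtain ⟨h1, h2⟩ := h.lists b
    constructor
    · rw [Finsupp.update_apply]
      simp only [addr_one_inj (V := V) (show 1 < 4 by omega)]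
      by_cases e : b = v
      · subst e; simp [length_swapRemove]
      · rw [if_neg e, Finsupp.update_apply, if_neg (addr_ne (by omega) (by omega) (by omega)),
          Finsupp.update_apply, if_neg (addr_ne (by omega) (by omega) (by omega)),
          Finsupp.update_apply, if_neg (addr_ne (by omega) (by omega) (by omega)), h1,
          Function.update_of_ne e]
    · intro i hi
      have hi' : i < n := by
        by_cases e : b = v
        · subst e
          simp [length_swapRemove] at hi
          have := hlen b
          omega
        · rw [Function.update_of_ne e] at hi
          have := hlen b
          omega
      rw [Finsupp.update_apply, if_neg (addr_ne (by omega) (by omega) (by omega)),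
        Finsupp.update_apply, if_neg (addr_ne (by omega) (by omega) (by omega)), Finsupp.update_apply,
        if_neg (addr_ne (by omega) (by omega) (by omega)), Finsupp.update_apply]
      simp only [addr_list_inj (V := V) (show 2 < 4 by omega) hi' hpn]
      by_cases e : b = v
      · subst e
        simp only [Function.update_self] at hi ⊢
        rw [getElem_swapRemove]
        rw [length_swapRemove] at hi
        simp only [true_and]
        split_ifs
        · rfl
        · exact h2 i (by omega)
      · rw [if_neg fun h => e h.1]
        simp only [Function.update_of_ne e] at hi ⊢
        exact h2 i hi
  · intro b i hi
    rw [Finsupp.update_apply, if_neg (addr_ne (by omega) (by omega) (by omega)), Finsupp.update_apply,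
      Finsupp.update_apply]
    simp only [addr_two_inj (V := V) (show 3 < 4 by omega)]
    by_cases e : b = v
    · subst e
      simp only [Function.update_self] at hi ⊢
      rw [if_neg fun h => ((mem_swapRemove (hL b) hp hl).1 (List.getElem_mem hi)).2 h.1,
        getElem_swapRemove]
      rw [length_swapRemove] at hi
      by_cases e : i = p
      · simp [e]
      · rw [if_neg e, if_neg fun h => by have := ((hL b).getElem_inj_iff).1 h.1; omega,
          Finsupp.update_apply, if_neg (addr_ne (by omega) (by omega) (by omega)), h.pos]
    · rw [if_neg fun h => e h.2, if_neg fun h => e h.2]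
      simp only [Function.update_of_ne e] at hi ⊢
      rw [Finsupp.update_apply, if_neg (addr_ne (by omega) (by omega) (by omega)), h.pos]
  · intro a b hab
    rw [Finsupp.update_apply, if_neg (addr_ne (by omega) (by omega) (by omega)), Finsupp.update_apply,
      Finsupp.update_apply]
    simp only [addr_two_inj (V := V) (show 3 < 4 by omega)]
    split_ifs with h1 h2
    · rfl
    · obtain ⟨rfl, rfl⟩ := h2
      rw [Function.update_self, mem_swapRemove (hL b) hp] at hab
      exact absurd ⟨List.getElem_mem _, fun e => h1 ⟨e, rfl⟩⟩ hab
    · rw [Finsupp.update_apply, if_neg (addr_ne (by omega) (by omega) (by omega)), h.pos_zero a b ?_]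
      by_cases e : b = v
      · subst e
        rw [Function.update_self, mem_swapRemove (hL b) hp] at hab
        exact fun ha => hab ⟨ha, fun e => h1 ⟨e, rfl⟩⟩
      · rwa [Function.update_of_ne e] at hab

variable (V)

/-- Give the edge from the vertex in register `0` to that in register `1` the colour with the code in
register `2`. -/
def colorProg : Prog := storeAt (tables V) 0 [0, 1] 2

/-- Add the vertex in register `0` to the list of the vertex in register `1`. -/
def insertProg : Prog :=
  .seq (loadAt 7 (tables V) 1 [1]) (.seq (storeAt (tables V) 2 [1, 7] 0)
    (.seq (storeAt (tables V) 3 [0, 1] 7) (.seq (.const 5 1) (.seq (.op .add 7 7 5)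
      (storeAt (tables V) 1 [1] 7)))))

/-- Remove the vertex in register `0` from the list of the vertex in register `1`. -/
def deleteProg : Prog :=
  .seq (loadAt 7 (tables V) 3 [0, 1]) (.seq (loadAt 8 (tables V) 1 [1]) (.seq (.const 5 1)
    (.seq (.op .sub 8 8 5) (.seq (loadAt 9 (tables V) 2 [1, 8]) (.seq (storeAt (tables V) 2 [1, 7] 9)
      (.seq (storeAt (tables V) 3 [9, 1] 7) (.seq (.const 10 0) (.seq (storeAt (tables V) 3 [0, 1] 10)
        (storeAt (tables V) 1 [1] 8)))))))))

variable {V}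

theorem writes_insertProg {x : ℕ} (h : (insertProg V).Writes x) : 5 ≤ x ∧ x < 12 := by
  simp only [insertProg, Prog.Writes] at h
  rcases h with h | h | h | h | h | h
  · have := writes_loadAt h; omega
  · have := writes_storeAt h; omega
  · have := writes_storeAt h; omega
  · omega
  · omega
  · have := writes_storeAt h; omega

theorem writes_deleteProg {x : ℕ} (h : (deleteProg V).Writes x) : 5 ≤ x ∧ x < 12 := by
  simp only [deleteProg, Prog.Writes] at h
  rcases h with h | h | h | h | h | h | h | h | h | h
  · have := writes_loadAt h; omega
  · have := writes_loadAt h; omega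
  · omega
  · omega
  · have := writes_loadAt h; omega
  · have := writes_storeAt h; omega
  · have := writes_storeAt h; omega
  · omega
  · have := writes_storeAt h; omega
  · have := writes_storeAt h; omega

theorem Setting.addr_lt (hS : Setting π w D A L) {g : ℕ} (hg : g < 4) {l : List ℕ}
    (hl : l.length ≤ 2) (h : ∀ e ∈ l, e < n) : addr n (tables V) g l < 2 ^ w :=
  hS.fits.addr_lt _ _ (lt_of_lt_of_le hg four_le_tables) (hl.trans hS.fits.two) h

theorem wp_colorProg (hS : Setting π w D A L) (hs : Ready n s) (hR : Rep π g₀ G L f s.mem)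
    {u v : Fin n} (huv : u ∈ L v) {o : Option (Fin (k + 1))} (h0 : s.reg 0 = u) (h1 : s.reg 1 = v)
    (h2 : s.reg 2 = colorCode o)
    (hG : ∀ a b, G'.color a b = if a = u ∧ b = v then o else G.color a b) :
    Wp w A (colorProg V) 12 (fun s' => Rep π g₀ G' L f s'.mem) s :=
  wp_storeAt hs.1 hs.2 (by simp) (l := [(u : ℕ), (v : ℕ)]) (by simp [h0, h1])
    (hS.addr_lt (by omega) (by simp) (by simp)) hS.fits.sq (by omega) (hS.color_mem u v huv)
    fun s' hm _ => by
      rw [hm, h2]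
      exact hR.setColor hG

theorem Setting.lt_pow (hS : Setting π w D A L) {a : ℕ} (ha : a ≤ n) : a < 2 ^ w := by
  have h4 := hS.fits.sq
  have h5 := hS.fits.pos
  nlinarith

/-- The setting is that of the extended list: its length bound makes the new slot admissible. -/
theorem wp_insertProg {u v : Fin n} (hS : Setting π w D A (Function.update L v (L v ++ [u])))
    (hs : Ready n s) (hR : Rep π g₀ G L f s.mem) (hL : ∀ v, (L v).Nodup)
    (huv : u ∉ L v) (h0 : s.reg 0 = u) (h1 : s.reg 1 = v) :
    Wp w A (insertProg V) 46 (fun s' => Rep π g₀ G (Function.update L v (L v ++ [u])) f s'.mem) s := by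
  have hlen := length_lt_of_notMem (hL v) huv
  have hD := hS.length_le v
  simp only [Function.update_self, List.length_append, List.length_singleton] at hD
  refine Wp.mono (T := 10 + (12 + (12 + (1 + (1 + 10))))) (wp_seq (wp_loadAt hs.1 hs.2 (by simp)
    (l := [(v : ℕ)]) (by simp [h1]) (hS.addr_lt (by omega) (by simp) (by simp)) hS.fits.sq
    fun s₁ hm₁ h7 hr₁ => ?_)) (by omega)
  have r1 : ∀ y, y < 5 → s₁.reg y = s.reg y := fun y hy => hr₁ y (by omega) (by omega) (by omega)
  rw [(hR.lists v).1] at h7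
  refine wp_seq (wp_storeAt ((r1 3 (by omega)).trans hs.1) ((r1 4 (by omega)).trans hs.2) (by simp)
    (l := [(v : ℕ), (L v).length]) (by simp [r1, h1, h7])
    (hS.addr_lt (by omega) (by simp) (by simp [hlen])) hS.fits.sq (by omega)
    (hS.list_mem v _ (by omega)) fun s₂ hm₂ hr₂ => ?_)
  have r2 : ∀ y, y < 5 → s₂.reg y = s.reg y := fun y hy =>
    (hr₂ y (by omega) (by omega)).trans (r1 y hy)
  have h7₂ : s₂.reg 7 = (L v).length := (hr₂ 7 (by omega) (by omega)).trans h7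
  refine wp_seq (wp_storeAt ((r2 3 (by omega)).trans hs.1) ((r2 4 (by omega)).trans hs.2) (by simp)
    (l := [(u : ℕ), (v : ℕ)]) (by simp [r2, h1, h0])
    (hS.addr_lt (by omega) (by simp) (by simp)) hS.fits.sq (by omega)
    (hS.pos_mem u v (by simp)) fun s₃ hm₃ hr₃ => ?_)
  have r3 : ∀ y, y < 5 → s₃.reg y = s.reg y := fun y hy =>
    (hr₃ y (by omega) (by omega)).trans (r2 y hy)
  have h7₃ : s₃.reg 7 = (L v).length := (hr₃ 7 (by omega) (by omega)).trans h7₂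
  refine wp_seq (wp_const (wp_seq (wp_op ?_)))
  have e : BinOp.add.eval w ((s₃.setReg 5 (1 % 2 ^ w)).reg 7) ((s₃.setReg 5 (1 % 2 ^ w)).reg 5) =
      (L v).length + 1 := by
    rw [State.setReg_reg_self, State.setReg_reg_ne _ _ (by omega), h7₃, hS.fits.one_mod]
    exact Nat.mod_eq_of_lt (hS.lt_pow hlen)
  rw [e]
  have r4 : ∀ y, y < 5 → ((s₃.setReg 5 (1 % 2 ^ w)).setReg 7 ((L v).length + 1)).reg y = s.reg y :=
    fun y hy => by
      rw [State.setReg_reg_ne _ _ (by omega), State.setReg_reg_ne _ _ (by omega), r3 y hy]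
  refine wp_storeAt ((r4 3 (by omega)).trans hs.1) ((r4 4 (by omega)).trans hs.2) (by simp)
    (l := [(v : ℕ)]) (by rw [List.map_singleton, r4 1 (by omega), h1])
    (hS.addr_lt (by omega) (by simp) (by simp)) hS.fits.sq (by omega)
    (hS.length_mem v) fun s₅ hm₅ hr₅ => ?_
  have := hR.insert hL huv
  rw [hm₅, State.setReg_reg_self, State.setReg_mem, State.setReg_mem, hm₃, h7₂, hm₂, r1 0 (by omega), h0, hm₁]
  exact this

/-- The table of positions yields the index `p` without a search, so the time does not depend on the
length of the list. -/
theorem wp_deleteProg (hS : Setting π w D A L) (hs : Ready n s) (hR : Rep π g₀ G L f s.mem)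
    {u v : Fin n} {p : ℕ} (hp : p < (L v).length) (hu : (L v)[p] = u) (h0 : s.reg 0 = u)
    (h1 : s.reg 1 = v) (hl : (L v).length - 1 < (L v).length) :
    Wp w A (deleteProg V) 83
      (fun s' => Rep π g₀ G (Function.update L v (swapRemove (L v) p hl)) f s'.mem) s := by
  have hD := hS.length_le v
  have hlen : (L v).length ≤ n := by simpa using (hS.nodup v).length_le_card
  refine Wp.mono (T := 12 + (10 + (1 + (1 + (12 + (12 + (12 + (1 + (12 + 10))))))))) (wp_seq (wp_loadAt hs.1 hs.2 (by simp)
    (l := [(u : ℕ), (v : ℕ)]) (by simp [h0, h1]) (hS.addr_lt (by omega) (by simp) (by simp)) hS.fits.sq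
    fun s₁ hm₁ h7 hr₁ => ?_)) (by omega)
  have r1 : ∀ y, y < 5 → s₁.reg y = s.reg y := fun y hy => hr₁ y (by omega) (by omega) (by omega)
  rw [← hu, hR.pos v p hp] at h7
  refine wp_seq (wp_loadAt ((r1 3 (by omega)).trans hs.1) ((r1 4 (by omega)).trans hs.2) (by simp)
    (l := [(v : ℕ)]) (by simp [r1, h1]) (hS.addr_lt (by omega) (by simp) (by simp)) hS.fits.sq
    fun s₂ hm₂ h8 hr₂ => ?_)
  rw [hm₁, (hR.lists v).1] at h8
  have r2 : ∀ y, y < 5 → s₂.reg y = s.reg y := fun y hy =>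
    (hr₂ y (by omega) (by omega) (by omega)).trans (r1 y hy)
  have h7₂ : s₂.reg 7 = p := (hr₂ 7 (by omega) (by omega) (by omega)).trans h7
  refine wp_seq (wp_const (wp_seq (wp_op ?_)))
  have e : BinOp.sub.eval w ((s₂.setReg 5 (1 % 2 ^ w)).reg 8) ((s₂.setReg 5 (1 % 2 ^ w)).reg 5) =
      (L v).length - 1 := by
    rw [State.setReg_reg_self, State.setReg_reg_ne _ _ (by omega), h8, hS.fits.one_mod]
    rfl
  rw [e]
  obtain ⟨s₃, hs₃⟩ : ∃ s₃, s₃ = (s₂.setReg 5 (1 % 2 ^ w)).setReg 8 ((L v).length - 1) := ⟨_, rfl⟩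
  rw [← hs₃]
  have hm₃ : s₃.mem = s.mem := by rw [hs₃, State.setReg_mem, State.setReg_mem, hm₂, hm₁]
  have r3 : ∀ y, y < 5 → s₃.reg y = s.reg y := fun y hy => by
    rw [hs₃, State.setReg_reg_ne _ _ (by omega), State.setReg_reg_ne _ _ (by omega), r2 y hy]
  have h7₃ : s₃.reg 7 = p := by
    rw [hs₃, State.setReg_reg_ne _ _ (by omega), State.setReg_reg_ne _ _ (by omega), h7₂]
  have h8₃ : s₃.reg 8 = (L v).length - 1 := by rw [hs₃, State.setReg_reg_self]
  refine wp_seq (wp_loadAt ((r3 3 (by omega)).trans hs.1) ((r3 4 (by omega)).trans hs.2) (by simp)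
    (l := [(v : ℕ), (L v).length - 1]) (by simp [r3, h1, h8₃])
    (hS.addr_lt (by omega) (by simp) (by simp; omega)) hS.fits.sq
    fun s₄ hm₄ h9 hr₄ => ?_)
  rw [hm₃, (hR.lists v).2 _ hl] at h9
  have r4 : ∀ y, y < 5 → s₄.reg y = s.reg y := fun y hy =>
    (hr₄ y (by omega) (by omega) (by omega)).trans (r3 y hy)
  have h7₄ : s₄.reg 7 = p := (hr₄ 7 (by omega) (by omega) (by omega)).trans h7₃
  have h8₄ : s₄.reg 8 = (L v).length - 1 := (hr₄ 8 (by omega) (by omega) (by omega)).trans h8₃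
  refine wp_seq (wp_storeAt ((r4 3 (by omega)).trans hs.1) ((r4 4 (by omega)).trans hs.2) (by simp)
    (l := [(v : ℕ), p]) (by simp [r4, h1, h7₄])
    (hS.addr_lt (by omega) (by simp) (by simp; omega)) hS.fits.sq (by omega)
    (hS.list_mem v _ (by omega)) fun s₅ hm₅ hr₅ => ?_)
  have r5 : ∀ y, y < 5 ∨ 6 < y → s₅.reg y = s₄.reg y := fun y hy => hr₅ y (by omega) (by omega)
  refine wp_seq (wp_storeAt (by rw [r5 3 (by omega), r4 3 (by omega), hs.1])
    (by rw [r5 4 (by omega), r4 4 (by omega), hs.2]) (by simp)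
    (l := [((L v)[(L v).length - 1] : ℕ), (v : ℕ)]) (by simp [r5, r4, h1, h9])
    (hS.addr_lt (by omega) (by simp) (by simp)) hS.fits.sq (by omega)
    (hS.pos_mem _ v (List.getElem_mem _)) fun s₆ hm₆ hr₆ => wp_seq (wp_const ?_))
  have r6 : ∀ y, y < 5 ∨ 6 < y → y ≠ 10 → (s₆.setReg 10 (0 % 2 ^ w)).reg y = s₄.reg y :=
    fun y hy hy' => by
      rw [State.setReg_reg_ne _ _ hy', hr₆ y (by omega) (by omega), r5 y hy]
  refine wp_seq (wp_storeAt (by rw [r6 3 (by omega) (by omega), r4 3 (by omega), hs.1])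
    (by rw [r6 4 (by omega) (by omega), r4 4 (by omega), hs.2]) (by simp)
    (l := [(u : ℕ), (v : ℕ)]) (by
      rw [List.map_cons, List.map_singleton, r6 0 (by omega) (by omega), r6 1 (by omega) (by omega),
        r4 0 (by omega), r4 1 (by omega), h0, h1])
    (hS.addr_lt (by omega) (by simp) (by simp)) hS.fits.sq (by omega)
    (hS.pos_mem _ v (hu ▸ List.getElem_mem _)) fun s₇ hm₇ hr₇ => ?_)
  have r7 : ∀ y, y < 5 ∨ 6 < y → y ≠ 10 → s₇.reg y = s₄.reg y :=
    fun y hy hy' => (hr₇ y (by omega) (by omega)).trans (r6 y hy hy')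
  refine wp_storeAt (by rw [r7 3 (by omega) (by omega), r4 3 (by omega), hs.1])
    (by rw [r7 4 (by omega) (by omega), r4 4 (by omega), hs.2]) (by simp)
    (l := [(v : ℕ)]) (by simp [r7, r4, h1])
    (hS.addr_lt (by omega) (by simp) (by simp)) hS.fits.sq (by omega)
    (hS.length_mem v) fun s₈ hm₈ hr₈ => ?_
  have := hR.swapRemove hS.nodup hp hl
  rw [hm₈, hm₇, State.setReg_mem, hm₆, hm₅, hm₄, hm₃, r7 8 (by omega) (by omega), h8₄,
    State.setReg_reg_self, r5 7 (by omega), h7₄, h9, Nat.zero_mod]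
  rw [hu] at this
  exact this

end ColoredDigraph

/-! ### Runs with a numerical space bound, across changing sets of cells. -/

namespace WordRAM

/-- Within `T` steps and within the space `S`, the program `p` halts in a state that satisfies `Q`. -/
def Runs (w S : ℕ) (p : Prog) (T : ℕ) (Q : State → Prop) (s : State) : Prop :=
  ∃ t s', t ≤ T ∧ Exec w S p s t s' ∧ Q s'

variable {w S T T' T₁ T₂ : ℕ} {p q : Prog} {Q Q' : State → Prop} {s : State} {A : Finset ℕ}

/-- The admissible set varies with the lists from one operation to the next, so only a bound for its
size is carried along. -/
theorem Wp.runs (h : Wp w A p T Q s) (hs : s.mem.support ⊆ A) (hA : A.card ≤ S) :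
    Runs w S p T (fun s' => Q s' ∧ s'.mem.support ⊆ A) s := by
  obtain ⟨t, s', ht, he, hA', hq⟩ := h hs
  exact ⟨t, s', ht, he.mono hA, hq, hA'⟩

theorem Runs.imp (h : Runs w S p T Q s) (hT : T ≤ T') (hQ : ∀ s', Q s' → Q' s') :
    Runs w S p T' Q' s := by
  obtain ⟨t, s', ht, he, hq⟩ := h
  exact ⟨t, s', ht.trans hT, he, hQ _ hq⟩

theorem Runs.frame (h : Runs w S p T Q s) :
    Runs w S p T (fun s' => Q s' ∧ ∀ x, ¬ p.Writes x → s'.reg x = s.reg x) s := by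
  obtain ⟨t, s', ht, he, hq⟩ := h
  exact ⟨t, s', ht, he, hq, fun x hx => he.reg_eq hx⟩

theorem Runs.seq (h : Runs w S p T₁ (fun s' => Runs w S q T₂ Q s') s) :
    Runs w S (.seq p q) (T₁ + T₂) Q s := by
  obtain ⟨t, s', ht, he, t', s'', ht', he', hq⟩ := h
  exact ⟨t + t', s'', add_le_add ht ht', .seq he he', hq⟩

end WordRAM

namespace ColoredDigraph

open WordRAM

open scoped Classical

variable {k : ℕ} {V : Type*} [Fintype V] {H : ColoredDigraph k V} (π : ∀ c, H.EvalPlan c) {n : ℕ}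

/-! ### The cells in use -/

/-- Assignments of members of `L x` to the ghosts of `c`. -/
noncomputable def ghostMaps (L : Fin n → List (Fin n)) (c : V) (x : Fin n) : Finset (V → Fin n) :=
  Fintype.piFinset fun v => if v ∈ (π c).ghosts then (L x).toFinset else {x}

/-- The cells that may be stored: those of `B`, and those of the tables. -/
noncomputable def cells (D : ℕ) (B : Finset ℕ) (L : Fin n → List (Fin n)) : Finset ℕ :=
  B ∪ ((Finset.univ ×ˢ Finset.range D).image fun p : Fin n × ℕ =>
      addr n (tables V) 2 [(p.1 : ℕ), p.2]) ∪
    (Finset.univ.image fun v : Fin n => addr n (tables V) 1 [(v : ℕ)]) ∪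
    (Finset.univ.biUnion fun v => (L v).toFinset.image fun u : Fin n => addr n (tables V) 0 [(u : ℕ), (v : ℕ)]) ∪
    (Finset.univ.biUnion fun v => (L v).toFinset.image fun u : Fin n => addr n (tables V) 3 [(u : ℕ), (v : ℕ)]) ∪
    (Finset.univ.biUnion fun p : V × Fin n => (ghostMaps π L p.1 p.2).image (atCell π p.1 p.2)) ∪
    (Finset.univ.biUnion fun p : V × Fin n => (ghostMaps π L p.1 p.2).image (totalCell π p.1))

variable {π} {D w : ℕ} {B : Finset ℕ} {L L' : Fin n → List (Fin n)}

theorem mem_cells {a : ℕ} : a ∈ cells π D B L ↔ a ∈ B ∨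
    (∃ (v : Fin n) (i : ℕ), i < D ∧ a = addr n (tables V) 2 [(v : ℕ), i]) ∨
    (∃ v : Fin n, a = addr n (tables V) 1 [(v : ℕ)]) ∨
    (∃ u v : Fin n, u ∈ L v ∧ a = addr n (tables V) 0 [(u : ℕ), (v : ℕ)]) ∨
    (∃ u v : Fin n, u ∈ L v ∧ a = addr n (tables V) 3 [(u : ℕ), (v : ℕ)]) ∨
    (∃ c x γ, (∀ g ∈ (π c).ghosts, γ g ∈ L x) ∧ a = atCell π c x γ) ∨
    (∃ c x γ, (∀ g ∈ (π c).ghosts, γ g ∈ L x) ∧ a = totalCell π c γ) := by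
  -- A cell depends on the ghosts only, so it suffices to count maps that are constant off the
  -- ghosts.
  have key : ∀ (h : V → Fin n → (V → Fin n) → ℕ), (∀ c x γ γ', (∀ g ∈ (π c).ghosts, γ g = γ' g) →
      h c x γ = h c x γ') → ((∃ p : V × Fin n, ∃ γ ∈ ghostMaps π L p.1 p.2, h p.1 p.2 γ = a) ↔
      ∃ c x γ, (∀ g ∈ (π c).ghosts, γ g ∈ L x) ∧ a = h c x γ) := by
    intro h hh
    constructor
    · rintro ⟨⟨c, x⟩, γ, hγ, rfl⟩
      refine ⟨c, x, γ, fun g hg => ?_, rfl⟩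
      have := Fintype.mem_piFinset.1 hγ g
      simpa [hg] using this
    · rintro ⟨c, x, γ, hγ, rfl⟩
      refine ⟨⟨c, x⟩, fun v => if v ∈ (π c).ghosts then γ v else x,
        Fintype.mem_piFinset.2 fun v => ?_, hh _ _ _ _ fun g hg => by simp [hg]⟩
      by_cases hv : v ∈ (π c).ghosts
      · simpa [hv] using hγ v hv
      · simp [hv]
  have k1 := key (fun c x γ => atCell π c x γ) fun c x γ γ' h => atCell_inj.2 ⟨rfl, rfl, h⟩
  have k2 := key (fun c x γ => totalCell π c γ) fun c x γ γ' h => totalCell_inj.2 ⟨rfl, h⟩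
  simp only [cells, Finset.mem_union, Finset.mem_image, Finset.mem_biUnion, Finset.mem_univ, true_and,
    k1, k2, List.mem_toFinset, or_assoc, Finset.mem_product, Finset.mem_range, Prod.exists]
  refine or_congr Iff.rfl (or_congr ?_ (or_congr ?_ (or_congr ?_ (or_congr ?_ Iff.rfl))))
  · exact ⟨fun ⟨v, i, h, e⟩ => ⟨v, i, h, e.symm⟩, fun ⟨v, i, h, e⟩ => ⟨v, i, h, e.symm⟩⟩
  · exact ⟨fun ⟨v, e⟩ => ⟨v, e.symm⟩, fun ⟨v, e⟩ => ⟨v, e.symm⟩⟩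
  · exact ⟨fun ⟨v, u, h, e⟩ => ⟨u, v, h, e.symm⟩, fun ⟨u, v, h, e⟩ => ⟨v, u, h, e.symm⟩⟩
  · exact ⟨fun ⟨v, u, h, e⟩ => ⟨u, v, h, e.symm⟩, fun ⟨u, v, h, e⟩ => ⟨v, u, h, e.symm⟩⟩

theorem card_ghostMaps_le (hD : 0 < D) (hL : ∀ v, (L v).length ≤ D) (c : V) (x : Fin n) :
    (ghostMaps π L c x).card ≤ D ^ Fintype.card V := by
  rw [ghostMaps, Fintype.card_piFinset]
  refine (Finset.prod_le_prod' (g := fun _ => D) fun v _ => ?_).trans (by simp)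
  split_ifs
  · exact (List.toFinset_card_le _).trans (hL x)
  · simpa using Nat.succ_le_of_lt hD

/-- The two tables of each vertex contribute 2|V|. The 7 consists of 3 for the cells in `B`, and 1
each for the list slots, the lengths, the colours and the positions. -/
theorem card_cells_le [Nonempty V] (hD : 0 < D) (hL : ∀ v, (L v).length ≤ D)
    (hB : B.card ≤ 3 * (D * n)) :
    (cells π D B L).card ≤ (2 * Fintype.card V + 7) * (D ^ Fintype.card V * n) := by
  have hpow : D * n ≤ D ^ Fintype.card V * n :=
    Nat.mul_le_mul_right _ (Nat.le_self_pow Fintype.card_ne_zero D)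
  have hn : n ≤ D * n := Nat.le_mul_of_pos_left _ hD
  have h2 : ((Finset.univ ×ˢ Finset.range D).image fun p : Fin n × ℕ =>
      addr n (tables V) 2 [(p.1 : ℕ), p.2]).card ≤ D * n := by
    refine Finset.card_image_le.trans ?_
    simp [mul_comm]
  have h1 : (Finset.univ.image fun v : Fin n => addr n (tables V) 1 [(v : ℕ)]).card ≤ n :=
    Finset.card_image_le.trans (by simp)
  have h0 : ∀ t, (Finset.univ.biUnion fun v => (L v).toFinset.image fun u : Fin n =>
      addr n (tables V) t [(u : ℕ), (v : ℕ)]).card ≤ D * n := by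
    intro t
    refine (Finset.card_biUnion_le_card_mul _ _ D fun v _ => ?_).trans (by simp [mul_comm])
    exact Finset.card_image_le.trans ((List.toFinset_card_le _).trans (hL v))
  have h4 : ∀ h : V → Fin n → (V → Fin n) → ℕ, (Finset.univ.biUnion fun p : V × Fin n =>
      (ghostMaps π L p.1 p.2).image (h p.1 p.2)).card ≤ Fintype.card V * (D ^ Fintype.card V * n) := by
    intro h
    refine (Finset.card_biUnion_le_card_mul _ _ (D ^ Fintype.card V) fun v _ => ?_).trans ?_
    · exact Finset.card_image_le.trans (card_ghostMaps_le hD hL _ _)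
    · rw [Finset.card_univ, Fintype.card_prod, Fintype.card_fin]
      exact le_of_eq (by ring)
  have e1 := h4 (fun c x => atCell π c x)
  have e2 := h4 (fun c x => totalCell π c)
  have e3 := h0 0
  have e4 := h0 3
  unfold cells
  refine (Finset.card_union_le _ _).trans ?_
  refine (Nat.add_le_add_right (Finset.card_union_le _ _) _).trans ?_
  refine (Nat.add_le_add_right (Nat.add_le_add_right (Finset.card_union_le _ _) _) _).trans ?_
  refine (Nat.add_le_add_right (Nat.add_le_add_right (Nat.add_le_add_right
    (Finset.card_union_le _ _) _) _) _).trans ?_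
  refine (Nat.add_le_add_right (Nat.add_le_add_right (Nat.add_le_add_right (Nat.add_le_add_right
    (Finset.card_union_le _ _) _) _) _) _).trans ?_
  refine (Nat.add_le_add_right (Nat.add_le_add_right (Nat.add_le_add_right (Nat.add_le_add_right
    (Nat.add_le_add_right (Finset.card_union_le _ _) _) _) _) _) _).trans ?_
  set m := Fintype.card V
  set E := D ^ m * n
  nlinarith

/-- The cells in use can be described by the current graph. -/
theorem Rep.support_subset {G : ColoredDigraph k (Fin n)} {mem : ℕ →₀ ℕ} {g₀ : ℕ → ℕ}
    {L₁ : Fin n → List (Fin n)} (h : Rep π g₀ G L (H.cntAt G) mem)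
    (hG : ∀ u v, G.Adj u v → u ∈ L' v) (hL : ∀ u v, u ∈ L v → u ∈ L' v)
    (hm : mem.support ⊆ cells π D B L₁) : mem.support ⊆ cells π D B L' := by
  intro a ha
  have h0 := Finsupp.mem_support_iff.1 ha
  -- Cells that became zero no longer count, and nonzero counts lie over edges of the current graph.
  -- So the stored cells never accumulate over a sequence of updates.
  have hgh : ∀ c x (γ : V → Fin n), H.cntAt G c x γ ≠ 0 → ∀ g ∈ (π c).ghosts, γ g ∈ L' x :=
    fun c x γ hne g hg => hG _ _ (adj_of_cntAt_ne_zero hne (((π c).mem_ghosts g).1 hg).1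
      ((π c).ghosts_adj g hg))
  rw [mem_cells]
  rcases mem_cells.1 (hm ha) with h' | h' | h' | ⟨u, v, _, rfl⟩ | ⟨u, v, _, rfl⟩ | ⟨c, x, γ, _, rfl⟩ |
    ⟨c, x, γ, _, rfl⟩
  · exact .inl h'
  · exact .inr (.inl h')
  · exact .inr (.inr (.inl h'))
  · refine .inr (.inr (.inr (.inl ⟨u, v, hG u v fun e => h0 ?_, rfl⟩)))
    rw [h.color, e]
    rfl
  · refine .inr (.inr (.inr (.inr (.inl ⟨u, v, hL u v ?_, rfl⟩))))
    by_contra hu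
    exact h0 (h.pos_zero u v hu)
  · rw [h.entry] at h0
    exact .inr (.inr (.inr (.inr (.inr (.inl ⟨c, x, γ, hgh c x γ h0, rfl⟩)))))
  · rw [h.total] at h0
    obtain ⟨x', _, hx'⟩ := Finset.exists_ne_zero_of_sum_ne_zero h0
    exact .inr (.inr (.inr (.inr (.inr (.inr ⟨c, x', γ, hgh c x' γ hx', rfl⟩)))))

/-! ### The size of the words -/

variable (V k) in
/-- The exponent that governs the size of the words. -/
def wordExponent : ℕ := 3 + (Fintype.card V + 1) + tables V + (k + 1)

variable (V k) in
/-- The words are large enough. -/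
structure WordSize (n w : ℕ) : Prop where
  fits : Fits n (tables V) w (Fintype.card V + 1)
  color_lt : k + 1 < 2 ^ w
  sum_lt : (n + 1) * n ^ Fintype.card V < 2 ^ w

/-- Since `n + 2` is at least 2, each constant `a` is less than `(n + 2) ^ a`. The summands of the
exponent pay for `3 * n * n + 1`, the digits, the number of tables and the colours. -/
theorem wordSize_of_le [Nonempty V] (hn : 0 < n) (h : (n + 2) ^ wordExponent k V ≤ 2 ^ w) :
    WordSize k V n w := by
  have hpos : 0 < Fintype.card V := Fintype.card_pos
  have h2 : ∀ a, a < (n + 2) ^ a := fun a =>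
    lt_of_lt_of_le Nat.lt_two_pow_self (Nat.pow_le_pow_left (by omega) a)
  have hmono : ∀ a, a ≤ wordExponent k V → (n + 2) ^ a ≤ 2 ^ w := fun a ha =>
    (Nat.pow_le_pow_right (by omega) ha).trans h
  refine ⟨⟨?_, by omega, hn, fun g l hg hl hln => ?_⟩, ?_, ?_⟩
  · refine lt_of_lt_of_le ?_ (hmono 3 (by unfold wordExponent; omega))
    ring_nf
    nlinarith
  · have h1 := enc_lt (3 * n * n) hln
    have h3 : n ^ l.length ≤ (n + 2) ^ (Fintype.card V + 1) :=
      (Nat.pow_le_pow_left (by omega) _).trans (Nat.pow_le_pow_right (by omega) hl)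
    have h4 : 3 * n * n + 1 ≤ (n + 2) ^ 3 := by ring_nf; nlinarith
    calc addr n (tables V) g l < (enc n (3 * n * n) l + 1) * tables V := by
          unfold addr
          rw [add_mul, one_mul]
          omega
      _ ≤ ((3 * n * n + 1) * n ^ l.length) * (n + 2) ^ tables V :=
          Nat.mul_le_mul h1 (h2 _).le
      _ ≤ ((n + 2) ^ 3 * (n + 2) ^ (Fintype.card V + 1)) * (n + 2) ^ tables V :=
          Nat.mul_le_mul_right _ (Nat.mul_le_mul h4 h3)
      _ = (n + 2) ^ (3 + (Fintype.card V + 1) + tables V) := by rw [← pow_add, ← pow_add]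
      _ ≤ 2 ^ w := hmono _ (by unfold wordExponent; omega)
  · exact lt_of_lt_of_le (h2 _) (hmono _ (by unfold wordExponent; omega))
  · calc (n + 1) * n ^ Fintype.card V ≤ (n + 1) * (n + 2) ^ Fintype.card V :=
          Nat.mul_le_mul_left _ (Nat.pow_le_pow_left (by omega) _)
      _ < (n + 2) * (n + 2) ^ Fintype.card V := Nat.mul_lt_mul_of_pos_right (by omega) (by positivity)
      _ = (n + 2) ^ (Fintype.card V + 1) := by ring
      _ ≤ 2 ^ w := hmono _ (by unfold wordExponent; omega)

theorem WordSize.setting (hw : WordSize k V n w) (hD : 0 < D) (hL : ∀ v, (L v).Nodup)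
    (hLD : ∀ v, (L v).length ≤ D) : Setting π w D (cells π D B L) L where
  fits := hw.fits
  color_lt := hw.color_lt
  sum_lt := hw.sum_lt
  nodup := hL
  length_le := hLD
  pos := hD
  color_mem u v h := mem_cells.2 (.inr (.inr (.inr (.inl ⟨u, v, h, rfl⟩))))
  length_mem v := mem_cells.2 (.inr (.inr (.inl ⟨v, rfl⟩)))
  list_mem v i h := mem_cells.2 (.inr (.inl ⟨v, i, h, rfl⟩))
  pos_mem u v h := mem_cells.2 (.inr (.inr (.inr (.inr (.inl ⟨u, v, h, rfl⟩)))))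
  atCell_mem c x γ h := mem_cells.2 (.inr (.inr (.inr (.inr (.inr (.inl ⟨c, x, γ, h, rfl⟩))))))
  totalCell_mem c x γ h := mem_cells.2 (.inr (.inr (.inr (.inr (.inr (.inr ⟨c, x, γ, h, rfl⟩))))))

/-! ### The states that represent a graph -/

/-- The list of in-neighbours has at most `D` members. -/
theorem InDegreeLE.length_le {G : ColoredDigraph k (Fin n)} (h : G.InDegreeLE D)
    (hL : ∀ v, (L v).Nodup) (hG : ∀ u v, u ∈ L v ↔ G.Adj u v) (v : Fin n) : (L v).length ≤ D := by
  have e : ({u | G.Adj u v} : Set (Fin n)) = ((L v).toFinset : Set (Fin n)) := by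
    ext u
    simp [hG]
  have := h v
  rw [e, Set.encard_coe_eq_coe_finsetCard, List.toFinset_card_of_nodup (hL v)] at this
  exact_mod_cast this

theorem InDegreeLE.mono {G G' : ColoredDigraph k (Fin n)} (h : G.InDegreeLE D)
    (hG : ∀ u v, G'.Adj u v → G.Adj u v) : G'.InDegreeLE D := fun v =>
  (Set.encard_le_encard fun u hu => hG u v hu).trans (h v)

variable (π) in
/-- The state represents the graph `G`. -/
def Stored (D : ℕ) (g₀ : ℕ → ℕ) (B : Finset ℕ) (G : ColoredDigraph k (Fin n)) (s : State) : Prop :=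
  Ready n s ∧ ∃ L : Fin n → List (Fin n), (∀ v, (L v).Nodup) ∧ (∀ u v, u ∈ L v ↔ G.Adj u v) ∧
    Rep π g₀ G L (H.cntAt G) s.mem ∧ s.mem.support ⊆ cells π D B L

theorem Stored.congr {G : ColoredDigraph k (Fin n)} {g₀ : ℕ → ℕ} {s s' : State}
    (h : Stored π D g₀ B G s) (hm : s'.mem = s.mem) (h3 : s'.reg 3 = s.reg 3)
    (h4 : s'.reg 4 = s.reg 4) : Stored π D g₀ B G s' := by
  obtain ⟨h1, L, h2⟩ := h
  exact ⟨h1.congr h3 h4, L, hm ▸ h2⟩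

variable (V) in
/-- The bound for the space. -/
def spaceBound (D n : ℕ) : ℕ := (2 * Fintype.card V + 7) * (D ^ Fintype.card V * n)

theorem Stored.space_le [Nonempty V] {G : ColoredDigraph k (Fin n)} {g₀ : ℕ → ℕ} {s : State}
    (h : Stored π D g₀ B G s) (hD : 0 < D) (hG : G.InDegreeLE D) (hB : B.card ≤ 3 * (D * n)) :
    s.space ≤ spaceBound V D n := by
  obtain ⟨_, L, h1, h2, _, h3⟩ := h
  exact (Finset.card_le_card h3).trans (card_cells_le hD (hG.length_le h1 h2) hB)

end ColoredDigraph

namespace ColoredDigraph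

open WordRAM

open scoped Classical

/-! ### Updates -/

section Programs

variable {k : ℕ} {V : Type*} [Fintype V] {H : ColoredDigraph k V} (π : ∀ c, H.EvalPlan c)
  (ord : List V)

/-- Give the edge between the vertices in the registers `0` and `1` the colour with the code in
register `2`, and recompute the numbers of extensions. -/
noncomputable def setProg : Prog := .seq (colorProg V) (refreshNear π ord)

/-- Insert an edge with the colour with the code in register `2`. -/
noncomputable def insertEdge : Prog := .seq (insertProg V) (setProg π ord)

/-- Turn the colour in register `2` into its code. -/
def encodeColor : Prog := .seq (.const 5 1) (.op .add 2 2 5)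

/-- Addition of an edge. -/
noncomputable def addProg : Prog := .seq encodeColor (insertEdge π ord)

/-- Recolouring of an edge. -/
noncomputable def recolorProg : Prog := .seq encodeColor (setProg π ord)

/-- Removal of an edge. -/
noncomputable def removeProg : Prog := .seq (.const 2 0) (.seq (setProg π ord) (deleteProg V))

/-- Exchange the registers `0` and `1`, and copy register `12` to register `2`. -/
def swapArgs : Prog := .seq (move 13 0) (.seq (move 0 1) (.seq (move 1 13) (move 2 12)))

/-- Reorientation of an edge. -/
noncomputable def reorientProg : Prog :=
  .seq (loadAt 12 (tables V) 0 [0, 1]) (.seq (removeProg π ord) (.seq swapArgs (insertEdge π ord)))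

/-- The cost of an update. -/
def updateCost : ℕ := 400 + 2 * refreshNearCost π ord

variable {π ord}

theorem writes_setProg {x : ℕ} (h : (setProg π ord).Writes x) : 5 ≤ x ∧ x < 12 ∨ 20 ≤ x := by
  rcases h with h | h
  · have := writes_storeAt h; omega
  · exact writes_refreshNear h

theorem writes_insertEdge {x : ℕ} (h : (insertEdge π ord).Writes x) : 5 ≤ x ∧ x < 12 ∨ 20 ≤ x := by
  rcases h with h | h
  · exact .inl (writes_insertProg h)
  · exact writes_setProg h

theorem writes_addProg {x : ℕ} (h : (addProg π ord).Writes x) :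
    x = 2 ∨ 5 ≤ x ∧ x < 12 ∨ 20 ≤ x := by
  rcases h with (h | h) | h
  · simp only [Prog.Writes] at h; omega
  · simp only [Prog.Writes] at h; omega
  · exact .inr (writes_insertEdge h)

theorem writes_removeProg {x : ℕ} (h : (removeProg π ord).Writes x) :
    x = 2 ∨ 5 ≤ x ∧ x < 12 ∨ 20 ≤ x := by
  rcases h with h | h | h
  · exact .inl h
  · exact .inr (writes_setProg h)
  · exact .inr (.inl (writes_deleteProg h))

end Programs

variable {k : ℕ} {V : Type*} [Fintype V] {H : ColoredDigraph k V} {π : ∀ c, H.EvalPlan c}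
  {ord : List V} {n w D : ℕ} {A B : Finset ℕ} {L : Fin n → List (Fin n)} {g₀ : ℕ → ℕ}
  {G G' : ColoredDigraph k (Fin n)} {s : State} {u v : Fin n}

/-- The list of `v` contains `u` both before and after the change of colour, so `L` covers the
in-neighbours in both graphs, as the refresh requires. -/
theorem wp_setProg (hS : Setting π w D A L) (hs : Ready n s) (hR : Rep π g₀ G L (H.cntAt G) s.mem)
    (hGL : ∀ a b, G.Adj a b → a ∈ L b) (huv : u ∈ L v) {o : Option (Fin (k + 1))}
    (h0 : s.reg 0 = u) (h1 : s.reg 1 = v) (h2 : s.reg 2 = colorCode o)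
    (hG : ∀ a b, G'.color a b = if a = u ∧ b = v then o else G.color a b) (hord : IsEvalOrder H ord) :
    Wp w A (setProg π ord) (12 + refreshNearCost π ord * D ^ (Fintype.card V ^ 2))
      (fun s' => Rep π g₀ G' L (H.cntAt G') s'.mem) s := by
  refine wp_seq ((wp_colorProg hS hs hR huv h0 h1 h2 hG).frame.imp le_rfl fun s' ⟨hR', hr⟩ => ?_)
  have hr' : ∀ x < 5, s'.reg x = s.reg x := fun x hx => hr x fun h => by
    have := writes_storeAt h; omega
  refine wp_refreshNear hS (hs.congr (hr' 3 (by omega)) (hr' 4 (by omega))) hR' hGL (fun a b h => ?_)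
    (x₀ := u) (y₀ := v) (fun a b h => ?_) ((hr' 1 (by omega)).trans h1) hord
  · by_cases e : a = u ∧ b = v
    · rw [e.1, e.2]; exact huv
    · exact hGL a b (by simpa [Adj, hG, e] using h)
  · rw [hG, if_neg h]

theorem one_le_pow_card (hD : 0 < D) : 1 ≤ D ^ (Fintype.card V ^ 2) := Nat.one_le_pow _ _ hD

theorem runs_setProg [Nonempty V] (hw : WordSize k V n w) (hD : 0 < D) (hB : B.card ≤ 3 * (D * n))
    (hst : Stored π D g₀ B G s) (hGD : G.InDegreeLE D) (hord : IsEvalOrder H ord) (huv : G.Adj u v)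
    {c : Fin (k + 1)}
    (hG : ∀ a b, G'.color a b = if a = u ∧ b = v then some c else G.color a b)
    (h0 : s.reg 0 = u) (h1 : s.reg 1 = v) (h2 : s.reg 2 = c + 1) :
    Runs w (spaceBound V D n) (setProg π ord)
      ((12 + refreshNearCost π ord) * D ^ (Fintype.card V ^ 2)) (Stored π D g₀ B G') s := by
  obtain ⟨hs, L, hL, hLG, hR, hsup⟩ := hst
  have hlen := hGD.length_le hL hLG
  have hS := hw.setting (π := π) (B := B) hD hL hlen
  refine ((wp_setProg hS hs hR (fun a b h => (hLG a b).2 h) ((hLG u v).2 huv) (o := some c) h0 h1 h2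
    hG hord).runs hsup (card_cells_le hD hlen hB)).frame.imp ?_ fun s' ⟨⟨hR', hA⟩, hr⟩ => ?_
  · have := one_le_pow_card (V := V) hD
    nlinarith
  · have hr' : ∀ x < 5, s'.reg x = s.reg x := fun x hx => hr x fun h => by
      have := writes_setProg h; omega
    refine ⟨hs.congr (hr' 3 (by omega)) (hr' 4 (by omega)), L, hL, fun a b => ?_, hR', hA⟩
    rw [hLG]
    by_cases e : a = u ∧ b = v
    · rw [e.1, e.2]; simpa [Adj, hG] using huv
    · simp [Adj, hG, e]

/-- The list is extended first. Its length is bounded through the in-degrees of the new graph. -/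
theorem runs_insertEdge [Nonempty V] (hw : WordSize k V n w) (hD : 0 < D) (hB : B.card ≤ 3 * (D * n))
    (hst : Stored π D g₀ B G s) (hGD : G'.InDegreeLE D) (hord : IsEvalOrder H ord)
    (huv : ¬ G.Adj u v) {o : Option (Fin (k + 1))} (ho : o ≠ none)
    (hG : ∀ a b, G'.color a b = if a = u ∧ b = v then o else G.color a b)
    (h0 : s.reg 0 = u) (h1 : s.reg 1 = v) (h2 : s.reg 2 = colorCode o) :
    Runs w (spaceBound V D n) (insertEdge π ord)
      ((58 + refreshNearCost π ord) * D ^ (Fintype.card V ^ 2)) (Stored π D g₀ B G') s := by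
  obtain ⟨hs, L, hL, hLG, hR, hsup⟩ := hst
  have hu : u ∉ L v := fun h => huv ((hLG u v).1 h)
  set L' := Function.update L v (L v ++ [u]) with hL'
  have hmem : ∀ a b, a ∈ L' b ↔ a ∈ L b ∨ (a = u ∧ b = v) := by
    intro a b
    by_cases e : b = v
    · subst e; simp [hL']
    · simp [hL', e]
  have hLG' : ∀ a b, a ∈ L' b ↔ G'.Adj a b := by
    intro a b
    rw [hmem, hLG]
    by_cases e : a = u ∧ b = v
    · simp [Adj, hG, e, ho]
    · simp [Adj, hG, e]
  have hnd : ∀ b, (L' b).Nodup := by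
    intro b
    by_cases e : b = v
    · subst e
      simpa [hL', List.nodup_append, hL b] using fun a ha (e : a = u) => hu (e ▸ ha)
    · simpa [hL', e] using hL b
  have hlen := hGD.length_le hnd hLG'
  have hS := hw.setting (π := π) (B := B) hD hnd hlen
  have hsup' := hR.support_subset (L' := L') (fun a b h => (hmem a b).2 (.inl ((hLG a b).2 h)))
    (fun a b h => (hmem a b).2 (.inl h)) hsup
  refine ((wp_seq ((wp_insertProg hS hs hR hL hu h0 h1).frame.imp le_rfl fun s' ⟨hR', hr⟩ => ?_)).runs
    (Q := fun s' => Rep π g₀ G' L' (H.cntAt G') s'.mem) (T := 46 + (12 + refreshNearCost π ord * D ^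
      (Fintype.card V ^ 2))) hsup' (card_cells_le hD hlen hB)).frame.imp ?_ fun s' ⟨⟨hR', hA⟩, hr⟩ => ?_
  · have hr' : ∀ x < 5, s'.reg x = s.reg x := fun x hx => hr x fun h => by
      have := writes_insertProg h; omega
    exact wp_setProg hS (hs.congr (hr' 3 (by omega)) (hr' 4 (by omega))) hR'
      (fun a b h => (hmem a b).2 (.inl ((hLG a b).2 h))) ((hmem u v).2 (.inr ⟨rfl, rfl⟩))
      ((hr' 0 (by omega)).trans h0) ((hr' 1 (by omega)).trans h1) ((hr' 2 (by omega)).trans h2) hG hord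
  · have := one_le_pow_card (V := V) hD
    nlinarith
  · have hr' : ∀ x < 5, s'.reg x = s.reg x := fun x hx => hr x fun h => by
      have := writes_insertEdge h; omega
    exact ⟨hs.congr (hr' 3 (by omega)) (hr' 4 (by omega)), L', hnd, hLG', hR', hA⟩

/-- The colour is erased and the counts are refreshed while `u` is still listed; only then is it
deleted. Afterwards the support is described again by the shorter lists. -/
theorem runs_removeProg [Nonempty V] (hw : WordSize k V n w) (hD : 0 < D) (hB : B.card ≤ 3 * (D * n))
    (hst : Stored π D g₀ B G s) (hGD : G.InDegreeLE D) (hord : IsEvalOrder H ord) (huv : G.Adj u v)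
    (hG : ∀ a b, G'.color a b = if a = u ∧ b = v then none else G.color a b)
    (h0 : s.reg 0 = u) (h1 : s.reg 1 = v) :
    Runs w (spaceBound V D n) (removeProg π ord)
      ((96 + refreshNearCost π ord) * D ^ (Fintype.card V ^ 2)) (Stored π D g₀ B G') s := by
  obtain ⟨hs, L, hL, hLG, hR, hsup⟩ := hst
  have hu : u ∈ L v := (hLG u v).2 huv
  obtain ⟨p, hp, hpu⟩ := List.getElem_of_mem hu
  have hl : (L v).length - 1 < (L v).length := by omega
  set L' := Function.update L v (swapRemove (L v) p hl) with hL'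
  have hlen := hGD.length_le hL hLG
  have hS := hw.setting (π := π) (B := B) hD hL hlen
  have hmem : ∀ a b, a ∈ L' b ↔ a ∈ L b ∧ ¬ (a = u ∧ b = v) := by
    intro a b
    by_cases e : b = v
    · subst e
      simp [hL', mem_swapRemove (hL b) hp hl, hpu]
    · simp [hL', e]
  have hLG' : ∀ a b, a ∈ L' b ↔ G'.Adj a b := by
    intro a b
    rw [hmem, hLG]
    by_cases e : a = u ∧ b = v
    · simp [Adj, hG, e]
    · simp [Adj, hG, e]
  have hnd : ∀ b, (L' b).Nodup := by
    intro b
    by_cases e : b = v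
    · subst e
      simpa [hL'] using nodup_swapRemove (hL b) hl
    · simpa [hL', e] using hL b
  set s₀ := s.setReg 2 (0 % 2 ^ w) with hs₀
  have hR₀ : Rep π g₀ G L (H.cntAt G) s₀.mem := hR
  refine ((wp_seq (wp_const (wp_seq (T₂ := 83) ((wp_setProg (s := s₀) (G' := G') (u := u) (v := v)
    (o := none) hS ?_ hR₀ (fun a b h => (hLG a b).2 h) hu ?_ ?_ ?_ hG hord).frame.imp le_rfl
    fun s' hs' => wp_deleteProg hS ?_ hs'.1 hp hpu ?_ ?_ hl)))).runs (Q := fun s' =>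
      Rep π g₀ G' L' (H.cntAt G') s'.mem) hsup
    (card_cells_le hD hlen hB)).frame.imp ?_ fun s' ⟨⟨hR', hA⟩, hr⟩ => ?_
  · exact hs.congr (State.setReg_reg_ne _ _ (by omega)) (State.setReg_reg_ne _ _ (by omega))
  · rw [State.setReg_reg_ne _ _ (by omega), h0]
  · rw [State.setReg_reg_ne _ _ (by omega), h1]
  · rw [State.setReg_reg_self, Nat.zero_mod, colorCode]
  · have hr' : ∀ x < 5, x ≠ 2 → s'.reg x = s.reg x := fun x hx h2 => (hs'.2 x fun h => by
      have := writes_setProg h; omega).trans (State.setReg_reg_ne _ _ h2)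
    exact hs.congr (hr' 3 (by omega) (by omega)) (hr' 4 (by omega) (by omega))
  · rw [hs'.2 0 fun h => by have := writes_setProg h; omega, State.setReg_reg_ne _ _ (by omega), h0]
  · rw [hs'.2 1 fun h => by have := writes_setProg h; omega, State.setReg_reg_ne _ _ (by omega), h1]
  · have := one_le_pow_card (V := V) hD
    nlinarith
  · have hr' : ∀ x < 5, x ≠ 2 → s'.reg x = s.reg x := fun x hx h2 => hr x fun h => by
      have := writes_removeProg h; omega
    exact ⟨hs.congr (hr' 3 (by omega) (by omega)) (hr' 4 (by omega) (by omega)), L', hnd, hLG', hR',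
      hR'.support_subset (fun a b h => (hLG' a b).2 h) (fun _ _ h => h) hA⟩

/-- Taking the current support as the admissible set covers a prefix that stores nothing outside the
cells already in use. -/
theorem runs_of_wp {S T T' : ℕ} {p q : Prog} {Q : State → Prop} (hs : s.space ≤ S)
    (h : Wp w s.mem.support p T (fun s' => Runs w S q T' Q s') s) : Runs w S (.seq p q) (T + T') Q s :=
  ((h.runs subset_rfl hs).imp le_rfl fun _ h => h.1).seq

theorem runs_encodeColor {S T : ℕ} {q : Prog} {Q : State → Prop} (hs : s.space ≤ S)
    {c : Fin (k + 1)} (hk : k + 1 < 2 ^ w) (h2 : s.reg 2 = c)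
    (h : ∀ s' : State, s'.mem = s.mem → s'.reg 2 = c + 1 → (∀ x, x ≠ 2 → x ≠ 5 → s'.reg x = s.reg x) →
      Runs w S q T Q s') : Runs w S (.seq encodeColor q) (2 + T) Q s := by
  refine runs_of_wp hs (wp_seq (T₁ := 1) (T₂ := 1) (wp_const (wp_op (h _ rfl ?_ ?_))))
  · have := c.isLt
    rw [State.setReg_reg_self, State.setReg_reg_ne _ _ (by omega), State.setReg_reg_self, h2,
      BinOp.eval, Nat.mod_eq_of_lt (show 1 < 2 ^ w by omega), Nat.mod_eq_of_lt (by omega)]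
  · intro x hx hx'
    rw [State.setReg_reg_ne _ _ hx, State.setReg_reg_ne _ _ hx']

theorem runs_addProg [Nonempty V] (hw : WordSize k V n w) (hD : 0 < D) (hB : B.card ≤ 3 * (D * n))
    (hst : Stored π D g₀ B G s) (hGD : G'.InDegreeLE D) (hord : IsEvalOrder H ord)
    (huv : ¬ G.Adj u v) {c : Fin (k + 1)}
    (hG : ∀ a b, G'.color a b = if a = u ∧ b = v then some c else G.color a b)
    (h0 : s.reg 0 = u) (h1 : s.reg 1 = v) (h2 : s.reg 2 = c) :
    Runs w (spaceBound V D n) (addProg π ord)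
      (updateCost π ord * D ^ (Fintype.card V ^ 2)) (Stored π D g₀ B G') s := by
  have hGD₀ : G.InDegreeLE D := hGD.mono fun a b h => by
    have e : ¬ (a = u ∧ b = v) := fun e => huv (e.1 ▸ e.2 ▸ h)
    simpa [Adj, hG, e] using h
  refine (runs_encodeColor (hst.space_le hD hGD₀ hB) hw.color_lt h2 fun s' hm h2' hr =>
    runs_insertEdge hw hD hB (hst.congr hm (hr 3 (by omega) (by omega)) (hr 4 (by omega) (by omega)))
    hGD hord huv (o := some c) (by simp) hG ((hr 0 (by omega) (by omega)).trans h0)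
    ((hr 1 (by omega) (by omega)).trans h1) h2').imp ?_ fun _ h => h
  have := one_le_pow_card (V := V) hD
  unfold updateCost
  nlinarith

theorem runs_recolorProg [Nonempty V] (hw : WordSize k V n w) (hD : 0 < D)
    (hB : B.card ≤ 3 * (D * n))
    (hst : Stored π D g₀ B G s) (hGD : G.InDegreeLE D) (hord : IsEvalOrder H ord)
    (huv : G.Adj u v) {c : Fin (k + 1)}
    (hG : ∀ a b, G'.color a b = if a = u ∧ b = v then some c else G.color a b)
    (h0 : s.reg 0 = u) (h1 : s.reg 1 = v) (h2 : s.reg 2 = c) :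
    Runs w (spaceBound V D n) (recolorProg π ord)
      (updateCost π ord * D ^ (Fintype.card V ^ 2)) (Stored π D g₀ B G') s := by
  refine (runs_encodeColor (hst.space_le hD hGD hB) hw.color_lt h2 fun s' hm h2' hr =>
    runs_setProg hw hD hB (hst.congr hm (hr 3 (by omega) (by omega)) (hr 4 (by omega) (by omega)))
    hGD hord huv hG ((hr 0 (by omega) (by omega)).trans h0)
    ((hr 1 (by omega) (by omega)).trans h1) h2').imp ?_ fun _ h => h
  have := one_le_pow_card (V := V) hD
  unfold updateCost
  nlinarith

/-- The subgraph of the edges that satisfy `P`. -/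
noncomputable def restrict (G : ColoredDigraph k (Fin n)) (P : Fin n → Fin n → Prop) :
    ColoredDigraph k (Fin n) where
  color a b := if P a b then G.color a b else none
  loopless v := by simp [G.loopless]
  asymm a b h := by
    by_cases e : P a b
    · rw [if_pos e] at h
      simp [G.asymm a b h]
    · simp [e] at h

theorem adj_of_restrict {P : Fin n → Fin n → Prop} {a b : Fin n} (h : (G.restrict P).Adj a b) :
    P a b ∧ G.Adj a b := by
  by_cases e : P a b
  · exact ⟨e, by simpa [Adj, restrict, e] using h⟩
  · simp [Adj, restrict, e] at h

theorem runs_reorientProg [Nonempty V] (hw : WordSize k V n w) (hD : 0 < D)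
    (hB : B.card ≤ 3 * (D * n))
    (hst : Stored π D g₀ B G s) (hGD : G.InDegreeLE D) (hGD' : G'.InDegreeLE D)
    (hord : IsEvalOrder H ord) (huv : G.Adj u v)
    (hG : ∀ a b, G'.color a b = if a = u ∧ b = v then none
      else if a = v ∧ b = u then G.color u v else G.color a b)
    (h0 : s.reg 0 = u) (h1 : s.reg 1 = v) :
    Runs w (spaceBound V D n) (reorientProg π ord)
      (updateCost π ord * D ^ (Fintype.card V ^ 2)) (Stored π D g₀ B G') s := by
  have hne : u ≠ v := fun e => huv (e ▸ G.loopless v)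
  have hsq := hw.fits.sq
  have hpos := hw.fits.pos
  have hlt : ∀ a : Fin n, (a : ℕ) < 2 ^ w := fun a => by
    have := a.isLt
    nlinarith
  -- The edge is removed and inserted in reverse. The graph in between is a subgraph of `G`, so it
  -- respects the degree bound; the colour waits in register `12`, which the removal does not touch.
  let G₁ := G.restrict fun a b => ¬ (a = u ∧ b = v)
  have hG₁ : ∀ a b, G₁.color a b = if a = u ∧ b = v then none else G.color a b := fun a b => by
    by_cases e : a = u ∧ b = v <;> simp [G₁, restrict, e]
  have hG₁D : G₁.InDegreeLE D := hGD.mono fun a b h => (adj_of_restrict h).2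
  refine (runs_of_wp (T := 12) (T' := (96 + refreshNearCost π ord) * D ^ (Fintype.card V ^ 2) +
    (8 + (58 + refreshNearCost π ord) * D ^ (Fintype.card V ^ 2))) (hst.space_le hD hGD hB)
    (wp_loadAt hst.1.1 hst.1.2 (by simp) (l := [(u : ℕ), (v : ℕ)]) (by simp [h0, h1])
    (hw.fits.addr_lt _ _ (by unfold tables; omega) hw.fits.two (by simp))
    hsq fun s₁ hm₁ h12 hr₁ => ?_)).imp ?_ fun _ h => h
  · have hcol : s₁.reg 12 = colorCode (G.color u v) := by
      obtain ⟨_, L, _, _, hR, _⟩ := hst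
      rw [h12, hR.color]
    refine ((runs_removeProg hw hD hB (hst.congr hm₁ (hr₁ 3 (by omega) (by omega) (by omega))
      (hr₁ 4 (by omega) (by omega) (by omega))) hGD hord huv hG₁
      ((hr₁ 0 (by omega) (by omega) (by omega)).trans h0)
      ((hr₁ 1 (by omega) (by omega) (by omega)).trans h1)).frame.imp le_rfl
      fun s₂ ⟨hst₂, hr₂⟩ => ?_).seq
    have hr₂' : ∀ x, x ≠ 2 → (x < 5 ∨ 12 = x) → s₂.reg x = s₁.reg x := fun x hx hx' => hr₂ x fun h => by
      have := writes_removeProg h; omega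
    have e0 : s₂.reg 0 = u := by
      rw [hr₂' 0 (by omega) (by omega), hr₁ 0 (by omega) (by omega) (by omega), h0]
    have e1 : s₂.reg 1 = v := by
      rw [hr₂' 1 (by omega) (by omega), hr₁ 1 (by omega) (by omega) (by omega), h1]
    have e12 : s₂.reg 12 = colorCode (G.color u v) := by
      rw [hr₂' 12 (by omega) (by omega), hcol]
    have hcl : colorCode (G.color u v) < 2 ^ w := by
      refine lt_of_le_of_lt ?_ hw.color_lt
      cases G.color u v with
      | none => simp [colorCode]
      | some i => have := i.isLt; simp only [colorCode]; omega
    refine runs_of_wp (hst₂.space_le hD hG₁D hB) (wp_seq (T₁ := 2) (T₂ := 6)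
      (wp_move (by omega) (by rw [e0]; exact hlt u) fun t₁ m₁ f₁ r₁ => wp_seq (T₁ := 2) (T₂ := 4)
      (wp_move (by omega) ?_ fun t₂ m₂ f₂ r₂ => wp_seq (T₁ := 2) (T₂ := 2)
      (wp_move (by omega) ?_ fun t₃ m₃ f₃ r₃ => wp_move (by omega) ?_ fun t₄ m₄ f₄ r₄ => ?_))))
    · rw [r₁ 1 (by omega) (by omega), e1]; exact hlt v
    · rw [r₂ 13 (by omega) (by omega), f₁, e0]; exact hlt u
    · rw [r₃ 12 (by omega) (by omega), r₂ 12 (by omega) (by omega), r₁ 12 (by omega) (by omega), e12]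
      exact hcl
    · refine runs_insertEdge (G := G₁) (u := v) (v := u) (o := G.color u v) hw hD hB
        (hst₂.congr ?_ ?_ ?_) hGD' hord ?_ huv ?_ ?_ ?_ ?_
      · rw [m₄, m₃, m₂, m₁]
      · rw [r₄ 3 (by omega) (by omega), r₃ 3 (by omega) (by omega), r₂ 3 (by omega) (by omega),
          r₁ 3 (by omega) (by omega)]
      · rw [r₄ 4 (by omega) (by omega), r₃ 4 (by omega) (by omega), r₂ 4 (by omega) (by omega),
          r₁ 4 (by omega) (by omega)]
      · exact fun h => (adj_of_restrict h).2 (G.asymm u v huv)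
      · intro a b
        rw [hG, hG₁]
        by_cases e : a = u ∧ b = v
        · simp [e, hne]
        · simp [e]
      · rw [r₄ 0 (by omega) (by omega), r₃ 0 (by omega) (by omega), f₂, r₁ 1 (by omega) (by omega), e1]
      · rw [r₄ 1 (by omega) (by omega), f₃, r₂ 13 (by omega) (by omega), f₁, e0]
      · rw [f₄, r₃ 12 (by omega) (by omega), r₂ 12 (by omega) (by omega),
          r₁ 12 (by omega) (by omega), e12]
  · have := one_le_pow_card (V := V) hD
    unfold updateCost
    nlinarith

end ColoredDigraph

/-! ### Reading the edge list and starting from the edgeless graph. -/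

namespace WordRAM

variable {w S T : ℕ} {p : Prog} {s : State}

/-- A loop that counts a register down from `N` to `0`. -/
theorem runs_countdown {x N : ℕ} (I : ℕ → State → Prop)
    (hI : ∀ j s, j < N → I (j + 1) s → s.reg x = j + 1 →
      Runs w S p T (fun s' => I j s' ∧ s'.reg x = j) s)
    (h : I N s) (hx : s.reg x = N) : Runs w S (.loop x p) (N * (T + 1) + 1) (I 0) s := by
  induction N generalizing s with
  | zero => exact ⟨1, s, by omega, .loop_end hx, h⟩
  | succ N ih =>
    obtain ⟨t, s', ht, he, hI', hx'⟩ := hI N s (by omega) h hx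
    obtain ⟨t', s'', ht', he', h0⟩ := ih (fun j s hj => hI j s (by omega)) hI' hx'
    exact ⟨t + t' + 1, s'', by nlinarith, .loop_step (by omega) he he', h0⟩

/-- Decrease a register by `1`. -/
def decr (x : ℕ) : Prog := .seq (.const 5 1) (.op .sub x x 5)

theorem wp_decr {A : Finset ℕ} {Q : State → Prop} {x j : ℕ} (hx : x ≠ 5) (h1 : 1 < 2 ^ w)
    (hj : s.reg x = j + 1)
    (h : ∀ s' : State, s'.mem = s.mem → s'.reg x = j → (∀ y, y ≠ 5 → y ≠ x → s'.reg y = s.reg y) →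
      Q s') : Wp w A (decr x) 2 Q s := by
  refine wp_seq (T₁ := 1) (T₂ := 1) (wp_const (wp_op (h _ rfl ?_ ?_)))
  · rw [State.setReg_reg_self, State.setReg_reg_self, State.setReg_reg_ne _ _ hx, hj, BinOp.eval,
      Nat.mod_eq_of_lt h1, Nat.add_sub_cancel]
  · intro y h5 hy
    rw [State.setReg_reg_ne _ _ hy, State.setReg_reg_ne _ _ h5]

/-- Load the three cells from three times register `14` on into the registers `0`, `1`, `2`. -/
def readTriple : Prog := .seq (.const 5 3) (.seq (.op .mul 13 14 5) (.seq (.load 0 13)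
  (.seq (.const 5 1) (.seq (.op .add 13 13 5) (.seq (.load 1 13)
  (.seq (.op .add 13 13 5) (.load 2 13)))))))

theorem wp_readTriple {A : Finset ℕ} {Q : State → Prop} {j : ℕ} (hj : s.reg 14 = j)
    (hw : 3 * j + 3 < 2 ^ w)
    (h : ∀ s' : State, s'.mem = s.mem → s'.reg 0 = s.mem (3 * j) → s'.reg 1 = s.mem (3 * j + 1) →
      s'.reg 2 = s.mem (3 * j + 2) → (∀ y, 2 < y → y ≠ 5 → y ≠ 13 → s'.reg y = s.reg y) →
      Q s') : Wp w A readTriple 8 Q s := by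
  refine wp_seq (T₁ := 1) (T₂ := 7) (wp_const (wp_seq (T₁ := 1) (T₂ := 6) (wp_op
    (wp_seq (T₁ := 1) (T₂ := 5) (wp_load (wp_seq (T₁ := 1) (T₂ := 4) (wp_const
    (wp_seq (T₁ := 1) (T₂ := 3) (wp_op (wp_seq (T₁ := 1) (T₂ := 2) (wp_load
    (wp_seq (T₁ := 1) (T₂ := 1) (wp_op (wp_load (h _ rfl ?_ ?_ ?_ ?_)))))))))))))))
  all_goals have m3 : 3 % 2 ^ w = 3 := Nat.mod_eq_of_lt (by omega)
  all_goals have m1 : 1 % 2 ^ w = 1 := Nat.mod_eq_of_lt (by omega)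
  all_goals have mj : (j * 3) % 2 ^ w = 3 * j := by rw [mul_comm, Nat.mod_eq_of_lt (by omega)]
  all_goals have mj1 : (3 * j + 1) % 2 ^ w = 3 * j + 1 := Nat.mod_eq_of_lt (by omega)
  all_goals have mj2 : (3 * j + 1 + 1) % 2 ^ w = 3 * j + 2 := Nat.mod_eq_of_lt (by omega)
  · simp [State.setReg_reg, BinOp.eval, hj, m3, mj]
  · simp [State.setReg_reg, BinOp.eval, hj, m3, mj, m1, mj1]
  · simp [State.setReg_reg, BinOp.eval, hj, m3, mj, m1, mj1, mj2]
  · intro y h2 h5 h13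
    simp [State.setReg_reg, h5, h13, show y ≠ 0 by omega, show y ≠ 1 by omega, show y ≠ 2 by omega]

theorem getD_triples {n k : ℕ} (es : List (Fin n × Fin n × Fin (k + 1))) {j : ℕ}
    (hj : j < es.length) :
    (es.flatMap fun e => [e.1.val, e.2.1.val, e.2.2.val]).getD (3 * j) 0 = es[j].1 ∧
    (es.flatMap fun e => [e.1.val, e.2.1.val, e.2.2.val]).getD (3 * j + 1) 0 = es[j].2.1 ∧
    (es.flatMap fun e => [e.1.val, e.2.1.val, e.2.2.val]).getD (3 * j + 2) 0 = es[j].2.2 := by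
  induction es generalizing j with
  | nil => simp at hj
  | cons e es ih =>
    cases j with
    | zero => simp
    | succ j =>
      have := ih (j := j) (by simpa using hj)
      simpa [Nat.mul_succ, Nat.add_assoc, Nat.add_left_comm] using this

theorem input_mem {n k : ℕ} (es : List (Fin n × Fin n × Fin (k + 1))) {j : ℕ} (hj : j < es.length) :
    (input es).mem (3 * j) = es[j].1 ∧ (input es).mem (3 * j + 1) = es[j].2.1 ∧
      (input es).mem (3 * j + 2) = es[j].2.2 := by
  simpa only [input, List.toFinsupp_apply] using getD_triples es hj

theorem length_triples {n k : ℕ} (es : List (Fin n × Fin n × Fin (k + 1))) :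
    (es.flatMap fun e => [e.1.val, e.2.1.val, e.2.2.val]).length = 3 * es.length := by
  induction es with
  | nil => rfl
  | cons e es ih => rw [List.flatMap_cons, List.length_append, ih]; simp; ring

theorem input_support {n k : ℕ} (es : List (Fin n × Fin n × Fin (k + 1))) :
    (input es).mem.support ⊆ Finset.range (3 * es.length) := by
  rw [← length_triples, input, List.toFinsupp_support]
  exact Finset.filter_subset _ _

end WordRAM

theorem ListsEdges.injOn {n k : ℕ} {es : List (Fin n × Fin n × Fin (k + 1))}
    {G : ColoredDigraph k (Fin n)} (h : ListsEdges es G) :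
    Set.InjOn (fun e : Fin n × Fin n × Fin (k + 1) => (e.1, e.2.1)) (es.toFinset : Set _) := by
  rintro ⟨a, b, c⟩ h1 ⟨a', b', c'⟩ h2 e
  simp only [Prod.mk.injEq] at e
  obtain ⟨rfl, rfl⟩ := e
  have e1 := (h.2 _ _ _).1 (List.mem_toFinset.1 h1)
  have e2 := (h.2 _ _ _).1 (List.mem_toFinset.1 h2)
  simp [Option.some.inj (e1.symm.trans e2)]

/-- Each ordered pair has at most one colour. This keeps the input below the cell `3 * n * n`, where
the tables begin. -/
theorem ListsEdges.length_le {n k : ℕ} {es : List (Fin n × Fin n × Fin (k + 1))}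
    {G : ColoredDigraph k (Fin n)} (h : ListsEdges es G) : es.length ≤ n * n := by
  classical
  rw [← List.toFinset_card_of_nodup h.1]
  refine (Finset.card_le_card_of_injOn _ (fun _ _ => Finset.mem_coe.2 (Finset.mem_univ _))
    h.injOn).trans ?_
  simp

theorem ListsEdges.length_le_mul {n k D : ℕ} {es : List (Fin n × Fin n × Fin (k + 1))}
    {G : ColoredDigraph k (Fin n)} (h : ListsEdges es G) (hG : G.InDegreeLE D) :
    es.length ≤ D * n := by
  classical
  rw [← List.toFinset_card_of_nodup h.1]
  refine (Finset.card_le_card_of_injOn _ (t := Finset.univ.biUnion fun v : Fin n =>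
    (Finset.univ.filter fun u => G.Adj u v).image fun u => (u, v)) (fun e he => ?_) h.injOn).trans ?_
  · have := (h.2 _ _ _).1 (List.mem_toFinset.1 (Finset.mem_coe.1 he))
    refine Finset.mem_coe.2 (Finset.mem_biUnion.2 ⟨e.2.1, Finset.mem_univ _, Finset.mem_image.2
      ⟨e.1, Finset.mem_filter.2 ⟨Finset.mem_univ _, ?_⟩, rfl⟩⟩)
    rw [ColoredDigraph.Adj, this]
    exact Option.some_ne_none _
  · refine (Finset.card_biUnion_le_card_mul _ _ D fun v _ => ?_).trans (by simp [mul_comm])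
    refine Finset.card_image_le.trans ?_
    have := hG v
    rw [← Finset.coe_filter_univ, Set.encard_coe_eq_coe_finsetCard] at this
    exact_mod_cast this

namespace ColoredDigraph

open WordRAM

open scoped Classical

section Programs

variable {k : ℕ} {V : Type*} [Fintype V] {H : ColoredDigraph k V} (π : ∀ c, H.EvalPlan c)
  (ord : List V) (r : V)

/-- Compute the constants in the registers `3` and `4`, and make register `14` the number of edges. -/
def prepare : Prog := .seq (move 3 0) (.seq (move 14 1)
  (.seq (.const 5 3) (.seq (.op .mul 4 3 5) (.op .mul 4 4 3))))

/-- Compute the entries of the tables of `r` for the graph without edges. -/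
noncomputable def initProg : Prog :=
  .seq (move 15 3) (.loop 15 (.seq (decr 15) (.seq (move (vreg r) 15) (refresh π r))))

/-- Add the listed edges. -/
noncomputable def readProg : Prog := .loop 14 (.seq (.seq (decr 14) readTriple) (addProg π ord))

/-- The building procedure. -/
noncomputable def buildProg : Prog := .seq (.seq prepare (initProg π r)) (readProg π ord)

end Programs

variable {k : ℕ} {V : Type*} [Fintype V] {H : ColoredDigraph k V} {π : ∀ c, H.EvalPlan c}
  {ord : List V} {n w D : ℕ} {A B : Finset ℕ} {L : Fin n → List (Fin n)} {g₀ : ℕ → ℕ}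
  {G G' : ColoredDigraph k (Fin n)} {s : State} {u v : Fin n} {r : V}

theorem wp_prepare (hw : WordSize k V n w) (h0 : s.reg 0 = n) (h1 : s.reg 1 < 2 ^ w)
    (hk : 3 < 2 ^ w) {Q : State → Prop}
    (h : ∀ s' : State, s'.mem = s.mem → Ready n s' → s'.reg 14 = s.reg 1 → Q s') :
    Wp w A prepare 7 Q s := by
  have hsq := hw.fits.sq
  have hpos := hw.fits.pos
  have e1 : (n * 3) % 2 ^ w = 3 * n := by rw [mul_comm, Nat.mod_eq_of_lt (by nlinarith)]
  refine wp_seq (T₁ := 2) (T₂ := 5) (wp_move (by omega) (by rw [h0]; nlinarith) fun s₁ m₁ f₁ r₁ =>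
    wp_seq (T₁ := 2) (T₂ := 3) (wp_move (by omega) (by rwa [r₁ 1 (by omega) (by omega)])
    fun s₂ m₂ f₂ r₂ => wp_seq (T₁ := 1) (T₂ := 2) (wp_const (wp_seq (T₁ := 1) (T₂ := 1) (wp_op (wp_op
    (h _ ?_ ⟨?_, ?_⟩ ?_)))))))
  · simp [m₂, m₁]
  · simp [State.setReg_reg, r₂, f₁, h0]
  · simp [State.setReg_reg, BinOp.eval, r₂, f₁, h0, Nat.mod_eq_of_lt hk, e1, Nat.mod_eq_of_lt hsq]
  · simp [State.setReg_reg, f₂, r₁]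

/-- A vertex other than the root has an incoming edge in `H`, which no map into an edgeless graph
can respect. -/
theorem cntAt_eq_zero (hG : ∀ a b, G.color a b = none) (hr : ∀ v, H.Reach r v) {c : V} (hc : c ≠ r)
    (x : Fin n) (γ : V → Fin n) : H.cntAt G c x γ = 0 := by
  by_contra h
  obtain ⟨φ, hφ⟩ := Finset.card_ne_zero.1 h
  simp only [Finset.mem_filter, mem_extensions] at hφ
  rcases Relation.ReflTransGen.cases_tail (hr c) with e | ⟨a, _, ha⟩
  · exact hc e
  · obtain ⟨i, hi⟩ := Option.ne_none_iff_exists'.1 ha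
    have := hφ.1.2 a c i hi (show H.Reach c c from .refl)
    simp [hG] at this

theorem ghosts_eq_nil (hr : ∀ v, H.Reach r v) : (π r).ghosts = [] :=
  List.eq_nil_iff_forall_not_mem.2 fun g hg => (((π r).mem_ghosts g).1 hg).1 (hr g)

/-- The cells above the input are zero, which is already right for all vertices except the root. So
only the entries of the root are computed, once for each image. -/
theorem wp_initProg (hw : WordSize k V n w) (hD : 0 < D) (hr : ∀ v, H.Reach r v)
    (hG : ∀ a b, G.color a b = none) (hs : Ready n s) (hmem : ∀ a, 3 * n * n ≤ a → s.mem a = 0) :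
    Wp w (cells π D B fun _ : Fin n => []) (initProg π r)
      (2 + (n * (4 + refreshCost π r * D ^ (2 * (Fintype.card V - 1)) + 1) + 1))
      (fun s' => Rep π s.mem G (fun _ => []) (H.cntAt G) s'.mem) s := by
  have hsq := hw.fits.sq
  have hpos := hw.fits.pos
  have hn : n < 2 ^ w := by nlinarith
  have hS : Setting π w D (cells π D B fun _ : Fin n => []) (fun _ => []) :=
    hw.setting hD (by simp) (by simp)
  have hz : ∀ g l, s.mem (addr n (tables V) g l) = 0 := fun g l =>
    hmem _ (le_addr hpos (by unfold tables; omega) g l)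
  have hvr := vreg_mod r
  refine wp_seq (wp_move (by omega) (by rw [hs.1]; exact hn) fun s₁ m₁ f₁ r₁ => ?_)
  -- Images below the counter still have their initial value 0.
  refine (wp_countdown (N := n) (fun j s' => Ready n s' ∧ Rep π s.mem G (fun _ => []) (fun c x γ =>
    if c = r ∧ (x : ℕ) < j then 0 else H.cntAt G c x γ) s'.mem) ?_ ⟨hs.congr (r₁ 3 (by omega) (by omega))
    (r₁ 4 (by omega) (by omega)), ?_⟩ (f₁.trans hs.1)).imp le_rfl fun s' h => h.2.congr (by simp)
  · rintro j s₂ hj ⟨hs₂, hR₂⟩ h15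
    refine Wp.mono (T := 2 + (2 + refreshCost π r * D ^ (2 * (Fintype.card V - 1)))) (wp_seq
      (wp_decr (by omega) (by omega) h15 fun s₃ m₃ f₃ r₃ => wp_seq (wp_move (by omega)
      (by omega) fun s₄ m₄ f₄ r₄ => ?_))) (by omega)
    have hs₄ : Ready n s₄ := hs₂.congr
      ((r₄ 3 (by omega) (by omega)).trans (r₃ 3 (by omega) (by omega)))
      ((r₄ 4 (by omega) (by omega)).trans (r₃ 4 (by omega) (by omega)))
    refine (wp_refresh (x := ⟨j, hj⟩) hS hs₄ (f := fun c x γ => if c = r ∧ (x : ℕ) < j + 1 then 0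
      else H.cntAt G c x γ) (by rw [m₄, m₃]; exact hR₂) (fun a b h => (h (hG a b)).elim) ?_ ?_
      (f₄.trans f₃) ?_).frame.imp le_rfl ?_
    · intro b hb x γ
      rw [if_neg]
      rintro ⟨rfl, _⟩
      exact (((π b).parts_cover b).1 ⟨b, hb, .refl⟩).2 .refl
    · intro x γ
      split_ifs
      · exact Nat.zero_le _
      · simpa using cntAt_le (H := H) (G := G) r x γ
    · intro γ g hg
      simp [ghosts_eq_nil hr] at hg
    · rintro s' ⟨hR, hr'⟩
      have hr'' : ∀ x, x < 5 ∨ x = 15 → s'.reg x = s₄.reg x := fun x hx => hr' x fun h => by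
        have := writes_refresh h; omega
      refine ⟨⟨hs₄.congr (hr'' 3 (by omega)) (hr'' 4 (by omega)), hR.congr fun c x γ => ?_⟩, ?_⟩
      · by_cases hc : c = r
        · subst hc
          rcases lt_trichotomy (x : ℕ) j with h | h | h
          · simp [h, Fin.ext_iff, h.ne, show (x : ℕ) < j + 1 by omega]
          · simp [Fin.ext_iff, h]
          · simp [Fin.ext_iff, h.ne', show ¬ (x : ℕ) < j + 1 by omega, show ¬ (x : ℕ) < j by omega]
        · simp [hc]
      · rw [hr'' 15 (by omega), r₄ 15 (by omega) (by omega), f₃]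
  · have hf : ∀ (c : V) (x : Fin n) (γ : V → Fin n),
        (if c = r ∧ (x : ℕ) < n then 0 else H.cntAt G c x γ) = 0 := by
      intro c x γ
      by_cases hc : c = r
      · simp [hc]
      · simp [hc, cntAt_eq_zero hG hr]
    rw [m₁]
    refine ⟨fun _ _ => rfl, fun u v => ?_, fun v => ⟨hz _ _, by simp⟩, by simp,
      fun u v _ => hz _ _, fun c x γ => ?_, fun c γ => ?_⟩
    · rw [hz, hG]; rfl
    · rw [hf]; exact hz _ _
    · simp only [hf, Finset.sum_const_zero]; exact hz _ _

end ColoredDigraph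

namespace ColoredDigraph

open WordRAM

open scoped Classical

variable {k : ℕ} {V : Type*} [Fintype V] {H : ColoredDigraph k V} {π : ∀ c, H.EvalPlan c}
  {ord : List V} {n w D : ℕ} {A B : Finset ℕ} {L : Fin n → List (Fin n)} {g₀ : ℕ → ℕ}
  {G G' : ColoredDigraph k (Fin n)} {s : State} {u v : Fin n} {r : V}

/-! ### Building -/

theorem restrict_eq_self {P : Fin n → Fin n → Prop} (h : ∀ a b, G.Adj a b → P a b) :
    G.restrict P = G := by
  have e : (G.restrict P).color = G.color := by
    funext a b
    by_cases hP : P a b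
    · simp [restrict, hP]
    · have := not_imp_not.2 (h a b) hP
      simp only [Adj, not_not] at this
      simp [restrict, this]
  cases G
  unfold restrict at e ⊢
  congr

theorem runs_readProg [Nonempty V] (hw : WordSize k V n w) (hD : 0 < D) (hB : B.card ≤ 3 * (D * n))
    {es : List (Fin n × Fin n × Fin (k + 1))} (hes : ListsEdges es G) (hGD : G.InDegreeLE D)
    (hord : IsEvalOrder H ord)
    (hst : Stored π D (input es).mem B (G.restrict fun _ _ => False) s) (h14 : s.reg 14 = es.length) :
    Runs w (spaceBound V D n) (readProg π ord)
      (es.length * (10 + updateCost π ord * D ^ (Fintype.card V ^ 2) + 1) + 1)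
      (Stored π D (input es).mem B G) s := by
  -- The counter runs down, so the edges are added from the last to the first; every intermediate
  -- graph is a subgraph of `G` and respects the degree bound.
  let E : ℕ → ColoredDigraph k (Fin n) := fun j => G.restrict fun a b => ∃ c, (a, b, c) ∈ es.drop j
  have hED : ∀ j, (E j).InDegreeLE D := fun j => hGD.mono fun a b h => (adj_of_restrict h).2
  have hsq := hw.fits.sq
  have hpos := hw.fits.pos
  have hlen := hes.length_le
  have e0 : E 0 = G := restrict_eq_self fun a b h => by
    obtain ⟨c, hc⟩ := Option.ne_none_iff_exists'.1 h
    exact ⟨c, by simpa using (hes.2 a b c).2 hc⟩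
  have eN : E es.length = G.restrict fun _ _ => False := by simp [E]
  refine (runs_countdown (fun j s => Stored π D (input es).mem B (E j) s) ?_ (by rwa [eN]) h14).imp
    le_rfl fun s' h => e0 ▸ h
  intro j s₁ hj hst₁ h14₁
  obtain ⟨i0, i1, i2⟩ := input_mem es hj
  have hj3 : 3 * j + 3 ≤ 3 * n * n := by nlinarith
  refine runs_of_wp (hst₁.space_le hD (hED _) hB) (wp_seq (T₁ := 2) (T₂ := 8)
    (wp_decr (by omega) (by omega) h14₁ fun s₂ m₂ f₂ r₂ => wp_readTriple f₂ (by omega)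
    fun s₃ m₃ f0 f1 f2 r₃ => ?_))
  -- Updates write only above `3 * n * n`, so the unread part of the input is intact.
  have hlow : ∀ a < 3 * n * n, s₂.mem a = (input es).mem a := by
    obtain ⟨_, L, _, _, hR, _⟩ := hst₁
    rw [m₂]
    exact hR.low
  rw [hlow _ (by omega), i0] at f0
  rw [hlow _ (by omega), i1] at f1
  rw [hlow _ (by omega), i2] at f2
  have hdrop : es.drop j = es[j] :: es.drop (j + 1) := List.drop_eq_getElem_cons hj
  have hnd : es[j] ∉ es.drop (j + 1) := by
    have := hdrop ▸ hes.1.sublist (List.drop_sublist j es)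
    exact (List.nodup_cons.1 this).1
  have hcol : G.color es[j].1 es[j].2.1 = some es[j].2.2 := (hes.2 _ _ _).1 (List.getElem_mem hj)
  refine ((runs_addProg (G := E (j + 1)) (G' := E j) (u := es[j].1) (v := es[j].2.1) (c := es[j].2.2)
    hw hD hB (hst₁.congr (m₃.trans m₂)
    ((r₃ 3 (by omega) (by omega) (by omega)).trans (r₂ 3 (by omega) (by omega)))
    ((r₃ 4 (by omega) (by omega) (by omega)).trans (r₂ 4 (by omega) (by omega)))) (hED j) hord ?_ ?_
    f0 f1 f2)).frame.imp le_rfl fun s' hs' => ⟨hs'.1, ?_⟩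
  · intro h
    obtain ⟨⟨c, hc⟩, -⟩ := adj_of_restrict h
    have := (hes.2 _ _ _).1 (List.mem_of_mem_drop hc)
    rw [hcol] at this
    rw [← Option.some.inj this] at hc
    exact hnd hc
  · intro a b
    by_cases e : a = es[j].1 ∧ b = es[j].2.1
    · obtain ⟨rfl, rfl⟩ := e
      simp only [and_self, if_true, E, restrict]
      rw [if_pos ⟨es[j].2.2, hdrop.symm ▸ List.mem_cons_self⟩, hcol]
    · rw [if_neg e]
      have : (∃ c, (a, b, c) ∈ es.drop j) ↔ ∃ c, (a, b, c) ∈ es.drop (j + 1) := by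
        refine exists_congr fun c => ?_
        rw [hdrop, List.mem_cons]
        exact or_iff_right fun h => e ⟨by rw [← h], by rw [← h]⟩
      by_cases h : ∃ c, (a, b, c) ∈ es.drop (j + 1)
      · simp only [E, restrict, if_pos h, if_pos (this.2 h)]
      · simp only [E, restrict, if_neg h, if_neg (mt this.1 h)]
  · rw [hs'.2 14 fun h => by have := writes_addProg h; omega, r₃ 14 (by omega) (by omega) (by omega), f₂]

variable (π ord r) in
/-- The cost of building. -/
def buildCost : ℕ := 100 + refreshCost π r + updateCost π ord

theorem card_input_le {es : List (Fin n × Fin n × Fin (k + 1))} (hes : ListsEdges es G)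
    (hGD : G.InDegreeLE D) : (input es).mem.support.card ≤ 3 * (D * n) := by
  have h1 := Finset.card_le_card (input_support es)
  have h2 := hes.length_le_mul hGD
  rw [Finset.card_range] at h1
  omega

theorem writes_initProg {x : ℕ} (h : (initProg π r).Writes x) : 5 ≤ x ∧ x < 12 ∨ x = 15 ∨ 20 ≤ x := by
  have := vreg_mod r
  rcases h with h | (h | h) | h | h
  · have := writes_move h; omega
  · exact .inl (by simp only [Prog.Writes] at h; omega)
  · simp only [Prog.Writes] at h; omega
  · have := writes_move h; omega
  · have := writes_refresh h; omega

theorem runs_buildProg [Nonempty V] (hw : WordSize k V n w) (hD : 0 < D)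
    {es : List (Fin n × Fin n × Fin (k + 1))} (hes : ListsEdges es G) (hGD : G.InDegreeLE D)
    (hord : IsEvalOrder H ord) (hr : ∀ v, H.Reach r v) (h3 : 3 < 2 ^ w) :
    Runs w (spaceBound V D n) (buildProg π ord r)
      (buildCost π ord r * (D ^ (Fintype.card V ^ 2 + 1) * n))
      (Stored π D (input es).mem (input es).mem.support G) (input es) := by
  have hB := card_input_le hes hGD
  have hsq := hw.fits.sq
  have hpos := hw.fits.pos
  have hlen := hes.length_le
  have hlenD := hes.length_le_mul hGD
  have hmem : ∀ a, 3 * n * n ≤ a → (input es).mem a = 0 := fun a ha => by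
    by_contra h
    have := Finset.mem_range.1 (input_support es (Finsupp.mem_support_iff.2 h))
    nlinarith
  let L₀ : Fin n → List (Fin n) := fun _ => []
  have hA : (input es).mem.support ⊆ cells π D (input es).mem.support L₀ := fun a ha =>
    mem_cells.2 (.inl ha)
  let G₀ := G.restrict fun _ _ => False
  refine ((wp_seq (wp_prepare hw (by simp [input]) (by simp [input]; nlinarith) h3
    fun s₁ m₁ hs₁ h14 => (wp_initProg (r := r) (G := G₀) hw hD hr (by simp [G₀, restrict])
    hs₁ (by rwa [m₁])).frame.imp le_rfl fun s' hs' => (?_ : Rep π (input es).mem G₀ L₀ (H.cntAt G₀) s'.mem ∧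
      Ready n s' ∧ s'.reg 14 = es.length))).runs hA (card_cells_le hD (by simp) hB)).imp le_rfl
    (fun s' ⟨⟨hR, hs, h14⟩, hsup⟩ => runs_readProg hw hD hB hes hGD hord
      ⟨hs, L₀, by simp [L₀], by simp [L₀, Adj, restrict], hR, hsup⟩ h14) |>.seq.imp ?_ fun _ h => h
  · have hr' : ∀ x, x < 5 ∨ x = 14 → s'.reg x = s₁.reg x := fun x hx => hs'.2 x fun h => by
      have := writes_initProg h; omega
    exact ⟨m₁ ▸ hs'.1, hs₁.congr (hr' 3 (by omega)) (hr' 4 (by omega)), (hr' 14 (by omega)).trans h14⟩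
  -- There are at most `D * n` additions, each of cost proportional to `D ^ (m ^ 2)`. This is the
  -- origin of the exponent `m ^ 2 + 1` and dominates the initialization.
  · set m := Fintype.card V
    have hp : 1 ≤ D ^ (m ^ 2) := Nat.one_le_pow _ _ hD
    have hp' : D ^ (2 * (m - 1)) ≤ D ^ (m ^ 2) := by
      refine Nat.pow_le_pow_right hD ?_
      rcases m with _ | m
      · simp
      · simp only [Nat.add_sub_cancel]; nlinarith
    rw [pow_succ D, mul_assoc]
    set X := D ^ (m ^ 2)
    set Y := D ^ (2 * (m - 1))
    set N := D * n
    have hN : n ≤ N := Nat.le_mul_of_pos_left _ hD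
    have hXN : N ≤ X * N := Nat.le_mul_of_pos_left _ hp
    have t1 : n * (refreshCost π r * Y) ≤ refreshCost π r * (X * N) := by
      calc n * (refreshCost π r * Y) ≤ N * (refreshCost π r * X) :=
            Nat.mul_le_mul hN (Nat.mul_le_mul_left _ hp')
        _ = _ := by ring
    have t2 : es.length * (updateCost π ord * X) ≤ updateCost π ord * (X * N) := by
      calc es.length * (updateCost π ord * X) ≤ N * (updateCost π ord * X) :=
            Nat.mul_le_mul_right _ hlenD
        _ = _ := by ring
    unfold buildCost
    nlinarith

/-! ### Queries -/

/-- The query for the number of all homomorphisms. -/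
noncomputable def queryAllProg (r : V) : Prog := loadAt 0 (tables V) (totalTable r) []

/-- The query for the number of homomorphisms with a given image of `r`. -/
noncomputable def queryAtProg (r : V) : Prog := loadAt 0 (tables V) (atTable r) [0]

theorem ghostIndex_eq_nil (hr : ∀ v, H.Reach r v) (γ : V → Fin n) : ghostIndex π r γ = [] := by
  simp [ghostIndex, ghosts_eq_nil hr]

theorem runs_queryAllProg {S : ℕ} (hw : WordSize k V n w) (hst : Stored π D g₀ B G s)
    (hS : s.space ≤ S) (hr : ∀ v, H.Reach r v) :
    Runs w S (queryAllProg r) 10 (fun s' => Stored π D g₀ B G s' ∧ s'.reg 0 = H.hom G) s := by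
  refine ((wp_loadAt hst.1.1 hst.1.2 (by simp) rfl (hw.fits.addr_lt _ _ (totalTable_lt r)
    (by simp) (by simp)) hw.fits.sq (Q := fun s' => Stored π D g₀ B G s' ∧ s'.reg 0 = H.hom G)
    fun s' hm h0 hr' => ⟨hst.congr hm (hr' 3 (by omega) (by omega) (by omega))
    (hr' 4 (by omega) (by omega) (by omega)), ?_⟩).runs subset_rfl hS).imp (by simp) fun _ h => h.1
  obtain ⟨_, L, _, _, hR, _⟩ := hst
  have γ : V → Fin n := fun _ => ⟨0, hw.fits.pos⟩
  rw [h0, hom_eq_cnt hr γ, cnt_eq_sum, ← hR.total r γ, totalCell, ghostIndex_eq_nil hr]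
  rfl

theorem runs_queryAtProg {S : ℕ} (hw : WordSize k V n w) (hst : Stored π D g₀ B G s)
    (hS : s.space ≤ S) (hr : ∀ v, H.Reach r v) (h0 : s.reg 0 = v) :
    Runs w S (queryAtProg r) 10 (fun s' => Stored π D g₀ B G s' ∧ s'.reg 0 = H.homAt r G v) s := by
  refine ((wp_loadAt hst.1.1 hst.1.2 (by simp) (l := [(v : ℕ)]) (by simp [h0])
    (hw.fits.addr_lt _ _ (atTable_lt r)
    (by simp) (by simp)) hw.fits.sq (Q := fun s' => Stored π D g₀ B G s' ∧ s'.reg 0 = H.homAt r G v)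
    fun s' hm h0 hr' => ⟨hst.congr hm (hr' 3 (by omega) (by omega) (by omega))
    (hr' 4 (by omega) (by omega) (by omega)), ?_⟩).runs subset_rfl hS).imp (by simp) fun _ h => h.1
  obtain ⟨_, L, _, _, hR, _⟩ := hst
  have γ : V → Fin n := fun _ => v
  rw [h0, homAt_eq_cntAt hr v γ, ← hR.entry r v γ, atCell, ghostIndex_eq_nil hr]

/-! ### The data structure -/

variable (π ord r) in
/-- The data structure for counting homomorphisms. -/
noncomputable def homStructure : DynamicStructure where
  build := buildProg π ord r
  add := addProg π ord
  remove := removeProg π ord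
  reorient := reorientProg π ord
  recolor := recolorProg π ord
  queryAll := queryAllProg r
  queryAt := queryAtProg r

theorem Stored.withArgs (h : Stored π D g₀ B G s) (a b c : ℕ) :
    Stored π D g₀ B G (s.withArgs a b c) :=
  h.congr rfl (by simp [State.withArgs, State.setReg_reg]) (by simp [State.withArgs, State.setReg_reg])

theorem withArgs_reg (s : State) (a b c : ℕ) : (s.withArgs a b c).reg 0 = a ∧
    (s.withArgs a b c).reg 1 = b ∧ (s.withArgs a b c).reg 2 = c := by
  simp [State.withArgs, State.setReg_reg]

theorem runs_updateProg [Nonempty V] (hw : WordSize k V n w) (hD : 0 < D)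
    (hB : B.card ≤ 3 * (D * n)) (hst : Stored π D g₀ B G s) (hGD : G.InDegreeLE D)
    (hGD' : G'.InDegreeLE D) (hord : IsEvalOrder H ord) {o : GraphUpdate n k} (ho : o.Turns G G') :
    Runs w (spaceBound V D n) ((homStructure π ord r).updateProg o)
      (updateCost π ord * D ^ (Fintype.card V ^ 2)) (Stored π D g₀ B G')
      (DynamicStructure.updateCall s o) := by
  cases o with
  | add u v c =>
    obtain ⟨h0, h1, h2⟩ := withArgs_reg s u v c
    exact runs_addProg hw hD hB (hst.withArgs u v c) hGD' hord ho.2.1 ho.2.2.2 h0 h1 h2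
  | remove u v =>
    obtain ⟨h0, h1, h2⟩ := withArgs_reg s u v 0
    refine (runs_removeProg hw hD hB (hst.withArgs u v 0) hGD hord ho.1 ho.2 h0 h1).imp
      (Nat.mul_le_mul_right _ ?_) fun _ h => h
    unfold updateCost
    omega
  | reorient u v =>
    obtain ⟨h0, h1, h2⟩ := withArgs_reg s u v 0
    exact runs_reorientProg hw hD hB (hst.withArgs u v 0) hGD hGD' hord ho.1 ho.2 h0 h1
  | recolor u v c =>
    obtain ⟨h0, h1, h2⟩ := withArgs_reg s u v c
    exact runs_recolorProg hw hD hB (hst.withArgs u v c) hGD hord ho.1 ho.2 h0 h1 h2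

theorem _root_.WordRAM.Runs.of_exec {S S' T t : ℕ} {p : Prog} {Q : State → Prop} {s' : State}
    (h : Runs w S p T Q s) (he : Exec w S' p s t s') : Q s' := by
  obtain ⟨t', s'', _, he', hq⟩ := h
  exact he.deterministic he' ▸ hq

/-- By determinism, every run that occurs in the history ends where the verified run ends, so the
invariant holds whatever space bounds the history was recorded with. The input cells stay in memory
and are accounted for by `B`. -/
theorem stored_of_represents [Nonempty V] (hw : WordSize k V n w) (hD : 0 < D) (h3 : 3 < 2 ^ w)
    (hr : ∀ v, H.Reach r v) (hord : IsEvalOrder H ord)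
    (h : (homStructure π ord r).Represents w D G s) :
    G.InDegreeLE D ∧ ∃ (g₀ : ℕ → ℕ) (B : Finset ℕ), B.card ≤ 3 * (D * n) ∧ Stored π D g₀ B G s := by
  induction h with
  | build hGD hes hrun =>
    exact ⟨hGD, _, _, card_input_le hes hGD, (runs_buildProg hw hD hes hGD hord hr h3).of_exec hrun⟩
  | update _ ho hGD' hrun ih =>
    obtain ⟨hGD, g₀, B, hB, hst⟩ := ih
    exact ⟨hGD', g₀, B, hB, (runs_updateProg hw hD hB hst hGD hGD' hord ho).of_exec hrun⟩
  | queryAll _ hrun ih =>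
    obtain ⟨hGD, g₀, B, hB, hst⟩ := ih
    exact ⟨hGD, g₀, B, hB, ((runs_queryAllProg hw hst le_rfl hr).of_exec hrun).1⟩
  | @queryAt G v _ _ s _ _ hrun ih =>
    obtain ⟨hGD, g₀, B, hB, hst⟩ := ih
    exact ⟨hGD, g₀, B, hB, ((runs_queryAtProg hw (hst.withArgs v 0 0) le_rfl hr
      (withArgs_reg s v 0 0).1).of_exec hrun).1⟩

end ColoredDigraph

/-! ### Assembly of the theorem. -/

open ColoredDigraph in
theorem mainTheorem2 {V : Type*} [Fintype V] {k : ℕ} (H : ColoredDigraph k V) (T : V → V → Prop)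
    (r : V) (hHT : IsElderVineyard H T r) :
    ∃ (P : DynamicStructure) (c K : ℕ), ∀ n D w : ℕ, 0 < n → 0 < D → (n + 2) ^ K ≤ 2 ^ w →
      -- building the structure for a graph given by a list of its edges
      (∀ (G : ColoredDigraph k (Fin n)) (es : List (Fin n × Fin n × Fin (k + 1))),
        G.InDegreeLE D → ListsEdges es G →
          (WordRAM.input es).space ≤ c * (D ^ Fintype.card V * n) ∧
          ∃ t s, t ≤ c * (D ^ (Fintype.card V ^ 2 + 1) * n) ∧
            WordRAM.Exec w (c * (D ^ Fintype.card V * n)) P.build (WordRAM.input es) t s) ∧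
      (∀ (G : ColoredDigraph k (Fin n)) (s : WordRAM.State), P.Represents w D G s →
        -- space
        s.space ≤ c * (D ^ Fintype.card V * n) ∧
        -- addition, removal, reorientation and recolouring of an edge
        (∀ (o : GraphUpdate n k) (G' : ColoredDigraph k (Fin n)),
          o.Turns G G' → G'.InDegreeLE D →
            ∃ t s', t ≤ c * D ^ (Fintype.card V ^ 2) ∧
              WordRAM.Exec w (c * (D ^ Fintype.card V * n)) (P.updateProg o)
                (DynamicStructure.updateCall s o) t s') ∧
        -- the query for the number of all homomorphisms
        (∃ t s', t ≤ c ∧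
          WordRAM.Exec w (c * (D ^ Fintype.card V * n)) P.queryAll s t s' ∧
            s'.reg 0 = H.hom G) ∧
        -- the query for the number of homomorphisms that map the root to a given vertex
        (∀ v : Fin n, ∃ t s', t ≤ c ∧
          WordRAM.Exec w (c * (D ^ Fintype.card V * n)) P.queryAt (s.withArgs v 0 0) t s' ∧
            s'.reg 0 = H.homAt r G v)) := by
  have hne : Nonempty V := ⟨r⟩
  -- The walks of the spanning outbranching are walks of `H`, so the root has no ghosts and its
  -- tables contain the answers.
  have hr : ∀ v, H.Reach r v := fun v =>
    Relation.ReflTransGen.mono (fun a b => hHT.subgraph a b) _ _ (hHT.outbranching.reach v)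
  let π : ∀ c, H.EvalPlan c := fun c => (hHT.elder.nonempty_evalPlan c).some
  obtain ⟨ord, hord⟩ := exists_isEvalOrder H
  -- One constant for the space, the building, the updates and the 10 steps of a query.
  set c := (2 * Fintype.card V + 7) + buildCost π ord r + updateCost π ord + 10 with hc
  refine ⟨homStructure π ord r, c, wordExponent k V, fun n D w hn hD hnw => ?_⟩
  have hw : WordSize k V n w := wordSize_of_le hn hnw
  -- The program `prepare` uses the constant 3, which must be a word; already the square of `n + 2`
  -- exceeds it.
  have h3 : 3 < 2 ^ w := by
    refine lt_of_lt_of_le ?_ ((Nat.pow_le_pow_right (by omega) (show 2 ≤ wordExponent k V by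
      unfold wordExponent; omega)).trans hnw)
    nlinarith
  have hsp : spaceBound V D n ≤ c * (D ^ Fintype.card V * n) := Nat.mul_le_mul_right _ (by omega)
  constructor
  · intro G es hGD hes
    refine ⟨?_, ?_⟩
    · refine le_trans ((card_input_le hes hGD).trans ?_) hsp
      exact Nat.mul_le_mul (by omega)
        (Nat.mul_le_mul_right _ (Nat.le_self_pow Fintype.card_ne_zero D))
    · obtain ⟨t, s, ht, he, _⟩ := runs_buildProg (π := π) hw hD hes hGD hord hr h3
      exact ⟨t, s, ht.trans (Nat.mul_le_mul_right _ (by omega)), he.mono hsp⟩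
  · intro G s hs
    obtain ⟨hGD, g₀, B, hB, hst⟩ := stored_of_represents hw hD h3 hr hord hs
    have hspace := (hst.space_le hD hGD hB).trans hsp
    refine ⟨hspace, fun o G' ho hGD' => ?_, ?_, fun v => ?_⟩
    · obtain ⟨t, s', ht, he, _⟩ := runs_updateProg (r := r) hw hD hB hst hGD hGD' hord ho
      exact ⟨t, s', ht.trans (Nat.mul_le_mul_right _ (by omega)), he.mono hsp⟩
    · obtain ⟨t, s', ht, he, _, h⟩ := runs_queryAllProg hw hst hspace hr
      exact ⟨t, s', by omega, he, h⟩
    · obtain ⟨t, s', ht, he, _, h⟩ := runs_queryAtProg hw (hst.withArgs v 0 0) hspace hr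
        (withArgs_reg s v 0 0).1
      exact ⟨t, s', by omega, he, h⟩
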